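/- Work on a word RAM with unit-cost instructions (constants, arithmetic, bitwise operations and comparisons on words, indirect reads and writes, branching and loops), where on a graph with $n$ vertices and weight bound $M$ every word has $O(\log(n+M))$ bits and memory outside the input is initially $0$. An instance consists of integers $n\ge 0$, $M\ge 1$ and a simple undirected graph on $n$ vertices with integral edge weights in $[1,M]$, given by $n$, $M$ and its weighted adjacency matrix. In the minimum cycle problem one has to output (the vertices, in cyclic order, of) a simple cycle of minimum total edge weight, or to report that the graph has no cycle; in the minimum triangle problem one has to output a triangle (a simple cycle with three edges) of minimum total edge weight, or to report that there is none. A "$T(n,M)$ time algorithm" is a program that halts with a correct output on all instances, and after at most $T(n,M)$ steps on all instances with $n\ge 2$. Here $T$ is an arbitrary real-valued function. 1. There are absolute constants $a,b,C\in\mathbb N$ such that, for every $T$: if there is a $T(n,M)$ time algorithm for the minimum cycle problem, then there is an algorithm for the minimum triangle problem that runs in time $$T(an,bM)+C\,n^2 .$$ 2. Conversely, there are absolute constants $a,b,C\in\mathbb N$ such that, for every $T$: if there is a $T(n,M)$ time algorithm for the minimum triangle problem, then there is an algorithm for the minimum cycle problem that runs in time $$C\bigl(T(an,bM)\log n+n^2\,\log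 n\,\log (nM)\bigr).$$ -/

import Mathlib

/-! ## A word RAM

The machine has scalar registers and arrays, both named by natural numbers; a program mentions only
finitely many names. Registers and array cells hold machine words. -/

namespace WordRAM

/-- The machine state: contents of the registers and of the arrays. -/
@[ext]
structure State where
  reg : ℕ → ℕ
  arr : ℕ → ℕ → ℕ

namespace State

/-- Write the word `v` to register `x`. -/
def setReg (s : State) (x v : ℕ) : State :=
  { s with reg := Function.update s.reg x v }

/-- Write the word `v` to the cell with index `i` of array `a`. -/
def setArr (s : State) (a i v : ℕ) : State :=
  { s with arr := Function.update s.arr a (Function.update (s.arr a) i v) }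

end State

/-- The binary operations on words. -/
inductive Op where
  | add | sub | mul | div | mod | and | or | xor | shl | shr | lt | eq

/-- The value of an operation: subtraction is cut off at `0`, division by `0` gives `0`, and
comparisons return `1` for true and `0` for false. -/
def Op.eval : Op → ℕ → ℕ → ℕ
  | .add, u, v => u + v
  | .sub, u, v => u - v
  | .mul, u, v => u * v
  | .div, u, v => u / v
  | .mod, u, v => u % v
  | .and, u, v => u &&& v
  | .or, u, v => u ||| v
  | .xor, u, v => u ^^^ v
  | .shl, u, v => u <<< v
  | .shr, u, v => u >>> v
  | .lt, u, v => if u < v then 1 else 0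
  | .eq, u, v => if u = v then 1 else 0

/-- Programs. Here `x y z i` are registers and `a` is an array. -/
inductive Prog where
  /-- do nothing -/
  | skip : Prog
  /-- `x := k` for a constant `k` -/
  | const (x k : ℕ) : Prog
  /-- `x := y o z` -/
  | op (o : Op) (x y z : ℕ) : Prog
  /-- `x := a[i]` -/
  | load (x a i : ℕ) : Prog
  /-- `a[i] := x` -/
  | store (a i x : ℕ) : Prog
  /-- first `p`, then `q` -/
  | seq (p q : Prog) : Prog
  /-- `if x ≠ 0 then p else q` -/
  | ite (x : ℕ) (p q : Prog) : Prog
  /-- `while x ≠ 0 do p` -/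
  | loop (x : ℕ) (p : Prog) : Prog

/-- `Exec B p s t s'`: started in state `s`, the program `p` halts after exactly `t` steps in state
`s'`, and every word that it computes on the way is less than `B`. Each instruction and each
evaluation of a branch or loop condition is one step. A program that computes a word `≥ B` is stuck,
i.e. it has no execution. -/
inductive Exec (B : ℕ) : Prog → State → ℕ → State → Prop
  | skip (s : State) : Exec B .skip s 1 s
  | const (s : State) (x k : ℕ) (hk : k < B) : Exec B (.const x k) s 1 (s.setReg x k)
  | op (s : State) (o : Op) (x y z : ℕ) (ho : o.eval (s.reg y) (s.reg z) < B) :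
      Exec B (.op o x y z) s 1 (s.setReg x (o.eval (s.reg y) (s.reg z)))
  | load (s : State) (x a i : ℕ) :
      Exec B (.load x a i) s 1 (s.setReg x (s.arr a (s.reg i)))
  | store (s : State) (a i x : ℕ) :
      Exec B (.store a i x) s 1 (s.setArr a (s.reg i) (s.reg x))
  | seq {p q : Prog} {s₁ s₂ s₃ : State} {t₁ t₂ : ℕ} (hp : Exec B p s₁ t₁ s₂)
      (hq : Exec B q s₂ t₂ s₃) : Exec B (.seq p q) s₁ (t₁ + t₂) s₃
  | iteTrue {x : ℕ} {p q : Prog} {s₁ s₂ : State} {t : ℕ} (hx : s₁.reg x ≠ 0)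
      (hp : Exec B p s₁ t s₂) : Exec B (.ite x p q) s₁ (t + 1) s₂
  | iteFalse {x : ℕ} {p q : Prog} {s₁ s₂ : State} {t : ℕ} (hx : s₁.reg x = 0)
      (hq : Exec B q s₁ t s₂) : Exec B (.ite x p q) s₁ (t + 1) s₂
  | loopStop {x : ℕ} {p : Prog} {s : State} (hx : s.reg x = 0) : Exec B (.loop x p) s 1 s
  | loopStep {x : ℕ} {p : Prog} {s₁ s₂ s₃ : State} {t₁ t₂ : ℕ} (hx : s₁.reg x ≠ 0)
      (hp : Exec B p s₁ t₁ s₂) (hl : Exec B (.loop x p) s₂ t₂ s₃) :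
      Exec B (.loop x p) s₁ (t₁ + t₂ + 1) s₃

end WordRAM

/-! ## Minimum weight cycles and triangles -/

/-- A simple undirected graph on `n` vertices with integral edge weights in `[1, M]`. -/
structure WGraph (n M : ℕ) where
  graph : SimpleGraph (Fin n)
  weight : Sym2 (Fin n) → ℕ
  weight_mem : ∀ e ∈ graph.edgeSet, 1 ≤ weight e ∧ weight e ≤ M

namespace WGraph

variable {n M : ℕ}

/-- The weight of a walk: the sum of the weights of its edges. -/
def walkWeight (G : WGraph n M) {u v : Fin n} (c : G.graph.Walk u v) : ℕ :=
  (c.edges.map G.weight).sum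

/-- `c` has minimum weight among all simple cycles of `G`. -/
def IsMinCycle (G : WGraph n M) {v : Fin n} (c : G.graph.Walk v v) : Prop :=
  c.IsCycle ∧ ∀ (u : Fin n) (d : G.graph.Walk u u), d.IsCycle → G.walkWeight c ≤ G.walkWeight d

/-- `c` has minimum weight among all triangles of `G`, i.e. simple cycles with three edges. -/
def IsMinTriangle (G : WGraph n M) {v : Fin n} (c : G.graph.Walk v v) : Prop :=
  (c.IsCycle ∧ c.length = 3) ∧ ∀ (u : Fin n) (d : G.graph.Walk u u),
    d.IsCycle → d.length = 3 → G.walkWeight c ≤ G.walkWeight d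

open Classical in
/-- The entry of the weighted adjacency matrix: the weight of the edge `ij`, or `0` for a non-edge. -/
noncomputable def entry (G : WGraph n M) (i j : Fin n) : ℕ :=
  if G.graph.Adj i j then G.weight s(i, j) else 0

/-- The initial state on input `G`: `n` is in register `0`, `M` is in register `1`, the weighted
adjacency matrix is stored row by row in array `0`, and all other memory is `0`. -/
noncomputable def input (G : WGraph n M) : WordRAM.State where
  reg x := if x = 0 then n else if x = 1 then M else 0
  arr a k := if h : a = 0 ∧ k < n * n then
    G.entry (⟨k, h.2⟩ : Fin (n * n)).divNat (⟨k, h.2⟩ : Fin (n * n)).modNat else 0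

end WGraph

/-- The output in a final state: register `0` holds its length and array `1` its members. -/
def WordRAM.State.output (s : WordRAM.State) : List ℕ :=
  (List.range (s.reg 0)).map (s.arr 1)

/-- A correct output for the minimum cycle problem: the vertices of a minimum weight cycle in cyclic
order, or the empty list if the graph has no cycle. -/
def MinCycleOutput {n M : ℕ} (G : WGraph n M) (out : List ℕ) : Prop :=
  (out = [] ∧ G.graph.IsAcyclic) ∨
    ∃ (v : Fin n) (c : G.graph.Walk v v), G.IsMinCycle c ∧ out = c.support.tail.map Fin.val

/-- A correct output for the minimum triangle problem: the vertices of a minimum weight triangle, or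
the empty list if the graph has no triangle. -/
def MinTriangleOutput {n M : ℕ} (G : WGraph n M) (out : List ℕ) : Prop :=
  (out = [] ∧ ∀ (v : Fin n) (c : G.graph.Walk v v), c.IsCycle → c.length ≠ 3) ∨
    ∃ (v : Fin n) (c : G.graph.Walk v v), G.IsMinTriangle c ∧ out = c.support.tail.map Fin.val

/-- `P` solves a problem (given by its correct outputs) on all undirected graphs with integral edge
weights in `[1, M]`, `M ≥ 1`, in time `T n M` for `n ≥ 2`, on words of `O(log (n + M))` bits: all
words are less than `(n + M + 1) ^ c` for a constant `c`. -/
def SolvesInTime (Correct : ∀ {n M : ℕ}, WGraph n M → List ℕ → Prop) (P : WordRAM.Prog)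
    (T : ℕ → ℕ → ℝ) : Prop :=
  ∃ c : ℕ, ∀ (n M : ℕ), 1 ≤ M → ∀ G : WGraph n M, ∃ (t : ℕ) (s : WordRAM.State),
    WordRAM.Exec ((n + M + 1) ^ c) P G.input t s ∧ Correct G s.output ∧
      (2 ≤ n → (t : ℝ) ≤ T n M)

/-! ### The machine model: bounded words, monotonicity, frames -/

namespace WordRAM

/-! Triangles from cycles: add `3M` to every weight, so that all weights lie in `(3M, 4M]`. A
triangle then weighs at most `12M`, and a cycle with four or more edges weighs more. Hence a minimum
cycle of the raised graph is a minimum triangle whenever there is a triangle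
(`WGraph.minTriangleOutput_of_raise`).

Cycles from triangles: explore the graph from every vertex `s` up to a threshold `t` and stop at the
first edge that joins two visited vertices and is not a parent edge. With sorted adjacency lists one
exploration takes `O(n)` steps, however many edges there are, since every scanned edge adds a
vertex, leads to the parent, or ends the list or the search (`WordRAM.run_explore`). If no
exploration stops, the explored regions are trees, and a tree follows every path without
backtracking up to the threshold (`WGraph.PTree.follow`). The parameter `b` selects the rule for an
edge `uv` out of `u`: for `b = 1` the far end has to be within the threshold, for `b = 0` only `u`
itself.

Binary search with `b = 1` yields `t` such that nothing is found at `t` (or `t = 0`) but something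
at `t + 1`; with `b = 0` it yields `r` such that the minimum weight `W` satisfies `2r < W ≤ 2r + 2 +
2M`. If `W ≥ 2t + 2`, the closing edge found at `t + 1` already gives a cycle of weight at most `2t
+ 2`, which is optimal (`WordRAM.Stopped.best`). Otherwise `W ≤ 2t + 1`. Place the root `s` just
before a heaviest edge of a minimum cycle. The edge `xy` that contains the midpoint then has both
ends different from `s`; they are reached in the tree of `s` through different children of `s`, and
`D x + D y + w(xy) = W` (`WGraph.Cyc.exists_triple`).

Finding such a triple `(s, x, y)` is a triangle problem. Label each visited vertex other than the
root with one more than the child of the root above it; different labels differ in one of `O(log n)`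
bits. For each bit, take a tripartite graph on roots, vertices with bit `0` and vertices with bit
`1`. The distances that matter lie in a window of width `O(M)` known from `r`, so subtracting `r - M
- 1` from them leaves leg weights in `[1, 4M]` (`WordRAM.exists_cand`). Conversely, in every
triangle of such a graph `xy` is not a tree edge, so there is a cycle no heavier than the triple
(`WordRAM.Cand.closing`, `WGraph.PTree.exists_cycle`).

The given triangle program is simulated once per bit. The runs use different residue classes of
memory addresses, so each of them starts with memory that is still zero (`WordRAM.Exec.run_sim`).
Sorting and the two searches cost `O(n² log (nM))`, and the rounds cost `O(log n)` times `n² + T(3n,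
4M)`. -/

@[simp] theorem State.setReg_reg (s : State) (x v y : ℕ) :
    (s.setReg x v).reg y = if y = x then v else s.reg y := by
  simp [State.setReg, Function.update_apply]

@[simp] theorem State.setReg_arr (s : State) (x v : ℕ) : (s.setReg x v).arr = s.arr := rfl

@[simp] theorem State.setArr_reg (s : State) (a i v : ℕ) : (s.setArr a i v).reg = s.reg := rfl

@[simp] theorem State.setArr_arr (s : State) (a i v b : ℕ) :
    (s.setArr a i v).arr b = if b = a then Function.update (s.arr a) i v else s.arr b := by
  simp [State.setArr, Function.update_apply]

/-- All words of the state are less than `B`. -/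
def State.Bounded (B : ℕ) (s : State) : Prop :=
  (∀ x, s.reg x < B) ∧ ∀ a i, s.arr a i < B

theorem State.Bounded.setReg {B : ℕ} {s : State} (h : s.Bounded B) {x v : ℕ} (hv : v < B) :
    (s.setReg x v).Bounded B := by
  refine ⟨fun y => ?_, h.2⟩
  rw [State.setReg_reg]; split_ifs
  exacts [hv, h.1 y]

theorem State.Bounded.setArr {B : ℕ} {s : State} (h : s.Bounded B) {a i v : ℕ} (hv : v < B) :
    (s.setArr a i v).Bounded B := by
  refine ⟨h.1, fun b j => ?_⟩
  rw [State.setArr_arr]; split_ifs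
  · rw [Function.update_apply]; split_ifs
    exacts [hv, h.2 _ j]
  · exact h.2 b j

/-- Loads and stores carry no bound of their own; they only move words that are already in memory,
and every computed word is checked. -/
theorem Exec.bounded {B : ℕ} {p : Prog} {s s' : State} {t : ℕ} (h : Exec B p s t s') :
    s.Bounded B → s'.Bounded B := by
  induction h with
  | skip => exact id
  | const s x k hk => exact fun hs => hs.setReg hk
  | op s o x y z ho => exact fun hs => hs.setReg ho
  | load s x a i => exact fun hs => hs.setReg (hs.2 _ _)
  | store s a i x => exact fun hs => hs.setArr (hs.1 _)
  | seq _ _ h1 h2 => exact fun hs => h2 (h1 hs)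
  | iteTrue _ _ h1 => exact h1
  | iteFalse _ _ h1 => exact h1
  | loopStop => exact id
  | loopStep _ _ _ h1 h2 => exact fun hs => h2 (h1 hs)

/-- Lets a given program, certified for its own word size, run inside a program that is allowed
larger words. -/
theorem Exec.mono {B B' : ℕ} (hB : B ≤ B') {p : Prog} {s s' : State} {t : ℕ}
    (h : Exec B p s t s') : Exec B' p s t s' := by
  induction h with
  | skip => exact .skip _
  | const s x k hk => exact .const _ _ _ (hk.trans_le hB)
  | op s o x y z ho => exact .op _ _ _ _ _ (ho.trans_le hB)
  | load s x a i => exact .load _ _ _ _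
  | store s a i x => exact .store _ _ _ _
  | seq _ _ h1 h2 => exact .seq h1 h2
  | iteTrue hx _ h1 => exact .iteTrue hx h1
  | iteFalse hx _ h1 => exact .iteFalse hx h1
  | loopStop hx => exact .loopStop hx
  | loopStep hx _ _ h1 h2 => exact .loopStep hx h1 h2

/-- The registers that a program may write. -/
def Prog.wregs : Prog → List ℕ
  | .skip => []
  | .const x _ => [x]
  | .op _ x _ _ => [x]
  | .load x _ _ => [x]
  | .store _ _ _ => []
  | .seq p q => p.wregs ++ q.wregs
  | .ite _ p q => p.wregs ++ q.wregs
  | .loop _ p => p.wregs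

/-- A syntactic frame rule that also covers the temporary registers hidden by `Rel`. It is needed
where the whole memory has to be known exactly before the given program is started. -/
theorem Exec.reg_eq {B : ℕ} {p : Prog} {s s' : State} {t : ℕ} (h : Exec B p s t s') (x : ℕ) :
    x ∉ p.wregs → s'.reg x = s.reg x := by
  induction h <;> simp_all [Prog.wregs]

/-! ### Expressions -/

/-- Expressions over registers and array cells. -/
inductive Expr where
  | var (x : ℕ)
  | lit (k : ℕ)
  | bin (o : Op) (e f : Expr)
  | get (a : ℕ) (e : Expr)

namespace Expr

instance : Add Expr := ⟨bin .add⟩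
instance : Sub Expr := ⟨bin .sub⟩
instance : Mul Expr := ⟨bin .mul⟩
instance : Div Expr := ⟨bin .div⟩
instance : Mod Expr := ⟨bin .mod⟩
instance (k : ℕ) : OfNat Expr k := ⟨lit k⟩

/-- The comparison `e < f`. -/
abbrev lt (e f : Expr) : Expr := bin .lt e f

/-- The comparison `e = f`. -/
abbrev eq (e f : Expr) : Expr := bin .eq e f

/-- The value of an expression. -/
def eval (h : State) : Expr → ℕ
  | var x => h.reg x
  | lit k => k
  | bin o e f => o.eval (e.eval h) (f.eval h)
  | get a e => h.arr a (e.eval h)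

/-- The condition on an operation that guarantees that its value is a word. -/
def OpOk (B : ℕ) : Op → ℕ → ℕ → Prop
  | .add, u, v => u + v < B
  | .mul, u, v => u * v < B
  | .or, u, v => u ||| v < B
  | .xor, u, v => u ^^^ v < B
  | .shl, u, v => u <<< v < B
  | .lt, _, _ => 1 < B
  | .eq, _, _ => 1 < B
  | _, _, _ => True

/-- The expression can be evaluated on words less than `B`. -/
def Ok (B : ℕ) (h : State) : Expr → Prop
  | var x => x ≤ 100
  | lit k => k < B
  | bin o e f => e.Ok B h ∧ f.Ok B h ∧ OpOk B o (e.eval h) (f.eval h)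
  | get _ e => e.Ok B h

/-- The number of steps for evaluating an expression. -/
def cost : Expr → ℕ
  | var _ => 1
  | lit _ => 1
  | bin _ e f => e.cost + (f.cost + 1)
  | get _ e => e.cost + 1

/-- Evaluate the expression into the register `101 + 2 * d`. -/
def code : Expr → ℕ → Prog
  -- Since `x ||| x = x`, bitwise or copies a register.
  | var x, d => .op .or (101 + 2 * d) x x
  | lit k, d => .const (101 + 2 * d) k
  | bin o e f, d =>
    .seq (e.code d) (.seq (f.code (d + 1)) (.op o (101 + 2 * d) (101 + 2 * d) (101 + 2 * (d + 1))))
  | get a e, d => .seq (e.code d) (.load (101 + 2 * d) a (101 + 2 * d))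

variable (h : State) (B : ℕ) (e f : Expr) (x k a : ℕ)

@[simp] theorem eval_var : (var x).eval h = h.reg x := rfl
@[simp] theorem eval_ofNat : (no_index (OfNat.ofNat k) : Expr).eval h = k := rfl
@[simp] theorem eval_get : (get a e).eval h = h.arr a (e.eval h) := rfl
@[simp] theorem eval_add : (e + f).eval h = e.eval h + f.eval h := rfl
@[simp] theorem eval_sub : (e - f).eval h = e.eval h - f.eval h := rfl
@[simp] theorem eval_mul : (e * f).eval h = e.eval h * f.eval h := rfl
@[simp] theorem eval_div : (e / f).eval h = e.eval h / f.eval h := rfl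
@[simp] theorem eval_mod : (e % f).eval h = e.eval h % f.eval h := rfl
@[simp] theorem eval_lt : (e.lt f).eval h = if e.eval h < f.eval h then 1 else 0 := rfl
@[simp] theorem eval_eq : (e.eq f).eval h = if e.eval h = f.eval h then 1 else 0 := rfl
@[simp] theorem ok_var : (var x).Ok B h ↔ x ≤ 100 := Iff.rfl
@[simp] theorem ok_ofNat : (no_index (OfNat.ofNat k) : Expr).Ok B h ↔ k < B := Iff.rfl
@[simp] theorem ok_get : (get a e).Ok B h ↔ e.Ok B h := Iff.rfl
@[simp] theorem ok_add : (e + f).Ok B h ↔ e.Ok B h ∧ f.Ok B h ∧ e.eval h + f.eval h < B := Iff.rfl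
@[simp] theorem ok_mul : (e * f).Ok B h ↔ e.Ok B h ∧ f.Ok B h ∧ e.eval h * f.eval h < B := Iff.rfl
@[simp] theorem ok_sub : (e - f).Ok B h ↔ e.Ok B h ∧ f.Ok B h :=
  show _ ∧ _ ∧ True ↔ _ by simp
@[simp] theorem ok_div : (e / f).Ok B h ↔ e.Ok B h ∧ f.Ok B h :=
  show _ ∧ _ ∧ True ↔ _ by simp
@[simp] theorem ok_mod : (e % f).Ok B h ↔ e.Ok B h ∧ f.Ok B h :=
  show _ ∧ _ ∧ True ↔ _ by simp
@[simp] theorem ok_lt : (e.lt f).Ok B h ↔ e.Ok B h ∧ f.Ok B h ∧ 1 < B := Iff.rfl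
@[simp] theorem ok_eq : (e.eq f).Ok B h ↔ e.Ok B h ∧ f.Ok B h ∧ 1 < B := Iff.rfl

end Expr

/-- Registers that hold intermediate values of expressions. -/
def IsTemp (x : ℕ) : Prop := 101 ≤ x ∧ x % 2 = 1

/-- The concrete state `s` agrees with the abstract state `h` apart from temporary registers. -/
structure Rel (B : ℕ) (s h : State) : Prop where
  arr : s.arr = h.arr
  reg : ∀ x, ¬ IsTemp x → s.reg x = h.reg x
  bdd : s.Bounded B

/-- Subtraction, division, remainder, bitwise and, and right shift never exceed their left operand,
so for them `u < B` suffices; the other operations carry their condition in `OpOk`. -/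
theorem OpOk.eval_lt {B : ℕ} {o : Op} {u v : ℕ} (h : Expr.OpOk B o u v) (hu : u < B) :
    o.eval u v < B := by
  cases o <;> simp only [Expr.OpOk, Op.eval] at h ⊢
  · exact h
  · omega
  · exact h
  · exact (Nat.div_le_self _ _).trans_lt hu
  · exact (Nat.mod_le _ _).trans_lt hu
  · exact Nat.and_le_left.trans_lt hu
  · exact h
  · exact h
  · exact h
  · rw [Nat.shiftRight_eq_div_pow]; exact (Nat.div_le_self _ _).trans_lt hu
  · split_ifs <;> omega
  · split_ifs <;> omega

/-- The registers `101 + 2 * d` form an evaluation stack. The last conjunct is what makes the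
induction work: the value of the first operand survives while the second one is evaluated one level
higher. -/
theorem Expr.exec_code {B : ℕ} {h : State} (e : Expr) : ∀ {s : State} (d : ℕ), Rel B s h →
    e.Ok B h → ∃ s', Exec B (e.code d) s e.cost s' ∧ Rel B s' h ∧
      s'.reg (101 + 2 * d) = e.eval h ∧ e.eval h < B ∧
      ∀ d' < d, s'.reg (101 + 2 * d') = s.reg (101 + 2 * d') := by
  have hT : ∀ d x, ¬ IsTemp x → x ≠ 101 + 2 * d := by
    intro d x hx h; apply hx; constructor <;> omega
  have key : ∀ {s : State} (d v : ℕ), Rel B s h → v < B →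
      Rel B (s.setReg (101 + 2 * d) v) h := by
    intro s d v hr hv
    refine ⟨hr.arr, fun x hx => ?_, hr.bdd.setReg hv⟩
    rw [State.setReg_reg, if_neg (hT d x hx), hr.reg x hx]
  induction e with
  | var x =>
    intro s d hr hok
    have hx : s.reg x = h.reg x := hr.reg x (by intro h1; have := h1.1; simp at hok; omega)
    have hlt : h.reg x < B := hx ▸ hr.bdd.1 x
    have ho : Op.or.eval (s.reg x) (s.reg x) = h.reg x := by simp [Op.eval, hx]
    refine ⟨_, .op s .or _ x x (by rw [ho]; exact hlt), ?_, ?_, hlt, ?_⟩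
    · rw [ho]; exact key _ _ hr hlt
    · simp [ho]
    · intro d' hd'; rw [State.setReg_reg, if_neg (by omega)]
  | lit k =>
    intro s d hr hok
    refine ⟨_, .const s _ k hok, key _ _ hr hok, by simp [Expr.eval], hok, ?_⟩
    intro d' hd'; rw [State.setReg_reg, if_neg (by omega)]
  | bin o e f ihe ihf =>
    intro s d hr hok
    obtain ⟨s1, h1, r1, v1, l1, f1⟩ := ihe d hr hok.1
    obtain ⟨s2, h2, r2, v2, l2, f2⟩ := ihf (d + 1) r1 hok.2.1
    have hv : (Expr.bin o e f).eval h < B := OpOk.eval_lt hok.2.2 l1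
    have ho : o.eval (s2.reg (101 + 2 * d)) (s2.reg (101 + 2 * (d + 1))) =
        (Expr.bin o e f).eval h := by
      rw [v2, f2 d (by omega), v1]; rfl
    refine ⟨_, .seq h1 (.seq h2 (.op s2 o _ _ _ (by rw [ho]; exact hv))), ?_, ?_, hv, ?_⟩
    · rw [ho]; exact key _ _ r2 hv
    · simp [ho]
    · intro d' hd'
      rw [State.setReg_reg, if_neg (by omega), f2 d' (by omega), f1 d' hd']
  | get a e ih =>
    intro s d hr hok
    obtain ⟨s1, h1, r1, v1, l1, f1⟩ := ih d hr hok
    have ho : s1.arr a (s1.reg (101 + 2 * d)) = (Expr.get a e).eval h := by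
      rw [v1, r1.arr]; rfl
    have hv : (Expr.get a e).eval h < B := ho ▸ r1.bdd.2 _ _
    refine ⟨_, .seq h1 (.load s1 _ a _), ?_, ?_, hv, ?_⟩
    · rw [ho]; exact key _ _ r1 hv
    · simp [ho]
    · intro d' hd'
      rw [State.setReg_reg, if_neg (by omega), f1 d' hd']

/-! ### Running programs -/

/-- Started in the abstract state `h`, the program halts after at most `T` steps in an abstract state
that satisfies `Q`. -/
def Run (B : ℕ) (p : Prog) (h : State) (T : ℕ) (Q : State → Prop) : Prop :=
  ∀ s, Rel B s h → ∃ t s' h', Exec B p s t s' ∧ t ≤ T ∧ Rel B s' h' ∧ Q h'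

theorem Run.conseq {B : ℕ} {p : Prog} {h : State} {T T' : ℕ} {Q Q' : State → Prop}
    (hr : Run B p h T Q) (hT : T ≤ T') (hQ : ∀ h', Q h' → Q' h') : Run B p h T' Q' := by
  intro s hs
  obtain ⟨t, s', h', he, ht, hr', hq⟩ := hr s hs
  exact ⟨t, s', h', he, ht.trans hT, hr', hQ _ hq⟩

theorem Run.seq {B : ℕ} {p q : Prog} {h : State} {T₁ T₂ : ℕ} {Q Q' : State → Prop}
    (hp : Run B p h T₁ Q) (hq : ∀ h', Q h' → Run B q h' T₂ Q') :
    Run B (.seq p q) h (T₁ + T₂) Q' := by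
  intro s hs
  obtain ⟨t, s', h', he, ht, hr', hh⟩ := hp s hs
  obtain ⟨t2, s2, h2, he2, ht2, hr2, hh2⟩ := hq h' hh s' hr'
  exact ⟨_, s2, h2, .seq he he2, by omega, hr2, hh2⟩

/-- `x := e` -/
def asg (x : ℕ) (e : Expr) : Prog := .seq (e.code 0) (.op .or x 101 101)

/-- `a[e] := f` -/
def put (a : ℕ) (e f : Expr) : Prog := .seq (e.code 0) (.seq (f.code 1) (.store a 101 103))

/-- `if e ≠ 0 then p else q` -/
def ifE (e : Expr) (p q : Prog) : Prog := .seq (e.code 0) (.ite 101 p q)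

/-- `while e ≠ 0 do p` -/
def whileE (e : Expr) (p : Prog) : Prog := .seq (e.code 0) (.loop 101 (.seq p (e.code 0)))

theorem Run.asg {B : ℕ} {x : ℕ} {e : Expr} {h : State} {Q : State → Prop}
    (hok : e.Ok B h) (hQ : Q (h.setReg x (e.eval h))) : Run B (asg x e) h (e.cost + 1) Q := by
  intro s hs
  obtain ⟨s1, h1, r1, v1, l1, -⟩ := e.exec_code 0 hs hok
  have ho : Op.or.eval (s1.reg 101) (s1.reg 101) = e.eval h := by
    have : s1.reg 101 = e.eval h := v1
    simp [Op.eval, this]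
  refine ⟨_, _, _, .seq h1 (.op s1 .or x 101 101 (by rw [ho]; exact l1)), le_rfl, ?_, hQ⟩
  rw [ho]
  refine ⟨r1.arr, fun y hy => ?_, r1.bdd.setReg l1⟩
  simp [r1.reg y hy]

theorem Run.put {B : ℕ} {a : ℕ} {e f : Expr} {h : State} {Q : State → Prop}
    (hok : e.Ok B h) (hok' : f.Ok B h) (hQ : Q (h.setArr a (e.eval h) (f.eval h))) :
    Run B (put a e f) h (e.cost + (f.cost + 1)) Q := by
  intro s hs
  obtain ⟨s1, h1, r1, v1, l1, -⟩ := e.exec_code 0 hs hok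
  obtain ⟨s2, h2, r2, v2, l2, f2⟩ := f.exec_code 1 r1 hok'
  have e1 : s2.reg 101 = e.eval h := by
    have := f2 0 (by omega)
    simp only [mul_zero, add_zero] at this v1
    rw [this, v1]
  have e2 : s2.reg 103 = f.eval h := v2
  refine ⟨_, _, _, .seq h1 (.seq h2 (.store s2 a 101 103)), le_rfl, ?_, hQ⟩
  rw [e1, e2]
  refine ⟨?_, r2.reg, r2.bdd.setArr l2⟩
  simp [State.setArr, r2.arr]

theorem Run.ifE {B : ℕ} {e : Expr} {p q : Prog} {h : State} {T : ℕ} {Q : State → Prop}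
    (hok : e.Ok B h) (hp : e.eval h ≠ 0 → Run B p h T Q) (hq : e.eval h = 0 → Run B q h T Q) :
    Run B (ifE e p q) h (e.cost + (T + 1)) Q := by
  intro s hs
  obtain ⟨s1, h1, r1, v1, l1, -⟩ := e.exec_code 0 hs hok
  have v1' : s1.reg 101 = e.eval h := v1
  by_cases hc : e.eval h = 0
  · obtain ⟨t, s', h', he, ht, hr', hh⟩ := hq hc s1 r1
    exact ⟨_, s', h', .seq h1 (.iteFalse (by rw [v1', hc]) he), by omega, hr', hh⟩
  · obtain ⟨t, s', h', he, ht, hr', hh⟩ := hp hc s1 r1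
    exact ⟨_, s', h', .seq h1 (.iteTrue (by rw [v1']; exact hc) he), by omega, hr', hh⟩

/-- The rule for loops: `I` is an invariant, and `Φ` bounds the remaining time. -/
theorem Run.whileE {B : ℕ} {e : Expr} {p : Prog} {h : State} (I : State → Prop)
    (Φ : State → ℕ) (T : ℕ) {Q : State → Prop} (hI : I h) (hok : ∀ h, I h → e.Ok B h)
    (hp : ∀ h, I h → e.eval h ≠ 0 →
      Run B p h T (fun h' => I h' ∧ Φ h' + (T + e.cost + 1) ≤ Φ h))
    (hQ : ∀ h, I h → e.eval h = 0 → Q h) :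
    Run B (whileE e p) h (Φ h + e.cost + 1) Q := by
  have key : ∀ N h s, Φ h ≤ N → I h → Rel B s h → s.reg 101 = e.eval h →
      ∃ t s' h', Exec B (.loop 101 (.seq p (e.code 0))) s t s' ∧ t ≤ Φ h + 1 ∧
        Rel B s' h' ∧ Q h' := by
    intro N
    induction N with
    | zero =>
      intro h s hN hI hr hv
      by_cases hc : e.eval h = 0
      · exact ⟨1, s, h, .loopStop (by rw [hv, hc]), by omega, hr, hQ h hI hc⟩
      -- Another iteration would lower the potential by at least one, but it is already zero.
      · obtain ⟨t, s', h', he, ht, hr', hI', hΦ⟩ := hp h hI hc s hr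
        omega
    | succ N ih =>
      intro h s hN hI hr hv
      by_cases hc : e.eval h = 0
      · exact ⟨1, s, h, .loopStop (by rw [hv, hc]), by omega, hr, hQ h hI hc⟩
      · obtain ⟨t, s', h', he, ht, hr', hI', hΦ⟩ := hp h hI hc s hr
        obtain ⟨s1, h1, r1, v1, l1, -⟩ := e.exec_code 0 hr' (hok h' hI')
        obtain ⟨t2, s2, h2, he2, ht2, hr2, hh2⟩ := ih h' s1 (by omega) hI' r1 v1
        exact ⟨_, s2, h2, .loopStep (by rw [hv]; exact hc) (.seq he h1) he2, by omega, hr2, hh2⟩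
  intro s hs
  obtain ⟨s1, h1, r1, v1, l1, -⟩ := e.exec_code 0 hs (hok h hI)
  obtain ⟨t, s', h', he, ht, hr', hh⟩ := key _ h s1 le_rfl hI r1 v1
  exact ⟨_, s', h', .seq h1 he, by omega, hr', hh⟩

/-- `for x := 0, …, e - 1 do p` -/
def forE (x : ℕ) (e : Expr) (p : Prog) : Prog :=
  .seq (asg x 0) (WordRAM.whileE (.lt (.var x) e) (.seq p (WordRAM.asg x (.var x + 1))))

/-- The potential is the number of remaining rounds times the cost of a round. The limit `e` is
evaluated again in every round, so the invariant has to fix its value. The `7` pays for the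
comparison, the increment and the loop itself. -/
theorem Run.forE {B x N : ℕ} {e : Expr} {p : Prog} {h : State} (J : ℕ → State → Prop)
    (T : ℕ) {Q : State → Prop} (hx : x ≤ 100) (hB : N + 1 < B) (h0 : J 0 (h.setReg x 0))
    (hlim : ∀ k h, k ≤ N → J k h → h.reg x = k → e.Ok B h ∧ e.eval h = N)
    (hp : ∀ k h, k < N → J k h → h.reg x = k →
      Run B p h T (fun h' => h'.reg x = k ∧ J (k + 1) (h'.setReg x (k + 1))))
    (hQ : ∀ h, J N h → h.reg x = N → Q h) :
    Run B (forE x e p) h (N * (T + e.cost + 7) + e.cost + 5) Q := by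
  have hw : ∀ h, J 0 h → h.reg x = 0 → Run B (WordRAM.whileE (.lt (.var x) e)
      (.seq p (WordRAM.asg x (.var x + 1)))) h (N * (T + e.cost + 7) + (e.cost + 2) + 1) Q := by
    intro h h0 hx0
    have := Run.whileE (B := B) (e := .lt (.var x) e)
      (p := .seq p (WordRAM.asg x (.var x + 1))) (h := h) (Q := Q)
      (fun h => ∃ k, k ≤ N ∧ J k h ∧ h.reg x = k) (fun h => (N - h.reg x) * (T + e.cost + 7))
      (T + 4) ⟨0, by omega, h0, hx0⟩ ?_ ?_ ?_
    · refine this.conseq ?_ (fun _ h => h)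
      simp only [hx0, Expr.cost, Nat.sub_zero]; omega
    · rintro h ⟨k, hk, hJ, hk'⟩
      simp [hx, (hlim k h hk hJ hk').1]; omega
    · rintro h ⟨k, hk, hJ, hk'⟩ hne
      have hl := (hlim k h hk hJ hk').2
      have hlt : k < N := by simpa [hl, hk'] using hne
      refine Run.seq (hp k h hlt hJ hk') (T₂ := 4) (fun h' hh' => ?_)
      refine Run.asg ?_ ?_
      · simp [hx, hh'.1]; omega
      · refine ⟨⟨k + 1, hlt, ?_, ?_⟩, ?_⟩
        · have := hh'.2; simpa [hh'.1] using this
        · simp [hh'.1]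
        · simp only [State.setReg_reg, if_true, Expr.eval_add, Expr.eval_var, hh'.1, hk']
          obtain ⟨m, rfl⟩ := Nat.exists_eq_add_of_lt hlt
          have h1 : (k + m + 1 - (k + Expr.eval h' 1)) = m := by simp
          have h2 : k + m + 1 - k = m + 1 := by omega
          rw [h1, h2, Nat.add_mul]
          simp only [Expr.cost]; omega
    · rintro h ⟨k, hk, hJ, hk'⟩ hz
      have hl := (hlim k h hk hJ hk').2
      have : k = N := by simp [hl, hk'] at hz; omega
      subst this
      exact hQ h hJ hk'
  have := Run.seq (B := B) (T₁ := 2)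
    (Run.asg (B := B) (x := x) (e := 0) (h := h) (Q := fun h' => J 0 h' ∧ h'.reg x = 0) 
      (by simp; omega) (by simpa using h0)) (fun h' hh' => hw h' hh'.1 hh'.2)
  refine this.conseq (by omega) (fun _ h => h)

/-! ### Loop-free blocks -/

/-- Loop-free programs. -/
inductive Stmt where
  | skip
  | asg (x : ℕ) (e : Expr)
  | put (a : ℕ) (e f : Expr)
  | seq (p q : Stmt)
  | ite (e : Expr) (p q : Stmt)

namespace Stmt

/-- The compiled block. -/
def code : Stmt → Prog
  | skip => .skip
  | asg x e => WordRAM.asg x e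
  | put a e f => WordRAM.put a e f
  | seq p q => .seq p.code q.code
  | ite e p q => ifE e p.code q.code

/-- A bound for the number of steps of a block. -/
def cost : Stmt → ℕ
  | skip => 1
  | asg _ e => e.cost + 1
  | put _ e f => e.cost + (f.cost + 1)
  | seq p q => p.cost + q.cost
  | ite e p q => e.cost + (max p.cost q.cost + 1)

/-- The weakest precondition of a block. -/
def wp (B : ℕ) : Stmt → (State → Prop) → State → Prop
  | skip, Q, h => Q h
  | asg x e, Q, h => e.Ok B h ∧ Q (h.setReg x (e.eval h))
  | put a e f, Q, h => e.Ok B h ∧ f.Ok B h ∧ Q (h.setArr a (e.eval h) (f.eval h))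
  | seq p q, Q, h => p.wp B (q.wp B Q) h
  | ite e p q, Q, h => e.Ok B h ∧ (e.eval h ≠ 0 → p.wp B Q h) ∧ (e.eval h = 0 → q.wp B Q h)

theorem run {B : ℕ} (st : Stmt) {Q : State → Prop} {h : State} (hw : st.wp B Q h) :
    Run B st.code h st.cost Q := by
  induction st generalizing Q h with
  | skip => exact fun s hs => ⟨1, s, h, .skip s, le_rfl, hs, hw⟩
  | asg x e => exact Run.asg hw.1 hw.2
  | put a e f => exact Run.put hw.1 hw.2.1 hw.2.2
  | seq p q ihp ihq => exact Run.seq (ihp hw) (fun h' hh' => ihq hh')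
  | ite e p q ihp ihq =>
    refine Run.ifE hw.1 (fun hc => ?_) (fun hc => ?_)
    · exact (ihp (hw.2.1 hc)).conseq (le_max_left _ _) (fun _ h => h)
    · exact (ihq (hw.2.2 hc)).conseq (le_max_right _ _) (fun _ h => h)

end Stmt

end WordRAM

/-! ### Minimum triangles from minimum cycles: raising the weights -/

namespace WordRAM

/-- Set the listed registers to `0`. -/
def clearRegs : List ℕ → Prog
  | [] => .skip
  | x :: l => .seq (.const x 0) (clearRegs l)

theorem exec_clearRegs {B : ℕ} (hB : 0 < B) (l : List ℕ) (s : State) :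
    Exec B (clearRegs l) s (l.length + 1)
      ⟨fun x => if x ∈ l then 0 else s.reg x, s.arr⟩ := by
  induction l generalizing s with
  | nil => simpa [clearRegs] using Exec.skip s
  | cons x l ih =>
    have h := Exec.seq (.const s x 0 hB) (ih (s.setReg x 0))
    have e : (clearRegs (x :: l)) = .seq (.const x 0) (clearRegs l) := rfl
    rw [e, List.length_cons, Nat.add_comm (l.length + 1) 1]
    convert h using 1
    ext y
    · simp only [List.mem_cons, State.setReg_reg]
      by_cases h1 : y ∈ l <;> by_cases h2 : y = x <;> simp [h1, h2]
    · rfl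

end WordRAM

open WordRAM

namespace WGraph

variable {n M : ℕ}

theorem entry_symm (G : WGraph n M) (i j : Fin n) : G.entry i j = G.entry j i := by
  unfold entry; rw [G.graph.adj_comm, Sym2.eq_swap]

theorem entry_le (G : WGraph n M) (i j : Fin n) : G.entry i j ≤ M := by
  unfold entry; split_ifs with h
  exacts [(G.weight_mem _ ((SimpleGraph.mem_edgeSet _).2 h)).2, Nat.zero_le _]

theorem entry_ne_zero_iff (G : WGraph n M) (i j : Fin n) : G.entry i j ≠ 0 ↔ G.graph.Adj i j := by
  unfold entry; split_ifs with h
  · have := (G.weight_mem s(i, j) h).1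
    simp [h]; omega
  · simp [h]

theorem weight_eq_entry (G : WGraph n M) {i j : Fin n} (h : G.graph.Adj i j) :
    G.weight s(i, j) = G.entry i j := by
  simp [entry, h]

theorem input_arr_zero (G : WGraph n M) (i j : Fin n) :
    G.input.arr 0 (i * n + j) = G.entry i j := by
  have h : (i : ℕ) * n + j < n * n := by
    have := Nat.mul_le_mul_right n (Nat.succ_le_of_lt i.2); have := j.2
    rw [Nat.succ_mul] at *; omega
  have hn : 0 < n := i.pos
  simp only [input, h, and_self, dif_pos]
  congr 1 <;> ext
  · simp [Fin.divNat, Nat.add_comm, Nat.add_mul_div_right _ _ hn, Nat.div_eq_of_lt j.2]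
  · simp [Fin.modNat, Nat.mod_eq_of_lt j.2]

theorem input_bounded (G : WGraph n M) {B : ℕ} (hn : n < B) (hM : M < B) :
    G.input.Bounded B := by
  constructor
  · intro x; simp only [input]; split_ifs <;> omega
  · intro a k; simp only [input]; split_ifs with h
    · exact (G.entry_le _ _).trans_lt hM
    · omega

/-- The same graph with all weights increased by `3 * M`. -/
abbrev raise (G : WGraph n M) : WGraph n (4 * M) where
  graph := G.graph
  weight e := G.weight e + 3 * M
  weight_mem e he := by have := G.weight_mem e he; omega

@[simp] theorem walkWeight_nil (G : WGraph n M) {u : Fin n} :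
    G.walkWeight (.nil : G.graph.Walk u u) = 0 := rfl

@[simp] theorem walkWeight_cons (G : WGraph n M) {u v w : Fin n} (h : G.graph.Adj u v)
    (p : G.graph.Walk v w) : G.walkWeight (.cons h p) = G.weight s(u, v) + G.walkWeight p := by
  simp [walkWeight]

theorem raise_walkWeight (G : WGraph n M) {u v : Fin n} (c : G.graph.Walk u v) :
    G.raise.walkWeight c = G.walkWeight c + 3 * M * c.length := by
  induction c with
  | nil => rfl
  | cons h p ih =>
    have h1 := G.raise.walkWeight_cons h p
    have h2 := G.walkWeight_cons h p
    rw [ih] at h1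
    rw [h1, h2, SimpleGraph.Walk.length_cons]
    ring

theorem walkWeight_le (G : WGraph n M) {u v : Fin n} (c : G.graph.Walk u v) :
    G.walkWeight c ≤ M * c.length := by
  induction c with
  | nil => simp
  | cons h p ih =>
    rw [walkWeight_cons, SimpleGraph.Walk.length_cons]
    have := (G.weight_mem _ ((SimpleGraph.mem_edgeSet _).2 h)).2
    rw [Nat.mul_succ]; omega

theorem length_le_walkWeight (G : WGraph n M) {u v : Fin n} (c : G.graph.Walk u v) :
    c.length ≤ G.walkWeight c := by
  induction c with
  | nil => simp
  | cons h p ih =>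
    rw [walkWeight_cons, SimpleGraph.Walk.length_cons]
    have := (G.weight_mem _ ((SimpleGraph.mem_edgeSet _).2 h)).1
    omega

/-- A minimum cycle of the raised graph is a minimum triangle, or there is no triangle. -/
theorem minTriangleOutput_of_raise (G : WGraph n M) (out : List ℕ)
    (h : MinCycleOutput G.raise out) :
    MinTriangleOutput G (if out.length = 3 then out else []) := by
  have len : ∀ {v : Fin n} (c : G.graph.Walk v v), (c.support.tail.map Fin.val).length = c.length := by
    intro v c; simp
  rcases h with ⟨rfl, hac⟩ | ⟨v, c, ⟨hc, hmin⟩, rfl⟩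
  · left
    exact ⟨by simp, fun v c hc => absurd hc (hac c)⟩
  · have len' := len c
    by_cases h3 : c.length = 3
    · right
      refine ⟨v, c, ⟨⟨hc, h3⟩, fun u d hd hd3 => ?_⟩, if_pos (by rw [← h3]; exact len')⟩
      have := hmin u d hd
      rw [raise_walkWeight G c, raise_walkWeight G d, h3, hd3] at this
      omega
    · left
      refine ⟨if_neg (fun h => h3 (len'.symm.trans h)), fun u d hd hd3 => ?_⟩
      have h1 := hmin u d hd
      rw [raise_walkWeight G c, raise_walkWeight G d, hd3] at h1
      have h2 := hc.three_le_length
      change 3 ≤ c.length at h2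
      -- A cycle with at least four edges weighs at least `12M + 4` after raising, a triangle at
      -- most `12M`; so no triangle exists if the minimum cycle is longer.
      have h4 : 4 ≤ c.length := by omega
      have h5 := G.walkWeight_le d
      rw [hd3] at h5
      have h6 := G.length_le_walkWeight c
      have h7 : 3 * M * 4 ≤ 3 * M * c.length := Nat.mul_le_mul_left _ h4
      omega

end WGraph

/-- Raise the weights of the input graph in place. -/
def raiseInput : Prog :=
  .seq (forE 2 (.var 0 * .var 0)
    (Stmt.ite (.get 0 (.var 2)) (.put 0 (.var 2) (.get 0 (.var 2) + 3 * .var 1)) .skip).code)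
  (asg 1 (4 * .var 1))

/-- A zero entry encodes a non-edge and has to stay zero, hence the branch in the loop. The entries
are raised one by one, so the invariant mixes raised cells below `k` with original cells from `k`
on. -/
theorem run_raiseInput {n M B : ℕ} (G : WGraph n M) (hB : n * n + n + 4 * M + 5 < B) :
    Run B raiseInput G.input (30 * (n * n) + 20) (fun h =>
      h.reg 0 = n ∧ h.reg 1 = 4 * M ∧ h.arr = G.raise.input.arr) := by
  have hent : ∀ k, k < n * n → (G.input.arr 0 k = 0 → G.raise.input.arr 0 k = 0) ∧
      (G.input.arr 0 k ≠ 0 → G.raise.input.arr 0 k = G.input.arr 0 k + 3 * M) ∧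
      G.input.arr 0 k ≤ M := by
    intro k hk
    simp only [WGraph.input, hk, and_self, dif_pos]
    refine ⟨fun h0 => ?_, fun h0 => ?_, G.entry_le _ _⟩
    · by_contra h1
      exact (G.entry_ne_zero_iff _ _).2 ((G.raise.entry_ne_zero_iff _ _).1 h1) h0
    · have h1 := (G.entry_ne_zero_iff _ _).1 h0
      rw [← G.weight_eq_entry h1, ← G.raise.weight_eq_entry h1]
  have h1 : Run B (forE 2 (.var 0 * .var 0)
      (Stmt.ite (.get 0 (.var 2)) (.put 0 (.var 2) (.get 0 (.var 2) + 3 * .var 1)) .skip).code)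
      G.input (n * n * (12 + 3 + 7) + 3 + 5) (fun h =>
      h.reg 0 = n ∧ h.reg 1 = M ∧ h.arr = G.raise.input.arr) := by
    refine Run.forE (N := n * n) (B := B) (fun k h => h.reg 0 = n ∧ h.reg 1 = M ∧
      (∀ a, a ≠ 0 → h.arr a = G.raise.input.arr a) ∧
      ∀ i, h.arr 0 i = if i < k then G.raise.input.arr 0 i else G.input.arr 0 i)
      12 (by norm_num) (by omega) ?_ ?_ ?_ ?_
    · refine ⟨by simp [WGraph.input], by simp [WGraph.input], ?_, by simp⟩
      intro a ha; ext i; simp [WGraph.input, ha]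
    · rintro k h - ⟨h0, -⟩ -
      simp [h0]; omega
    · rintro k h hk ⟨h0, h1, ha, hi⟩ hk'
      refine Run.conseq (Stmt.run _ ?_) (by decide) (fun _ h => h)
      have hik := hi k
      simp only [lt_self_iff_false, if_false] at hik
      obtain ⟨e1, e2, e3⟩ := hent k hk
      have key : ∀ v, v = G.raise.input.arr 0 k → ∀ i,
          Function.update (h.arr 0) k v i =
            if i < k + 1 then G.raise.input.arr 0 i else G.input.arr 0 i := by
        intro v hv i
        rw [Function.update_apply]
        rcases lt_trichotomy i k with hlt | rfl | hgt
        · rw [if_neg hlt.ne, hi, if_pos hlt, if_pos (by omega)]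
        · simp [hv]
        · rw [if_neg hgt.ne', hi, if_neg (by omega), if_neg (by omega)]
      simp only [Stmt.wp, Expr.eval_get, Expr.eval_var, Expr.eval_add, Expr.eval_mul,
        Expr.eval_ofNat, Expr.ok_get, Expr.ok_add, Expr.ok_mul, Expr.ok_var, Expr.ok_ofNat, hk', hik,
        h1]
      refine ⟨by omega, fun hne => ⟨by omega, by omega, ?_⟩, fun hz => ?_⟩
      · refine ⟨by simpa using hk', by simpa using h0, by simpa using h1, ?_, ?_⟩
        · intro a ha'; simp [ha', ha a ha']
        · simpa using key _ (e2 hne).symm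
      · refine ⟨trivial, by simpa using h0, by simpa using h1, by simpa using ha, ?_⟩
        intro i
        rw [← key _ (e1 hz).symm i, State.setReg_arr]
        have hz' : h.arr 0 k = 0 := hik.trans hz
        by_cases hi' : i = k <;> simp [hi', hz']
    · rintro h ⟨h0, h1, ha, hi⟩ -
      refine ⟨h0, h1, ?_⟩
      ext a i
      by_cases h' : a = 0
      · subst h'
        rw [hi]; split_ifs with hlt
        · rfl
        · simp [WGraph.input, hlt]
      · rw [ha a h']
  refine (h1.seq (T₂ := 4) (Q' := fun h =>
      h.reg 0 = n ∧ h.reg 1 = 4 * M ∧ h.arr = G.raise.input.arr) ?_).conseq (by omega)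
      (fun _ h => h)
  rintro h ⟨h0, h1, h2⟩
  refine Run.asg ?_ ?_
  · simp [h1]; omega
  · simp [h1, h0, h2]

/-- Solve the minimum triangle problem with a program for the minimum cycle problem. -/
def triangleProg (P : Prog) : Prog :=
  .seq raiseInput (.seq (clearRegs (raiseInput.wregs.filter (· ≠ 1)))
    (.seq P (.seq (.const 1 3) (.seq (.op .eq 1 0 1) (.ite 1 .skip (.const 0 0))))))

/-- After raising, every register that was written, except register `1` with the new bound `4M`, is
cleared. The state is then literally the initial state of the raised graph, and `P` can be run
unchanged. Its output is kept only if it has length three. -/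
theorem triangleProg_solves {P : Prog} {T : ℕ → ℕ → ℝ} (hP : SolvesInTime MinCycleOutput P T) :
    SolvesInTime MinTriangleOutput (triangleProg P)
      (fun n M => T (1 * n) (4 * M) + (100 : ℕ) * (n : ℝ) ^ 2) := by
  obtain ⟨c, hc⟩ := hP
  -- The factor `3` comes from `n + 4 * M + 1 ≤ (n + M + 1) ^ 3`; the extra `10` leaves room for the
  -- matrix indices below `n * n` and the constants.
  refine ⟨3 * c + 10, fun n M hM G => ?_⟩
  obtain ⟨t, s, hex, hout, htime⟩ := hc n (4 * M) (by omega) G.raise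
  set B := (n + M + 1) ^ (3 * c + 10) with hBdef
  have hX : 2 ≤ n + M + 1 := by omega
  have hBc : (n + 4 * M + 1) ^ c ≤ B := by
    have h1 : n + 4 * M + 1 ≤ (n + M + 1) ^ 3 := by
      have : 4 ≤ (n + M + 1) ^ 2 := by nlinarith
      calc n + 4 * M + 1 ≤ 4 * (n + M + 1) := by omega
        _ ≤ (n + M + 1) ^ 2 * (n + M + 1) := Nat.mul_le_mul_right _ this
        _ = _ := by ring
    calc (n + 4 * M + 1) ^ c ≤ ((n + M + 1) ^ 3) ^ c := Nat.pow_le_pow_left h1 c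
      _ = (n + M + 1) ^ (3 * c) := by rw [pow_mul]
      _ ≤ B := Nat.pow_le_pow_right (by omega) (by omega)
  have hB : n * n + n + 4 * M + 5 < B := by
    have h1 : (n + M + 1) ^ 10 ≤ B := Nat.pow_le_pow_right (by omega) (by omega)
    have h2 : 2 ^ 8 ≤ (n + M + 1) ^ 8 := Nat.pow_le_pow_left hX 8
    have h3 : (n + M + 1) ^ 10 = (n + M + 1) ^ 8 * (n + M + 1) ^ 2 := by ring
    have h4 : 2 ^ 8 * (n + M + 1) ^ 2 ≤ B := by
      calc _ ≤ (n + M + 1) ^ 8 * (n + M + 1) ^ 2 := Nat.mul_le_mul_right _ h2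
        _ ≤ B := by omega
    nlinarith
  have hb : G.input.Bounded B := G.input_bounded (by omega) (by omega)
  obtain ⟨t1, s1, h1, e1, ht1, r1, q0, q1, q2⟩ :=
    run_raiseInput G hB G.input ⟨rfl, fun _ _ => rfl, hb⟩
  have e2 := exec_clearRegs (B := B) (by omega) (raiseInput.wregs.filter (· ≠ 1)) s1
  have hst : (⟨fun x => if x ∈ raiseInput.wregs.filter (· ≠ 1) then 0 else s1.reg x, s1.arr⟩ :
      State) = G.raise.input := by
    have nt : ∀ x, x < 101 → ¬ IsTemp x := fun x hx h => by have := h.1; omega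
    have z0 : 0 ∉ raiseInput.wregs := by decide
    ext x
    · by_cases hx : x ∈ raiseInput.wregs
      · by_cases hx1 : x = 1
        · subst hx1
          simp [r1.reg 1 (nt 1 (by norm_num)), q1, WGraph.input]
        · have : x ≠ 0 := by rintro rfl; exact z0 hx
          simp [hx, hx1, WGraph.input, this]
      · have hx1 : x ≠ 1 := by rintro rfl; exact hx (by decide)
        simp [hx, e1.reg_eq x hx, WGraph.input, hx1]
    · rw [r1.arr, q2]
  rw [hst] at e2
  have hex' := hex.mono hBc
  have hb' : s.Bounded B := by
    refine hex'.bounded (G.raise.input_bounded (by omega) (by omega))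
  have hl : (raiseInput.wregs.filter (· ≠ 1)).length ≤ 30 := by decide
  have hlen : s.output.length = s.reg 0 := by simp [State.output]
  have e3 := Exec.const (B := B) s 1 3 (by omega)
  have e4 := Exec.op (B := B) (s.setReg 1 3) .eq 1 0 1 (by
    simp only [Op.eval]; split_ifs <;> omega)
  have key := G.minTriangleOutput_of_raise _ hout
  rw [hlen] at key
  set s4 := (s.setReg 1 3).setReg 1
    (Op.eq.eval ((s.setReg 1 3).reg 0) ((s.setReg 1 3).reg 1)) with hs4
  obtain ⟨s5, e5, ho⟩ : ∃ s5, Exec B (.ite 1 .skip (.const 0 0)) s4 2 s5 ∧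
      s5.output = if s.reg 0 = 3 then s.output else [] := by
    by_cases h3 : s.reg 0 = 3
    · refine ⟨_, .iteTrue ?_ (.skip _), ?_⟩
      · simp [hs4, Op.eval, h3]
      · simp [hs4, State.output, h3]
    · refine ⟨_, .iteFalse ?_ (.const _ 0 0 (by omega)), ?_⟩
      · simp [hs4, Op.eval, h3]
      · simp [State.output, h3]
  refine ⟨_, s5, .seq e1 (.seq e2 (.seq hex' (.seq e3 (.seq e4 e5)))), ?_, ?_⟩
  · rw [ho]; exact key
  · intro hn
    have h2 := htime hn
    have h3 : t1 + ((raiseInput.wregs.filter (· ≠ 1)).length + 1 + (t + (1 + (1 + 2)))) ≤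
        t + 100 * n ^ 2 := by nlinarith
    have h4 : ((t1 + ((raiseInput.wregs.filter (· ≠ 1)).length + 1 + (t + (1 + (1 + 2)))) : ℕ) : ℝ) ≤
        t + 100 * (n : ℝ) ^ 2 := by exact_mod_cast h3
    simp only [one_mul]
    push_cast at h4 ⊢
    linarith

open WordRAM

/-! ### Exploration trees -/

namespace WGraph

variable {n M : ℕ}

/-- A tree of paths that start in `s`, explored up to the threshold `t`: a vertex `v` is visited if
`F v ≠ 0`, its distance is `D v`, its parent `P v`, and `F v` is one more than the first vertex after
`s` on its path. An edge `uv` is explored from `u` only if `D u + b * w(uv) ≤ t`. -/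
structure PTree (G : WGraph n M) (b t : ℕ) (s : Fin n) (D P F : ℕ → ℕ) : Prop where
  F_root : F s = n + 1
  D_root : D s = 0
  P_root : P s = n
  step : ∀ v : Fin n, F v ≠ 0 → v ≠ s → ∃ u : Fin n, P v = u ∧ F u ≠ 0 ∧ G.graph.Adj u v ∧
    D v = D u + G.entry u v ∧ D u + b * G.entry u v ≤ t ∧ F v = if u = s then (v : ℕ) + 1 else F u

/-- Every edge that may be explored is an edge of the tree. -/
def Complete (G : WGraph n M) (b t : ℕ) (D P F : ℕ → ℕ) : Prop :=
  ∀ u v : Fin n, F u ≠ 0 → G.graph.Adj u v → D u + b * G.entry u v ≤ t →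
    F v ≠ 0 ∧ (P v = u ∨ P u = v)

/-- An edge that may be explored and closes a cycle. -/
structure Closing (G : WGraph n M) (b t : ℕ) (D P F : ℕ → ℕ) (u v : Fin n) : Prop where
  left : F u ≠ 0
  right : F v ≠ 0
  adj : G.graph.Adj u v
  le : D u + b * G.entry u v ≤ t
  ne : P v ≠ u
  ne' : P u ≠ v

variable {G : WGraph n M} {b t : ℕ} {s : Fin n} {D P F D' P' F' : ℕ → ℕ}

theorem entry_pos {u v : Fin n} (h : G.graph.Adj u v) : 0 < G.entry u v :=
  Nat.pos_of_ne_zero ((G.entry_ne_zero_iff u v).2 h)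

/-- Induction on the distance, which grows along tree edges because weights are positive. The edge
by which the first tree reaches `v` from `u` may be explored in the second tree too, as the
distances of `u` agree, so it is a tree edge there. It cannot point from `v` to `u`: then `v` would
be the parent of `u` in both trees, and each of the two distances would exceed the other. -/
theorem PTree.eq_of_complete (T : G.PTree b t s D P F) (T' : G.PTree b t s D' P' F')
    (hc : G.Complete b t D' P' F') :
    ∀ v : Fin n, F v ≠ 0 → F' v ≠ 0 ∧ D' v = D v ∧ P' v = P v := by
  suffices H : ∀ N, ∀ v : Fin n, D v = N → F v ≠ 0 → F' v ≠ 0 ∧ D' v = D v ∧ P' v = P v from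
    fun v => H _ v rfl
  intro N
  induction N using Nat.strong_induction_on with
  | _ N ih =>
    intro v hN hv
    by_cases hvs : v = s
    · subst hvs
      rw [T.D_root, T'.D_root, T.P_root, T'.P_root, T'.F_root]
      simp
    · obtain ⟨u, hPu, hFu, hadj, hD, hle, -⟩ := T.step v hv hvs
      have hpos := entry_pos hadj
      obtain ⟨h1, h2, h3⟩ := ih (D u) (by omega) u rfl hFu
      obtain ⟨h4, h5⟩ := hc u v h1 hadj (by rw [h2]; exact hle)
      rcases h5 with h5 | h5
      · obtain ⟨u', hPu', hFu', hadj', hD', -⟩ := T'.step v h4 hvs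
        have : u' = u := Fin.ext (by rw [← hPu', h5])
        subst this
        exact ⟨h4, by rw [hD', h2, hD], by rw [h5, hPu]⟩
      · rw [h3] at h5
        by_cases hus : u = s
        · subst hus; rw [T.P_root] at h5; have := v.2; omega
        · obtain ⟨u0, hPu0, -, hadj0, hD0, -⟩ := T.step u hFu hus
          have : u0 = v := Fin.ext (by rw [← hPu0, h5])
          subst this
          omega

/-- The first tree sits inside the complete one with the same distances and parents, and in the
complete one an explorable edge is always a parent edge. So at a given threshold, finding a closing
edge and completing the tree exclude each other. -/
theorem PTree.not_closing (T : G.PTree b t s D P F) (T' : G.PTree b t s D' P' F')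
    (hc : G.Complete b t D' P' F') {u v : Fin n} : ¬ G.Closing b t D P F u v := by
  intro h
  obtain ⟨h1, h2, h3⟩ := T.eq_of_complete T' hc u h.left
  obtain ⟨h4, h5, h6⟩ := T.eq_of_complete T' hc v h.right
  obtain ⟨-, h7⟩ := hc u v h1 h.adj (by rw [h2]; exact h.le)
  rw [h3, h6] at h7
  exact h7.elim h.ne h.ne'

/-- Away from the root a nonzero label is one more than the index of a child of the root. Hence the
labels that matter have no more bits than `n`. -/
theorem PTree.F_ne_zero_le (T : G.PTree b t s D P F) : ∀ v : Fin n, F v ≤ n + 1 ∧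
    (v ≠ s → F v ≤ n) := by
  suffices H : ∀ N, ∀ v : Fin n, D v = N → F v ≤ n + 1 ∧ (v ≠ s → F v ≤ n) from
    fun v => H _ v rfl
  intro N
  induction N using Nat.strong_induction_on with
  | _ N ih =>
    intro v hN
    by_cases hvs : v = s
    · subst hvs; rw [T.F_root]; simp
    · by_cases hv : F v = 0
      · rw [hv]; simp
      · obtain ⟨u, hPu, hFu, hadj, hD, hle, hF⟩ := T.step v hv hvs
        have hpos := entry_pos hadj
        have h1 := ih (D u) (by omega) u rfl
        have : F v ≤ n := by
          rw [hF]; split_ifs with h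
          · exact v.2
          · exact h1.2 h
        exact ⟨by omega, fun _ => this⟩

/-- The partial sums of the weights along a sequence of vertices. -/
noncomputable def arc (G : WGraph n M) (c : ℕ → Fin n) (i : ℕ) : ℕ :=
  ∑ j ∈ Finset.range i, G.entry (c j) (c (j + 1))

theorem arc_succ (c : ℕ → Fin n) (i : ℕ) :
    G.arc c (i + 1) = G.arc c i + G.entry (c i) (c (i + 1)) := Finset.sum_range_succ _ _

theorem arc_mono (c : ℕ → Fin n) {i j : ℕ} (h : i ≤ j) : G.arc c i ≤ G.arc c j :=
  Finset.sum_le_sum_of_subset (Finset.range_mono h)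

/-- A complete tree follows every path without backtracking up to the threshold. -/
theorem PTree.follow (T : G.PTree b t s D P F) (hc : G.Complete b t D P F) (c : ℕ → Fin n)
    (h0 : c 0 = s) (i : ℕ) (hadj : ∀ j < i, G.graph.Adj (c j) (c (j + 1)))
    (hnb : ∀ j, j + 2 ≤ i → c (j + 2) ≠ c j)
    (ht : ∀ j < i, G.arc c j + b * G.entry (c j) (c (j + 1)) ≤ t) :
    F (c i) ≠ 0 ∧ D (c i) = G.arc c i ∧
      (1 ≤ i → P (c i) = c (i - 1) ∧ F (c i) = c 1 + 1) := by
  induction i with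
  | zero => rw [h0, T.F_root, T.D_root]; simp [arc]
  | succ i ih =>
    obtain ⟨h1, h2, h3⟩ := ih (fun j hj => hadj j (by omega)) (fun j hj => hnb j (by omega))
      (fun j hj => ht j (by omega))
    have ha := hadj i (by omega)
    obtain ⟨h4, h5⟩ := hc (c i) (c (i + 1)) h1 ha (by rw [h2]; exact ht i (by omega))
    have hP : P (c (i + 1)) = c i := by
      rcases h5 with h5 | h5
      · exact h5
      -- The edge does not lead back to the parent of `c i`: that parent is `c (i - 1)` and the path
      -- does not backtrack. The root has no parent at all, as its entry `n` is not a vertex.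
      · exfalso
        rcases i with _ | i
        · rw [h0, T.P_root] at h5; have := (c (0 + 1)).2; omega
        · have h6 := (h3 (by omega)).1
          rw [h5] at h6
          exact hnb i (by omega) (Fin.ext h6)
    have hs : c (i + 1) ≠ s := by
      intro h; rw [h, T.P_root] at hP; have := (c i).2; omega
    obtain ⟨u, hPu, hFu, hadj', hD, hle, hF⟩ := T.step _ h4 hs
    have : u = c i := Fin.ext (by rw [← hPu, hP])
    subst this
    refine ⟨h4, by rw [hD, h2, arc_succ], fun _ => ⟨by simpa using hP, ?_⟩⟩
    rw [hF]
    rcases i with _ | i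
    · simp [h0]
    · rw [if_neg, (h3 (by omega)).2]
      intro h
      have := (h3 (by omega)).1
      rw [h, T.P_root] at this
      have := (c (i + 1 - 1)).2; omega

/-- A simple cycle with `l` edges as a periodic sequence of vertices. -/
structure Cyc (G : WGraph n M) (l : ℕ) (c : ℕ → Fin n) : Prop where
  three : 3 ≤ l
  per : ∀ i, c (i + l) = c i
  inj : ∀ i < l, ∀ j < l, c i = c j → i = j
  adj : ∀ i, G.graph.Adj (c i) (c (i + 1))

theorem arc_eq_walkWeight (c : ℕ → Fin n) {u v : Fin n} (p : G.graph.Walk u v)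
    (h : ∀ i ≤ p.length, c i = p.getVert i) : G.arc c p.length = G.walkWeight p := by
  induction p generalizing c with
  | nil => simp [arc]
  | @cons u v w ha p ih =>
    have h0 : c 0 = u := by simpa using h 0 (by simp)
    have h1 : c (0 + 1) = v := by simpa using h 1 (by simp)
    have := ih (fun i => c (i + 1)) (fun i hi => by
      have := h (i + 1) (by simpa using hi)
      rwa [SimpleGraph.Walk.getVert_cons_succ] at this)
    rw [walkWeight_cons, SimpleGraph.Walk.length_cons, arc, Finset.sum_range_succ', ← this, h0, h1,
      weight_eq_entry _ ha, arc, add_comm]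

/-- As a periodic sequence on `ℕ` a cycle can be rotated by shifting the index. -/
theorem exists_cyc {v : Fin n} (p : G.graph.Walk v v) (hp : p.IsCycle) :
    ∃ c, G.Cyc p.length c ∧ G.arc c p.length = G.walkWeight p := by
  have h3 := hp.three_le_length
  have hmod : ∀ i, i % p.length < p.length := fun i => Nat.mod_lt _ (by omega)
  have hl : ∀ i ≤ p.length, p.getVert (i % p.length) = p.getVert i := by
    intro i hi
    rcases hi.lt_or_eq with h | h
    · rw [Nat.mod_eq_of_lt h]
    · rw [h, Nat.mod_self, SimpleGraph.Walk.getVert_zero, SimpleGraph.Walk.getVert_length]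
  refine ⟨fun i => p.getVert (i % p.length), ⟨h3, fun i => by simp, ?_, fun i => ?_⟩, ?_⟩
  · intro i hi j hj h
    simp only [Nat.mod_eq_of_lt hi, Nat.mod_eq_of_lt hj] at h
    exact hp.getVert_injOn' (by simp; omega) (by simp; omega) h
  · have h1 := p.adj_getVert_succ (hmod i)
    have h2 := hl (i % p.length + 1) (hmod i)
    rw [Nat.mod_add_mod] at h2
    rw [← h2] at h1
    exact h1
  · exact arc_eq_walkWeight _ p hl

/-- Shifting by one drops the first summand and appends an equal one at the end. -/
theorem Cyc.arc_shift {l : ℕ} {c : ℕ → Fin n} (h : G.Cyc l c) (k : ℕ) :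
    G.arc (fun i => c (i + k)) l = G.arc c l := by
  induction k with
  | zero => rfl
  | succ k ih =>
    rw [← ih]
    have e1 := Finset.sum_range_succ (fun j => G.entry (c (j + k)) (c (j + 1 + k))) l
    have e2 := Finset.sum_range_succ' (fun j => G.entry (c (j + k)) (c (j + 1 + k))) l
    rw [e1] at e2
    have e3 : ∀ j, c (j + (k + 1)) = c (j + 1 + k) := fun j => by congr 1; omega
    have e4 : c (l + k) = c (0 + k) := by rw [add_comm l, h.per, zero_add]
    have e5 : c (l + 1 + k) = c (0 + 1 + k) := by
      rw [show l + 1 + k = (0 + 1 + k) + l by omega, h.per]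
    rw [e4, e5] at e2
    simp only [arc, e3]
    omega

theorem Cyc.shift {l : ℕ} {c : ℕ → Fin n} (h : G.Cyc l c) (k : ℕ) :
    G.Cyc l (fun i => c (i + k)) := by
  have hm : ∀ i, c (i % l) = c i := by
    intro i
    conv_rhs => rw [← Nat.mod_add_div i l]
    generalize i / l = q
    induction q with
    | zero => simp
    | succ q ih => rw [Nat.mul_succ, ← add_assoc, h.per, ih]
  have h3 := h.three
  refine ⟨h.three, fun i => ?_, fun i hi j hj hij => ?_, fun i => ?_⟩
  · rw [show i + l + k = (i + k) + l by omega, h.per]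
  · change c (i + k) = c (j + k) at hij
    rw [← hm (i + k), ← hm (j + k)] at hij
    have := h.inj _ (Nat.mod_lt _ (by omega)) _ (Nat.mod_lt _ (by omega)) hij
    have h5 : i ≡ j [MOD l] := Nat.ModEq.add_right_cancel' k this
    rwa [Nat.ModEq, Nat.mod_eq_of_lt hi, Nat.mod_eq_of_lt hj] at h5
  · have := h.adj (i + k)
    rwa [show i + k + 1 = i + 1 + k by omega] at this

theorem Cyc.back {l : ℕ} {c : ℕ → Fin n} (h : G.Cyc l c) (j : ℕ) (hj : j + 2 ≤ l) :
    c (j + 2) ≠ c j := by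
  have h3 := h.three
  intro he
  rcases hj.lt_or_eq with h1 | h1
  · have := h.inj _ h1 _ (by omega) he; omega
  · rw [h1, ← zero_add l, h.per] at he
    have := h.inj 0 (by omega) j (by omega) he; omega

theorem Cyc.arc_rev {l : ℕ} {c : ℕ → Fin n} (i : ℕ) (hi : i ≤ l) :
    G.arc (fun i => c (l - i)) i + G.arc c (l - i) = G.arc c l := by
  induction i with
  | zero => simp [arc]
  | succ i ih =>
    rw [← ih (by omega), arc_succ, show l - i = (l - (i + 1)) + 1 by omega, arc_succ,
      entry_symm]
    ring

/-- The strict inequality `i < l` is part of the conclusion: a tree that followed the cycle all the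
way round would assign a vertex as the parent of its root, whose parent entry is `n`. -/
theorem Cyc.follow {l : ℕ} {c : ℕ → Fin n} (h : G.Cyc l c) (T : G.PTree b t (c 0) D P F)
    (hc : G.Complete b t D P F) (i : ℕ) (hi : i ≤ l)
    (ht : ∀ j < i, G.arc c j + b * G.entry (c j) (c (j + 1)) ≤ t) :
    i < l ∧ D (c i) = G.arc c i ∧ (1 ≤ i → F (c i) = c 1 + 1) := by
  obtain ⟨h1, h2, h3⟩ := T.follow hc c rfl i (fun j _ => h.adj j)
    (fun j hj => h.back j (by omega)) ht
  refine ⟨lt_of_le_of_ne hi ?_, h2, fun h => (h3 h).2⟩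
  intro hil
  have h4 := (h3 (by have := h.three; omega)).1
  rw [hil, ← zero_add l, h.per, T.P_root] at h4
  have := (c (0 + l - 1)).2
  omega

/-- The cycle is read backwards, so `c i` is reached after `l - i` edges through the neighbor `c (l
- 1)` of the root. -/
theorem Cyc.follow_rev {l : ℕ} {c : ℕ → Fin n} (h : G.Cyc l c) (T : G.PTree b t (c 0) D P F)
    (hc : G.Complete b t D P F) (i : ℕ) (hi : i ≤ l)
    (ht : ∀ j, i < j → j ≤ l → G.arc c l - G.arc c j + b * G.entry (c j) (c (j - 1)) ≤ t) :
    D (c i) + G.arc c i = G.arc c l ∧ (i < l → F (c i) = c (l - 1) + 1) := by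
  have hl : c l = c 0 := by rw [← zero_add l, h.per]
  obtain ⟨h1, h2, h3⟩ := T.follow hc (fun i => c (l - i)) (by simpa using hl) (l - i)
    (fun j hj => by
      have := (h.adj (l - (j + 1))).symm
      rwa [show l - (j + 1) + 1 = l - j by omega] at this)
    (fun j hj => by
      have := h.back (l - (j + 2)) (by omega)
      rw [show l - (j + 2) + 2 = l - j by omega] at this
      exact this.symm)
    (fun j hj => by
      have h1 := Cyc.arc_rev (G := G) (c := c) j (show j ≤ l by omega)
      have h2 := ht (l - j) (by omega) (by omega)
      rw [show G.arc c l - G.arc c (l - j) = G.arc (fun i => c (l - i)) j by omega] at h2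
      exact h2)
  have h4 := Cyc.arc_rev (G := G) (c := c) (l - i) (show l - i ≤ l by omega)
  simp only [show l - (l - i) = i by omega] at h1 h2 h3 h4
  exact ⟨by omega, fun hil => (h3 (by omega)).2⟩

/-- Otherwise every edge of the cycle could be explored, and the tree would close up at its root. -/
theorem Cyc.lt_of_complete {l : ℕ} {c : ℕ → Fin n} (h : G.Cyc l c)
    (T : G.PTree 1 t (c 0) D P F) (hc : G.Complete 1 t D P F) : t < G.arc c l := by
  by_contra! hle
  refine (h.follow T hc l le_rfl (fun j hj => ?_)).1.false
  rw [one_mul, ← arc_succ]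
  exact (arc_mono c hj).trans hle

theorem exists_crossing (f : ℕ → ℕ) {a l h : ℕ} (hal : a < l) (h0 : f a ≤ h) (hl : h < f l) :
    ∃ j, a ≤ j ∧ j < l ∧ f j ≤ h ∧ h < f (j + 1) := by
  induction l, hal using Nat.le_induction with
  | base => exact ⟨a, le_rfl, by omega, h0, hl⟩
  | succ l hal ih =>
    by_cases hc : h < f l
    · obtain ⟨j, h1, h2, h3⟩ := ih hc
      exact ⟨j, h1, by omega, h3⟩
    · exact ⟨l, by omega, by omega, by omega, hl⟩

/-- For `b = 0` the exploration reaches one edge beyond the threshold. If the cycle weighed at most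
`2t`, its first vertex beyond `t` would be reached in both directions, so both arcs to the root
would equal its distance. Then the cycle would weigh twice a number larger than `t`. -/
theorem Cyc.two_mul_lt_of_complete {l : ℕ} {c : ℕ → Fin n} (h : G.Cyc l c)
    (T : G.PTree 0 t (c 0) D P F) (hc : G.Complete 0 t D P F) : 2 * t < G.arc c l := by
  by_contra! hle
  have h3 := h.three
  have hlt : t < G.arc c l := by
    by_contra! hle
    refine (h.follow T hc l le_rfl (fun j hj => ?_)).1.false
    rw [zero_mul]
    exact (arc_mono c hj.le).trans hle
  obtain ⟨j, -, hj, h1, h2⟩ := exists_crossing (G.arc c) (a := 0) (by omega) (by simp [arc]) hlt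
  obtain ⟨h4, h5, -⟩ := h.follow T hc (j + 1) hj (fun i hi => by
    rw [zero_mul]; exact (arc_mono c (by omega)).trans h1)
  obtain ⟨h6, -⟩ := h.follow_rev T hc (j + 1) hj (fun i hi hi' => by
    have := arc_mono (G := G) c hi.le
    rw [zero_mul]; omega)
  omega

/-- If all trees are complete up to about half the weight of a cycle, then the cycle consists of two
paths with different first vertices in one of the trees and one more edge. -/
theorem Cyc.exists_triple {l : ℕ} {c : ℕ → Fin n} (h : G.Cyc l c)
    (ht : G.arc c l ≤ 2 * t + 1) : ∃ s x y : Fin n, x ≠ s ∧ y ≠ s ∧ G.graph.Adj x y ∧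
      ∀ D P F, G.PTree 1 t s D P F → G.Complete 1 t D P F →
        F x ≠ 0 ∧ F y ≠ 0 ∧ F x ≠ F y ∧ D x + D y + G.entry x y = G.arc c l ∧
        2 * D x ≤ G.arc c l ∧ 2 * D y ≤ G.arc c l := by
  have h3 := h.three
  -- A heaviest edge becomes the second edge of the rotated cycle. Then the first edge weighs at
  -- most half of the cycle, and the last edge less than half, so the midpoint lies on an edge that
  -- avoids the root.
  obtain ⟨m, hm, hmax⟩ := Finset.exists_max_image (Finset.range l)
    (fun j => G.entry (c j) (c (j + 1))) ⟨0, by simp; omega⟩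
  have hmax' : ∀ j, G.entry (c j) (c (j + 1)) ≤ G.entry (c m) (c (m + 1)) := by
    intro j
    have hmod := h.shift 0
    induction j using Nat.strong_induction_on with
    | _ j ih =>
      by_cases hj : j < l
      · exact hmax j (by simpa using hj)
      · have := ih (j - l) (by omega)
        rw [← h.per (j - l), ← h.per (j - l + 1)] at this
        rwa [show j - l + l = j by omega, show j - l + 1 + l = j + 1 by omega] at this
  -- Modulo `l` this is a rotation by `m - 1`; adding `l` avoids truncated subtraction at `m = 0`.
  have harc := h.arc_shift (m + l - 1)
  have h' := h.shift (m + l - 1)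
  set c' : ℕ → Fin n := fun i => c (i + (m + l - 1)) with hc'
  have hbig : ∀ j, G.entry (c' j) (c' (j + 1)) ≤ G.entry (c' 1) (c' 2) := by
    intro j
    have e1 : c' 1 = c m := by
      simp only [hc']; rw [show 1 + (m + l - 1) = m + l by omega, h.per]
    have e2 : c' 2 = c (m + 1) := by
      simp only [hc']; rw [show 2 + (m + l - 1) = m + 1 + l by omega, h.per]
    rw [e1, e2]
    have := hmax' (j + (m + l - 1))
    rwa [show j + (m + l - 1) + 1 = j + 1 + (m + l - 1) by omega] at this
  rw [← harc] at ht ⊢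
  clear_value c'
  clear hmax' hmax hc' harc
  set W := G.arc c' l with hW
  have a1 : G.arc c' 1 = G.entry (c' 0) (c' 1) := by simp [arc]
  have a2 : G.arc c' 2 = G.arc c' 1 + G.entry (c' 1) (c' 2) := arc_succ c' 1
  have al : W = G.arc c' (l - 1) + G.entry (c' (l - 1)) (c' l) := by
    rw [hW]; obtain ⟨k, rfl⟩ : ∃ k, l = k + 1 := ⟨l - 1, by omega⟩
    exact arc_succ c' k
  have hbl := hbig (l - 1)
  rw [show l - 1 + 1 = l by omega] at hbl
  have h2l : G.arc c' 2 ≤ G.arc c' (l - 1) := arc_mono c' (by omega)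
  have hb0 := hbig 0
  simp only [zero_add] at hb0
  have hpos := entry_pos (h'.adj 0)
  simp only [zero_add] at hpos
  -- The edge from `c' j` to `c' (j + 1)` contains the midpoint, and `1 ≤ j < l - 1` keeps both ends
  -- away from `c' 0`. As `W ≤ 2t + 1`, both arcs from the root to this edge have weight at most
  -- `t`.
  obtain ⟨j, j1, jl, j2, j3⟩ := exists_crossing (G.arc c') (a := 1) (l := l - 1) (h := W / 2)
    (by omega) (by omega) (by omega)
  have hne : ∀ i, 1 ≤ i → i < l → c' i ≠ c' 0 := fun i hi hil he => by
    have := h'.inj i hil 0 (by omega) he; omega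
  refine ⟨c' 0, c' j, c' (j + 1), hne j j1 (by omega), hne (j + 1) (by omega) (by omega),
    h'.adj j, fun D P F T hc => ?_⟩
  obtain ⟨-, f1, f2⟩ := h'.follow T hc j (by omega) (fun i hi => by
    have := arc_mono (G := G) c' (show i + 1 ≤ j from hi)
    rw [one_mul, ← arc_succ]; omega)
  obtain ⟨r1, r2⟩ := h'.follow_rev T hc (j + 1) (by omega) (fun i hi hil => by
    obtain ⟨k, rfl⟩ : ∃ k, i = k + 1 := ⟨i - 1, by omega⟩
    have e1 := arc_mono (G := G) c' (show j + 1 ≤ k by omega)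
    have e2 := arc_mono (G := G) c' hil
    have e3 := arc_succ (G := G) c' k
    rw [one_mul, entry_symm, Nat.add_sub_cancel]; omega)
  have f2' := f2 j1
  have r2' := r2 (by omega)
  have hsucc := arc_succ (G := G) c' j
  refine ⟨by omega, by omega, ?_, by omega, by omega, by omega⟩
  -- The labels come from the two neighbors `c' 1` and `c' (l - 1)` of the root on the cycle, which
  -- differ because `l ≥ 3`.
  rw [f2', r2']
  intro he
  have := h'.inj 1 (by omega) (l - 1) (by omega) (Fin.ext (by omega))
  omega

/-! ### Cycles from closing edges -/

/-- The walk follows the parents. -/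
def IsUp (P : ℕ → ℕ) : ∀ {u v : Fin n}, G.graph.Walk u v → Prop
  | _, _, .nil => True
  | _, _, .cons (u := u) (v := v) _ p => P u = v ∧ IsUp P p

theorem IsUp.edges {u v : Fin n} {p : G.graph.Walk u v} (h : IsUp P p) {x y : Fin n}
    (he : s(x, y) ∈ p.edges) : P x = y ∨ P y = x := by
  induction p with
  | nil => simp at he
  | cons ha p ih =>
    rw [SimpleGraph.Walk.edges_cons, List.mem_cons] at he
    rcases he with he | he
    · rw [Sym2.eq_iff] at he
      rcases he with ⟨rfl, rfl⟩ | ⟨rfl, rfl⟩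
      exacts [Or.inl h.1, Or.inr h.1]
    · exact ih h.2 he

theorem PTree.exists_up (T : G.PTree b t s D P F) : ∀ v : Fin n, F v ≠ 0 →
    ∃ p : G.graph.Walk v s, IsUp P p ∧ G.walkWeight p = D v := by
  suffices H : ∀ N, ∀ v : Fin n, D v = N → F v ≠ 0 →
      ∃ p : G.graph.Walk v s, IsUp P p ∧ G.walkWeight p = D v from fun v => H _ v rfl
  intro N
  induction N using Nat.strong_induction_on with
  | _ N ih =>
    intro v hN hv
    by_cases hvs : v = s
    · subst hvs
      exact ⟨.nil, trivial, by rw [T.D_root, walkWeight_nil]⟩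
    · obtain ⟨u, hPu, hFu, hadj, hD, hle, -⟩ := T.step v hv hvs
      have hpos := entry_pos hadj
      obtain ⟨p, hp, hw⟩ := ih (D u) (by omega) u rfl hFu
      refine ⟨.cons hadj.symm p, ⟨hPu, hp⟩, ?_⟩
      rw [walkWeight_cons, hw, hD, weight_eq_entry _ hadj.symm, entry_symm, add_comm]

theorem walkWeight_append {u v w : Fin n} (p : G.graph.Walk u v) (q : G.graph.Walk v w) :
    G.walkWeight (p.append q) = G.walkWeight p + G.walkWeight q := by
  simp [walkWeight]

theorem walkWeight_reverse {u v : Fin n} (p : G.graph.Walk u v) :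
    G.walkWeight p.reverse = G.walkWeight p := by
  simp [walkWeight, List.sum_reverse]

/-- Every edge that the bypass cuts out weighs at least one. So if the bypass does not lose weight,
it does not lose length either and is the walk itself. -/
theorem walkWeight_bypass {u v : Fin n} (p : G.graph.Walk u v) :
    G.walkWeight p.bypass + p.length ≤ G.walkWeight p + p.bypass.length := by
  have key : ∀ l₁ l₂ : List (Sym2 (Fin n)), l₁.Sublist l₂ → (∀ e ∈ l₂, 1 ≤ G.weight e) →
      (l₁.map G.weight).sum + l₂.length ≤ (l₂.map G.weight).sum + l₁.length := by
    intro l₁ l₂ h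
    induction h with
    | slnil => simp
    | cons a h ih =>
      intro hw
      have := ih (fun e he => hw e (by simp [he]))
      have := hw a (by simp)
      simp only [List.map_cons, List.sum_cons, List.length_cons]; omega
    | cons_cons a h ih =>
      intro hw
      have := ih (fun e he => hw e (by simp [he]))
      simp only [List.map_cons, List.sum_cons, List.length_cons]; omega
  have := key _ _ p.edges_bypass_sublist_edges
    (fun e he => (G.weight_mem e (p.edges_subset_edgeSet he)).1)
  simpa [walkWeight] using this

/-- Two visited vertices that are joined by an edge outside of the tree give rise to a cycle. -/
theorem PTree.exists_cycle (T : G.PTree b t s D P F) {u v : Fin n} (hu : F u ≠ 0) (hv : F v ≠ 0)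
    (ha : G.graph.Adj u v) (h1 : P v ≠ u) (h2 : P u ≠ v) :
    ∃ (p : G.graph.Walk u s) (q : G.graph.Walk v s) (c : G.graph.Walk v v), IsUp P p ∧ IsUp P q ∧
      c.IsCycle ∧ G.walkWeight c ≤ D u + D v + G.entry u v ∧
      (G.walkWeight c = D u + D v + G.entry u v →
        c.support.tail = p.support ++ q.support.reverse.tail ∧ p.length + q.length < n) := by
  obtain ⟨p, hp, hpw⟩ := T.exists_up u hu
  obtain ⟨q, hq, hqw⟩ := T.exists_up v hv
  -- The two paths to the root may share an initial segment at the root. The bypass removes such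
  -- detours, and `uv` closes it to a cycle since `uv` is not a parent edge and hence not on it.
  set r := p.append q.reverse with hr
  have hrw : G.walkWeight r = D u + D v := by
    rw [hr, walkWeight_append, walkWeight_reverse, hpw, hqw]
  have hb := G.walkWeight_bypass r
  have hb' := r.length_bypass_le_length
  have hw : G.walkWeight (.cons ha.symm r.bypass) = G.entry u v + G.walkWeight r.bypass := by
    rw [walkWeight_cons, weight_eq_entry _ ha.symm, entry_symm]
  have hpath : r.bypass.IsPath := r.bypass_isPath
  refine ⟨p, q, .cons ha.symm r.bypass, hp, hq, ?_, by omega, fun heq => ?_⟩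
  · rw [SimpleGraph.Walk.cons_isCycle_iff]
    refine ⟨hpath, fun he => ?_⟩
    have he' := r.edges_bypass_subset_edges he
    rw [hr, SimpleGraph.Walk.edges_append, List.mem_append, SimpleGraph.Walk.edges_reverse,
      List.mem_reverse] at he'
    rcases he' with he' | he'
    · exact (hp.edges he').elim h1 h2
    · exact (hq.edges he').elim h1 h2
  -- If the cycle attains the full weight, nothing was cut out, so its vertices can be read off from
  -- the two tree paths.
  · have hrb : r.bypass = r := r.bypass_eq_self_of_length_le_length_bypass (by omega)
    constructor
    · rw [SimpleGraph.Walk.support_cons, List.tail_cons, hrb, hr, SimpleGraph.Walk.support_append,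
        SimpleGraph.Walk.support_reverse]
    · have := hpath.length_lt
      rw [hrb, hr] at this
      simpa using this

end WGraph

/-! ### Frames, lists in memory and index arithmetic -/

namespace WordRAM

/-- `h'` agrees with `h` except for the registers in `R` and the arrays in `A`. -/
def Fr (R A : List ℕ) (h h' : State) : Prop :=
  (∀ x, x ∉ R → h'.reg x = h.reg x) ∧ ∀ a, a ∉ A → h'.arr a = h.arr a

theorem Fr.refl (R A : List ℕ) (h : State) : Fr R A h h := ⟨fun _ _ => rfl, fun _ _ => rfl⟩

theorem Fr.setReg {R A : List ℕ} {h h' : State} {x v : ℕ} (hx : x ∈ R) (hf : Fr R A h h') :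
    Fr R A h (h'.setReg x v) :=
  ⟨fun y hy => by rw [State.setReg_reg, if_neg (fun e : y = x => hy (e ▸ hx)), hf.1 y hy], hf.2⟩

theorem Fr.setArr {R A : List ℕ} {h h' : State} {a i v : ℕ} (ha : a ∈ A) (hf : Fr R A h h') :
    Fr R A h (h'.setArr a i v) :=
  ⟨hf.1, fun y hy => by rw [State.setArr_arr, if_neg (fun e : y = a => hy (e ▸ ha)), hf.2 y hy]⟩

theorem Fr.trans {R A R' A' S C : List ℕ} {h h' h'' : State} (h1 : Fr R A h h')
    (h2 : Fr R' A' h' h'') (hR : R ⊆ S) (hR' : R' ⊆ S) (hA : A ⊆ C) (hA' : A' ⊆ C) :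
    Fr S C h h'' :=
  ⟨fun x hx => by rw [h2.1 x (fun e => hx (hR' e)), h1.1 x (fun e => hx (hR e))],
    fun a ha => by rw [h2.2 a (fun e => ha (hA' e)), h1.2 a (fun e => ha (hA e))]⟩

theorem Fr.mono {R A R' A' : List ℕ} {h h' : State} (h1 : Fr R A h h') (hR : R ⊆ R')
    (hA : A ⊆ A') : Fr R' A' h h' :=
  (Fr.refl R' A' h).trans h1 (List.Subset.refl _) hR (List.Subset.refl _) hA

/-- The cells from index `0` on hold the list `l`. -/
def Holds {n : ℕ} (f : ℕ → ℕ) (l : List (Fin n)) : Prop := ∀ (i : ℕ) (x : Fin n), l[i]? = some x → f i = x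

theorem Holds.nil {n : ℕ} (f : ℕ → ℕ) : Holds f ([] : List (Fin n)) := by
  intro i x h; simp at h

theorem Holds.append {n : ℕ} {f g : ℕ → ℕ} {l : List (Fin n)} {x : Fin n} (h : Holds f l)
    (hx : g l.length = x) (hg : ∀ i < l.length, g i = f i) : Holds g (l ++ [x]) := by
  intro i y hy
  rcases lt_trichotomy i l.length with hi | rfl | hi
  · rw [List.getElem?_append_left hi] at hy
    rw [hg i hi, h i y hy]
  · simp at hy; rw [hx, hy]
  · rw [List.getElem?_append_right hi.le, List.getElem?_eq_none (by simp; omega)] at hy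
    simp at hy

theorem Holds.congr {n : ℕ} {f g : ℕ → ℕ} {l : List (Fin n)} (h : Holds f l)
    (hg : ∀ i < l.length, g i = f i) : Holds g l := by
  intro i y hy
  rw [hg i (List.getElem?_eq_some_iff.1 hy).1, h i y hy]

theorem idx_lt {n i j : ℕ} (hi : i < n) (hj : j < n) : i * n + j < n * n := by
  have := Nat.mul_le_mul_right n (Nat.succ_le_of_lt hi)
  rw [Nat.succ_mul] at this; omega

theorem idx_inj {n i j i' j' : ℕ} (hj : j < n) (hj' : j' < n) (h : i * n + j = i' * n + j') :
    i = i' ∧ j = j' := by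
  have h1 : j % n = j' % n := by
    have := congrArg (· % n) h
    simpa [Nat.add_mod] using this
  rw [Nat.mod_eq_of_lt hj, Nat.mod_eq_of_lt hj'] at h1
  subst h1
  exact ⟨Nat.eq_of_mul_eq_mul_right (by omega) (Nat.add_right_cancel h), rfl⟩

/-- The state contains the input `G`. -/
structure Inp {n M : ℕ} (G : WGraph n M) (h : State) : Prop where
  reg0 : h.reg 0 = n
  reg1 : h.reg 1 = M
  arr0 : ∀ i j : Fin n, h.arr 0 (i * n + j) = G.entry i j

theorem Inp.frame {n M : ℕ} {G : WGraph n M} {h h' : State} (hi : Inp G h) {R A : List ℕ}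
    (hf : Fr R A h h') (h0 : 0 ∉ R) (h1 : 1 ∉ R) (hA : 0 ∉ A) : Inp G h' :=
  ⟨by rw [hf.1 0 h0, hi.reg0], by rw [hf.1 1 h1, hi.reg1], fun i j => by rw [hf.2 0 hA, hi.arr0]⟩

/-! ### Sorted adjacency lists -/

/-- Append those neighbors in row `2` whose weight has the bit `bit` at position `pw` to array `8`. -/
def passBit (bit : Expr) : Prog :=
  forE 6 (.get 3 (.var 2))
    (Stmt.seq (.asg 7 (.get 2 (.var 2 * .var 0 + .var 6)))
      (.ite (.eq (.get 0 (.var 2 * .var 0 + .var 7) / .var 5 % 2) bit)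
        (.seq (.put 8 (.var 4) (.var 7)) (.asg 4 (.var 4 + 1))) .skip)).code

/-- The selected neighbors keep their relative order, which is the stability that radix sort depends
on. The list `pre` is what an earlier pass has already put into the buffer. -/
theorem run_passBit {n M B : ℕ} (G : WGraph n M) (hB : n * n + 4 * (n * M) + 10 * n + 10 * M + 50 < B) (h : State)
    (hi : Inp G h) (u : Fin n) (hu : h.reg 2 = u) (l pre : List (Fin n)) (hl : l.length ≤ n)
    (hdeg : h.arr 3 u = l.length) (hrow : Holds (fun i => h.arr 2 (u * n + i)) l)
    (hcnt : h.reg 4 = pre.length) (hpre : Holds (h.arr 8) pre) (hpl : pre.length ≤ n)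
    (bit : ℕ) (e : Expr) (he : ∀ h, e.eval h = bit ∧ e.Ok B h) (hec : e.cost = 1) :
    Run B (passBit e) h (60 * n + 10) (fun h' => Fr [4, 6, 7] [8] h h' ∧
      Holds (h'.arr 8) (pre ++ l.filter (fun v => G.entry u v / h.reg 5 % 2 = bit)) ∧
      h'.reg 4 = (pre ++ l.filter (fun v => G.entry u v / h.reg 5 % 2 = bit)).length) := by
  set q : Fin n → Bool := fun v => G.entry u v / h.reg 5 % 2 = bit with hq
  refine (Run.forE (N := l.length) (fun k h' => Fr [4, 6, 7] [8] h h' ∧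
    Holds (h'.arr 8) (pre ++ (l.take k).filter q) ∧
      h'.reg 4 = (pre ++ (l.take k).filter q).length) 40 (by norm_num) (by omega) ?_ ?_ ?_
      (Q := fun h' => Fr [4, 6, 7] [8] h h' ∧ Holds (h'.arr 8) (pre ++ l.filter q) ∧
      h'.reg 4 = (pre ++ l.filter q).length) ?_).conseq ?_ (fun _ h => h)
  · refine ⟨(Fr.refl _ _ _).setReg (by decide), by simpa using hpre, by simpa using hcnt⟩
  · rintro k h' hk ⟨hf, -, -⟩ -
    simp [hf.1 2 (by decide), hf.2 3 (by decide), hu, hdeg]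
  · rintro k h' hk ⟨hf, h8, h4⟩ h6
    refine Run.conseq (Stmt.run _ ?_) (T' := 40) (by simp only [Stmt.cost, Expr.cost, hec]; decide)
      (fun _ h => h)
    have e0 : h'.reg 0 = n := (hf.1 0 (by decide)).trans hi.reg0
    have e2 : h'.reg 2 = u := (hf.1 2 (by decide)).trans hu
    have e5 := hf.1 5 (by decide)
    have hx : h'.arr 2 (u * n + k) = (l[k] : Fin n) := by
      rw [hf.2 2 (by decide)]; exact hrow k _ (by simp [hk])
    have hw : h'.arr 0 (u * n + (l[k] : Fin n)) = G.entry u l[k] := by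
      rw [hf.2 0 (by decide)]; exact hi.arr0 _ _
    have i1 := idx_lt u.2 (show k < n by omega)
    have i2 := idx_lt u.2 (l[k] : Fin n).2
    have htake : (l.take (k + 1)).filter q =
        (l.take k).filter q ++ (if q l[k] then [l[k]] else []) := by
      rw [List.take_succ_eq_append_getElem hk, List.filter_append]
      congr 1
      by_cases hql : q l[k] <;> simp [hql]
    have hle : ((l.take k).filter q).length ≤ n :=
      (List.length_filter_le _ _).trans (by simp; omega)
    simp only [Stmt.wp, Expr.ok_get, Expr.ok_add, Expr.ok_mul, Expr.ok_var, Expr.eval_mul,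
      Expr.eval_var, Expr.eval_add, Expr.eval_get, Expr.ok_eq, Expr.ok_mod, Expr.ok_div,
      State.setReg_reg, State.setReg_arr, Expr.eval_eq, Expr.eval_mod, Expr.eval_div,
      Expr.eval_ofNat, Expr.ok_ofNat, he, e0, e2, e5, h6, hx, hw, State.setArr_reg,
      State.setArr_arr, reduceIte, Nat.reduceEqDiff]
    have hlen := List.length_append (as := pre) (bs := (l.take k).filter q)
    refine ⟨by omega, ⟨by omega, trivial, by omega⟩, fun hc => ?_, fun hc => ?_⟩
    · have hc' : q l[k] = true := by simpa [hq] using hc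
      rw [hc', if_pos rfl] at htake
      refine ⟨by simp, by simp, by rw [h4]; omega, by simp, ?_, ?_, ?_⟩
      · exact (((hf.setReg (by decide)).setArr (by decide)).setReg (by decide)).setReg (by decide)
      · rw [htake, ← List.append_assoc]
        refine h8.append ?_ ?_
        · simp [h4]
        · intro i hi'
          have : i ≠ h'.reg 4 := by omega
          simp [this]
      · rw [htake, ← List.append_assoc, List.length_append, ← h4]; simp
    · have hc' : q l[k] = false := by simpa [hq] using hc
      rw [hc', if_neg (by simp), List.append_nil] at htake
      refine ⟨by simp, (hf.setReg (by decide)).setReg (by decide), ?_, ?_⟩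
      · rw [htake]; simpa using h8
      · rw [htake]; simpa using h4
  · rintro h' ⟨h1, h2, h3⟩ -
    rw [List.take_length] at h2 h3
    exact ⟨h1, h2, h3⟩
  · have : l.length * (40 + (Expr.get 3 (.var 2)).cost + 7) ≤ n * 60 := by
      refine Nat.mul_le_mul hl ?_
      simp [Expr.cost]
    simp only [Expr.cost] at this ⊢
    omega


/-- Copy array `8` to row `2` of the adjacency lists. -/
def copyRow : Prog :=
  forE 6 (.get 3 (.var 2)) (Stmt.put 2 (.var 2 * .var 0 + .var 6) (.get 8 (.var 6))).code

theorem run_copyRow {n M B : ℕ} (hB : n * n + 4 * (n * M) + 10 * n + 10 * M + 50 < B) (h : State)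
    (h0 : h.reg 0 = n) (u : Fin n) (hu : h.reg 2 = u) (l : List (Fin n)) (hl : l.length ≤ n)
    (hdeg : h.arr 3 u = l.length) (h8 : Holds (h.arr 8) l) :
    Run B copyRow h (30 * n + 10) (fun h' => Fr [6] [2] h h' ∧
      Holds (fun i => h'.arr 2 (u * n + i)) l ∧
      ∀ i, i < u * n ∨ u * n + n ≤ i → h'.arr 2 i = h.arr 2 i) := by
  refine (Run.forE (N := l.length) (fun k h' => Fr [6] [2] h h' ∧
      Holds (fun i => h'.arr 2 (u * n + i)) (l.take k) ∧
      ∀ i, i < u * n ∨ u * n + n ≤ i → h'.arr 2 i = h.arr 2 i) 10 (by norm_num) (by omega)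
      ?_ ?_ ?_ (Q := fun h' => Fr [6] [2] h h' ∧
      Holds (fun i => h'.arr 2 (u * n + i)) l ∧
      ∀ i, i < u * n ∨ u * n + n ≤ i → h'.arr 2 i = h.arr 2 i) ?_).conseq ?_ (fun _ h => h)
  · exact ⟨(Fr.refl _ _ _).setReg (by decide), by simpa using Holds.nil _, by simp⟩
  · rintro k h' hk ⟨hf, -, -⟩ -
    simp [hf.1 2 (by decide), hf.2 3 (by decide), hu, hdeg]
  · rintro k h' hk ⟨hf, hH, hfar⟩ h6
    refine Run.conseq (Stmt.run _ ?_) (T' := 10) (by decide) (fun _ h => h)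
    have e0 : h'.reg 0 = n := (hf.1 0 (by decide)).trans h0
    have e2 : h'.reg 2 = u := (hf.1 2 (by decide)).trans hu
    have hx : h'.arr 8 k = (l[k] : Fin n) := by
      rw [hf.2 8 (by decide)]; exact h8 k _ (by simp [hk])
    have i1 := idx_lt u.2 (show k < n by omega)
    simp only [Stmt.wp, Expr.ok_get, Expr.ok_add, Expr.ok_mul, Expr.ok_var, Expr.eval_mul,
      Expr.eval_var, Expr.eval_add, Expr.eval_get, e0, e2, h6, hx]
    refine ⟨by omega, by omega, by simp [h6], (hf.setArr (by decide)).setReg (by decide), ?_, ?_⟩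
    · rw [List.take_succ_eq_append_getElem hk]
      have hlen : (l.take k).length = k := by simp; omega
      refine hH.append ?_ ?_
      · simp [hlen]
      · intro i hi
        have : i ≠ k := by omega
        simp [this]
    · intro i hi
      have : i ≠ u * n + k := by omega
      simp [this, hfar i hi]
  · rintro h' ⟨h1, h2, h3⟩ -
    rw [List.take_length] at h2
    exact ⟨h1, h2, h3⟩
  · have : l.length * (10 + (Expr.get 3 (.var 2)).cost + 7) ≤ n * 30 := by
      refine Nat.mul_le_mul hl ?_
      simp [Expr.cost]
    simp only [Expr.cost] at this ⊢
    omega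

/-- List the neighbors of the vertex in register `2`. -/
def listRow : Prog :=
  .seq (asg 4 0) (.seq (forE 3 (.var 0)
    (Stmt.ite (.get 0 (.var 2 * .var 0 + .var 3))
      (.seq (.put 2 (.var 2 * .var 0 + .var 4) (.var 3)) (.asg 4 (.var 4 + 1))) .skip).code)
    (put 3 (.var 2) (.var 4)))

theorem run_listRow {n M B : ℕ} (G : WGraph n M)
    (hB : n * n + 4 * (n * M) + 10 * n + 10 * M + 50 < B) (h : State)
    (hi : Inp G h) (u : Fin n) (hu : h.reg 2 = u) :
    Run B listRow h (50 * n + 20) (fun h' => Fr [3, 4] [2, 3] h h' ∧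
      Holds (fun i => h'.arr 2 (u * n + i))
        ((List.finRange n).filter (fun v => G.entry u v ≠ 0)) ∧
      h'.arr 3 u = ((List.finRange n).filter (fun v => G.entry u v ≠ 0)).length ∧
      (∀ i, i < u * n ∨ u * n + n ≤ i → h'.arr 2 i = h.arr 2 i) ∧
      ∀ i : ℕ, i ≠ u → h'.arr 3 i = h.arr 3 i) := by
  set q : Fin n → Bool := fun v => G.entry u v ≠ 0 with hq
  set l := List.finRange n with hl
  have hll : l.length = n := by simp [hl]
  have hfl : ∀ k, ((l.take k).filter q).length ≤ k := fun k =>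
    (List.length_filter_le _ _).trans (by simp)
  have hloop : ∀ h1, Fr [3, 4] [2] h h1 → h1.reg 4 = 0 →
      (∀ i, i < u * n ∨ u * n + n ≤ i → h1.arr 2 i = h.arr 2 i) →
      Run B (forE 3 (.var 0) (Stmt.ite (.get 0 (.var 2 * .var 0 + .var 3))
      (.seq (.put 2 (.var 2 * .var 0 + .var 4) (.var 3)) (.asg 4 (.var 4 + 1))) .skip).code) h1
      (n * (30 + 1 + 7) + 1 + 5)
      (fun h' => Fr [3, 4] [2] h h' ∧ Holds (fun i => h'.arr 2 (u * n + i)) (l.filter q) ∧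
        h'.reg 4 = (l.filter q).length ∧
        ∀ i, i < u * n ∨ u * n + n ≤ i → h'.arr 2 i = h.arr 2 i) := by
    intro h1 hf1 h14 hfar1
    refine Run.forE (N := n) (fun k h' => Fr [3, 4] [2] h h' ∧
      Holds (fun i => h'.arr 2 (u * n + i)) ((l.take k).filter q) ∧
      h'.reg 4 = ((l.take k).filter q).length ∧
      ∀ i, i < u * n ∨ u * n + n ≤ i → h'.arr 2 i = h.arr 2 i) 30 (by norm_num) (by omega)
      ?_ ?_ ?_ ?_
    · exact ⟨hf1.setReg (by decide), by simpa using Holds.nil _, by simpa using h14,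
        by simpa using hfar1⟩
    · rintro k h' hk ⟨hf, -, -⟩ -
      simp [hf.1 0 (by decide), hi.reg0]
    · rintro k h' hk ⟨hf, hH, h4, hfar⟩ h3
      refine Run.conseq (Stmt.run _ ?_) (T' := 30) (by decide) (fun _ h => h)
      have e0 : h'.reg 0 = n := (hf.1 0 (by decide)).trans hi.reg0
      have e2 : h'.reg 2 = u := (hf.1 2 (by decide)).trans hu
      have i1 := idx_lt u.2 hk
      have hlk : l[k]'(by omega) = ⟨k, hk⟩ := by simp [hl]
      have hw : h'.arr 0 (u * n + k) = G.entry u ⟨k, hk⟩ := by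
        rw [hf.2 0 (by decide)]; exact hi.arr0 u ⟨k, hk⟩
      have hle := hfl k
      have i2 := idx_lt u.2 (show ((l.take k).filter q).length < n by omega)
      have htake : (l.take (k + 1)).filter q =
          (l.take k).filter q ++ (if q ⟨k, hk⟩ then [⟨k, hk⟩] else []) := by
        rw [List.take_succ_eq_append_getElem (by omega), List.filter_append, hlk]
        congr 1
        by_cases hql : q ⟨k, hk⟩ <;> simp [hql]
      simp only [Stmt.wp, Expr.ok_get, Expr.ok_add, Expr.ok_mul, Expr.ok_var, Expr.eval_mul,
        Expr.eval_var, Expr.eval_add, Expr.eval_get, e0, e2, h3, hw, h4, State.setArr_reg,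
        Expr.ok_ofNat, Expr.eval_ofNat]
      refine ⟨by omega, fun hc => ?_, fun hc => ?_⟩
      · have hc' : q ⟨k, hk⟩ = true := by simpa [hq] using hc
        rw [hc', if_pos rfl] at htake
        refine ⟨by omega, by simp, by omega, by simpa using h3, ?_, ?_, ?_, ?_⟩
        · exact ((hf.setArr (by decide)).setReg (by decide)).setReg (by decide)
        · rw [htake]
          refine hH.append ?_ ?_
          · simp
          · intro i hi'
            have : i ≠ ((l.take k).filter q).length := by omega
            simp [this]
        · rw [htake]; simp
        · intro i hi'
          have : i ≠ u * n + ((l.take k).filter q).length := by omega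
          simp [this, hfar i hi']
      · have hc' : q ⟨k, hk⟩ = false := by simpa [hq] using hc
        rw [hc', if_neg (by simp), List.append_nil] at htake
        rw [htake]
        exact ⟨by simp, hf.setReg (by decide), by simpa using hH, by simpa using h4,
          by simpa using hfar⟩
    · rintro h' ⟨h2, h3, h4, h5⟩ -
      rw [List.take_of_length_le (by omega)] at h3 h4
      exact ⟨h2, h3, h4, h5⟩
  refine ((Run.asg (Q := fun h' => Fr [3, 4] [2] h h' ∧ h'.reg 4 = 0 ∧
      (∀ i, i < u * n ∨ u * n + n ≤ i → h'.arr 2 i = h.arr 2 i)) (by simp; omega) ?_).seq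
      (fun h1 hh1 => (hloop h1 hh1.1 hh1.2.1 hh1.2.2).seq (T₂ := 3) (fun h2 hh2 => ?_))).conseq
      ?_ (fun _ h => h)
  · exact ⟨(Fr.refl _ _ _).setReg (by decide), by simp, by simp⟩
  · obtain ⟨hf, hH, h4, hfar⟩ := hh2
    have e2 : h2.reg 2 = u := (hf.1 2 (by decide)).trans hu
    refine Run.put (by simp) (by simp) ⟨?_, ?_, ?_, ?_, ?_⟩
    · exact (hf.mono (by decide) (by decide)).setArr (by decide)
    · simpa using hH
    · simp [e2, h4]
    · simpa using hfar
    · intro i hi'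
      simp [e2, hi', hf.2 3 (by decide)]
  · simp only [Expr.cost]
    have : Expr.cost 0 = 1 := rfl
    omega

/-- The lists of neighbors, sorted by the weights of the edges. -/
structure SortedAdj {n M : ℕ} (G : WGraph n M) (u : Fin n) (l : List (Fin n)) : Prop where
  nodup : l.Nodup
  mem : ∀ v, v ∈ l ↔ G.graph.Adj u v
  sorted : l.Pairwise (fun v w => G.entry u v ≤ G.entry u w)

theorem filter_bit_perm {α : Type*} (f : α → ℕ) (l : List α) :
    (l.filter (fun v => f v % 2 = 0) ++ l.filter (fun v => f v % 2 = 1)).Perm l := by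
  have := List.filter_append_perm (fun v => decide (f v % 2 = 0)) l
  refine List.Perm.trans (List.Perm.of_eq ?_) this
  congr 2
  funext v
  have := Nat.mod_two_eq_zero_or_one (f v)
  rcases this with h | h <;> simp [h]

/-- One step of radix sort from the least significant bit: the residue modulo `pw * 2` consists of
the residue modulo `pw` and the next bit. Within one value of the bit the old order is kept, and
between the two values the bit decides. -/
theorem filter_bit_sorted {α : Type*} (f : α → ℕ) (pw : ℕ) (l : List α)
    (hl : l.Pairwise (fun v w => f v % pw ≤ f w % pw)) :
    (l.filter (fun v => f v / pw % 2 = 0) ++ l.filter (fun v => f v / pw % 2 = 1)).Pairwise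
      (fun v w => f v % (pw * 2) ≤ f w % (pw * 2)) := by
  rcases Nat.eq_zero_or_pos pw with rfl | hpw
  · simpa using hl
  have key : ∀ b, (l.filter (fun v => f v / pw % 2 = b)).Pairwise
      (fun v w => f v % (pw * 2) ≤ f w % (pw * 2)) := by
    intro b
    have := hl.filter (fun v => decide (f v / pw % 2 = b))
    refine this.imp_of_mem ?_
    intro v w hv hw hvw
    simp only [List.mem_filter, decide_eq_true_eq] at hv hw
    rw [Nat.mod_mul, Nat.mod_mul, hv.2, hw.2]
    omega
  rw [List.pairwise_append]
  refine ⟨key 0, key 1, fun v hv w hw => ?_⟩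
  simp only [List.mem_filter, decide_eq_true_eq] at hv hw
  rw [Nat.mod_mul, Nat.mod_mul, hv.2, hw.2]
  have := Nat.mod_lt (f v) hpw
  omega

/-- Sort the list of neighbors of the vertex in register `2` by one more bit of the weights. -/
def sortBit : Prog :=
  .seq (asg 4 0) (.seq (passBit 0) (.seq (passBit 1) (.seq copyRow (asg 5 (.var 5 * 2)))))

theorem run_sortBit {n M B : ℕ} (G : WGraph n M)
    (hB : n * n + 4 * (n * M) + 10 * n + 10 * M + 50 < B) (h : State)
    (hi : Inp G h) (u : Fin n) (hu : h.reg 2 = u) (l : List (Fin n)) (hl : l.length ≤ n)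
    (hdeg : h.arr 3 u = l.length) (hrow : Holds (fun i => h.arr 2 (u * n + i)) l)
    (hpw : h.reg 5 ≤ M) :
    Run B sortBit h (150 * n + 40) (fun h' =>
      Fr [4, 5, 6, 7] [2, 8] h h' ∧ h'.reg 5 = h.reg 5 * 2 ∧
      Holds (fun i => h'.arr 2 (u * n + i))
        (l.filter (fun v => G.entry u v / h.reg 5 % 2 = 0) ++
          l.filter (fun v => G.entry u v / h.reg 5 % 2 = 1)) ∧
      (∀ i, i < u * n ∨ u * n + n ≤ i → h'.arr 2 i = h.arr 2 i)) := by
  set l0 := l.filter (fun v => G.entry u v / h.reg 5 % 2 = 0) with hl0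
  set l1 := l.filter (fun v => G.entry u v / h.reg 5 % 2 = 1) with hl1
  have hlen01 : (l0 ++ l1).length = l.length :=
    (filter_bit_perm (fun v => G.entry u v / h.reg 5) l).length_eq
  have s1 := Run.asg (B := B) (x := 4) (e := 0) (h := h)
    (Q := fun g => Fr [4] [] h g ∧ g.reg 4 = 0) (by simp; omega)
    ⟨(Fr.refl _ _ _).setReg (by decide), by simp⟩
  refine (s1.seq (T₂ := 150 * n + 36) (fun g1 ⟨f1, c1⟩ => ?_)).conseq
    (by simp only [show Expr.cost 0 = 1 from rfl]; omega) (fun _ h => h)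
  have r1 := run_passBit G hB g1 (hi.frame f1 (by decide) (by decide) (by decide)) u
    ((f1.1 2 (by decide)).trans hu) l [] hl (by rw [f1.2 3 (by decide)]; exact hdeg)
    (by rw [f1.2 2 (by decide)]; exact hrow) (by simp [c1]) (Holds.nil _) (by simp)
    0 0 (fun h => ⟨rfl, by simp; omega⟩) rfl
  rw [f1.1 5 (by decide), List.nil_append, ← hl0] at r1
  refine (r1.seq (T₂ := 90 * n + 26) (fun g2 ⟨f2, c2, d2⟩ => ?_)).conseq (by omega) (fun _ h => h)
  replace f2 : Fr [4, 6, 7] [8] h g2 :=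
    f1.trans f2 (by decide) (by decide) (by decide) (by decide)
  have hll0 : l0.length ≤ n := (List.length_filter_le _ _).trans hl
  have r2 := run_passBit G hB g2 (hi.frame f2 (by decide) (by decide) (by decide)) u
    ((f2.1 2 (by decide)).trans hu) l l0 hl (by rw [f2.2 3 (by decide)]; exact hdeg)
    (by rw [f2.2 2 (by decide)]; exact hrow) d2 c2 hll0
    1 1 (fun h => ⟨rfl, by simp; omega⟩) rfl
  rw [f2.1 5 (by decide), ← hl1] at r2
  refine (r2.seq (T₂ := 30 * n + 16) (fun g3 ⟨f3, c3, d3⟩ => ?_)).conseq (by omega) (fun _ h => h)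
  replace f3 : Fr [4, 6, 7] [8] h g3 :=
    f2.trans f3 (by decide) (by decide) (by decide) (by decide)
  have r3 := run_copyRow hB g3 ((f3.1 0 (by decide)).trans hi.reg0) u
    ((f3.1 2 (by decide)).trans hu) (l0 ++ l1) (by omega)
    (by rw [f3.2 3 (by decide), hlen01]; exact hdeg) c3
  refine (r3.seq (T₂ := 6) (fun g4 ⟨f4, c4, d4⟩ => ?_)).conseq (by omega) (fun _ h => h)
  rw [f3.2 2 (by decide)] at d4
  have e5 : g4.reg 5 = h.reg 5 := (f4.1 5 (by decide)).trans (f3.1 5 (by decide))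
  replace f4 : Fr [4, 5, 6, 7] [2, 8] h g4 :=
    f3.trans f4 (by decide) (by decide) (by decide) (by decide)
  refine Run.conseq (Run.asg ?_ ?_) (by decide) (fun _ h => h)
  · simp [e5]; omega
  · exact ⟨f4.setReg (by decide), by simp [e5], by simpa using c4, by simpa using d4⟩

/-- Sort the list of neighbors of the vertex in register `2` by the weights of the edges. -/
def sortRow : Prog := .seq (asg 5 1) (whileE (.lt (.var 5) (.var 1 + 1)) sortBit)

/-- The list is kept sorted modulo a power of two that doubles in each pass. When the power exceeds
`M`, the residues are the weights themselves, so `Nat.log 2 M + 1` linear passes are enough. -/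
theorem run_sortRow {n M B : ℕ} (G : WGraph n M)
    (hB : n * n + 4 * (n * M) + 10 * n + 10 * M + 50 < B) (h : State)
    (hi : Inp G h) (u : Fin n) (hu : h.reg 2 = u) (l : List (Fin n)) (hnd : l.Nodup)
    (hmem : ∀ v, v ∈ l ↔ G.graph.Adj u v) (hdeg : h.arr 3 u = l.length)
    (hrow : Holds (fun i => h.arr 2 (u * n + i)) l) :
    Run B sortRow h ((Nat.log 2 M + 1) * (150 * n + 60) + 20) (fun h' =>
      Fr [4, 5, 6, 7] [2, 8] h h' ∧
      (∃ l, SortedAdj G u l ∧ Holds (fun i => h'.arr 2 (u * n + i)) l ∧ h'.arr 3 u = l.length) ∧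
      (∀ i, i < u * n ∨ u * n + n ≤ i → h'.arr 2 i = h.arr 2 i)) := by
  set I : State → Prop := fun h' => Fr [4, 5, 6, 7] [2, 8] h h' ∧
    (∃ b, h'.reg 5 = 2 ^ b) ∧
    (∃ l : List (Fin n), l.Nodup ∧ (∀ v, v ∈ l ↔ G.graph.Adj u v) ∧ h'.arr 3 u = l.length ∧
      Holds (fun i => h'.arr 2 (u * n + i)) l ∧
      l.Pairwise (fun v w => G.entry u v % h'.reg 5 ≤ G.entry u w % h'.reg 5)) ∧
    (∀ i, i < u * n ∨ u * n + n ≤ i → h'.arr 2 i = h.arr 2 i) with hI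
  have hlen : ∀ l : List (Fin n), l.Nodup → l.length ≤ n := fun l hl => by
    simpa using hl.length_le_card
  have h1 := Run.asg (B := B) (x := 5) (e := 1) (h := h)
    (Q := fun h' => I h' ∧ h'.reg 5 = 1) (by simp; omega) (by
      refine ⟨⟨(Fr.refl _ _ _).setReg (by decide), ⟨0, by simp⟩,
        ⟨l, hnd, hmem, hdeg, by simpa using hrow, ?_⟩, by simp⟩, by simp⟩
      simp [Nat.mod_one, List.pairwise_iff_getElem])
  refine (h1.seq (T₂ := (Nat.log 2 M + 1) * (150 * n + 60) + 10) (fun h2 hh2 => ?_)).conseq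
    (by simp only [show Expr.cost 1 = 1 from rfl]; omega) (fun _ h => h)
  refine (Run.whileE I (fun h' => (Nat.log 2 M + 1 - Nat.log 2 (h'.reg 5)) * (150 * n + 60))
      (150 * n + 40) hh2.1 ?_ ?_ ?_).conseq ?_ (fun _ h => h)
  · rintro h' ⟨hf, -⟩
    simp [(hf.1 1 (by decide)).trans hi.reg1]; omega
  · rintro h' ⟨hf, ⟨b, hb⟩, ⟨l, hnd, hmem, hdeg, hrow, hsort⟩, hfar⟩ hc
    have e1 : h'.reg 1 = M := (hf.1 1 (by decide)).trans hi.reg1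
    have hpM : h'.reg 5 ≤ M := by
      simp [e1] at hc; omega
    refine (run_sortBit G hB h' (hi.frame hf (by decide) (by decide) (by decide)) u
      ((hf.1 2 (by decide)).trans hu) l (hlen l hnd) hdeg hrow hpM).conseq le_rfl ?_
    rintro g ⟨f1, f2, f3, f4⟩
    have hperm := filter_bit_perm (fun v => G.entry u v / h'.reg 5) l
    refine ⟨⟨hf.trans f1 (by decide) (by decide) (by decide) (by decide), ⟨b + 1, ?_⟩,
      ⟨_, hperm.nodup_iff.2 hnd, fun v => ?_, ?_, f3, ?_⟩, ?_⟩, ?_⟩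
    · rw [f2, hb, pow_succ]
    · rw [hperm.mem_iff]; exact hmem v
    · rw [f1.2 3 (by decide), hdeg, hperm.length_eq]
    · rw [f2]; exact filter_bit_sorted _ _ _ hsort
    · intro i hi'; rw [f4 i hi', hfar i hi']
    · rw [f2, hb, ← pow_succ, Nat.log_pow (by norm_num), Nat.log_pow (by norm_num)]
      have hbM : b ≤ Nat.log 2 M := by
        rw [← Nat.log_pow (b := 2) (by norm_num) b]
        exact Nat.log_mono_right (hb ▸ hpM)
      rw [show Nat.log 2 M + 1 - b = (Nat.log 2 M + 1 - (b + 1)) + 1 by omega, Nat.add_mul]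
      have : (Expr.lt (.var 5) (.var 1 + 1)).cost = 5 := rfl
      omega
  · rintro h' ⟨hf, ⟨b, hb⟩, ⟨l, hnd, hmem, hdeg, hrow, hsort⟩, hfar⟩ hc
    have e1 : h'.reg 1 = M := (hf.1 1 (by decide)).trans hi.reg1
    have hpM : M < h'.reg 5 := by
      simp [e1] at hc; omega
    refine ⟨hf, ⟨l, ⟨hnd, hmem, ?_⟩, hrow, hdeg⟩, hfar⟩
    refine hsort.imp (fun {v w} hvw => ?_)
    rwa [Nat.mod_eq_of_lt ((G.entry_le _ _).trans_lt hpM),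
      Nat.mod_eq_of_lt ((G.entry_le _ _).trans_lt hpM)] at hvw
  · rw [hh2.2]
    have : (Expr.lt (.var 5) (.var 1 + 1)).cost = 5 := rfl
    simp only [Nat.log_one_right, this, Nat.sub_zero]
    omega

/-- The state contains the sorted adjacency lists `L`. -/
structure Lists {n M : ℕ} (G : WGraph n M) (L : Fin n → List (Fin n)) (h : State) : Prop where
  adj : ∀ u, SortedAdj G u (L u)
  row : ∀ u : Fin n, Holds (fun i => h.arr 2 (u * n + i)) (L u)
  deg : ∀ u : Fin n, h.arr 3 u = (L u).length

theorem Lists.frame {n M : ℕ} {G : WGraph n M} {L : Fin n → List (Fin n)} {h h' : State}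
    (hl : Lists G L h) {R A : List ℕ} (hf : Fr R A h h') (h2 : 2 ∉ A) (h3 : 3 ∉ A) :
    Lists G L h' :=
  ⟨hl.adj, by rw [hf.2 2 h2]; exact hl.row, by rw [hf.2 3 h3]; exact hl.deg⟩

/-- Compute the sorted adjacency lists. -/
def sortAll : Prog := forE 2 (.var 0) (.seq listRow sortRow)

theorem run_sortAll {n M B : ℕ} (G : WGraph n M)
    (hB : n * n + 4 * (n * M) + 10 * n + 10 * M + 50 < B) (h : State) (hi : Inp G h) :
    Run B sortAll h (n * ((Nat.log 2 M + 1) * (150 * n + 60) + 50 * n + 60) + 10) (fun h' =>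
      Fr [2, 3, 4, 5, 6, 7] [2, 3, 8] h h' ∧ ∃ L, Lists G L h') := by
  refine (Run.forE (N := n) (fun k h' => Fr [2, 3, 4, 5, 6, 7] [2, 3, 8] h h' ∧
    ∀ u : Fin n, (u : ℕ) < k → ∃ l, SortedAdj G u l ∧
      Holds (fun i => h'.arr 2 (u * n + i)) l ∧ h'.arr 3 u = l.length)
    ((Nat.log 2 M + 1) * (150 * n + 60) + 50 * n + 40) (by norm_num) (by omega) ?_ ?_ ?_
    (Q := fun h' => Fr [2, 3, 4, 5, 6, 7] [2, 3, 8] h h' ∧ ∃ L, Lists G L h') ?_).conseq ?_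
    (fun _ h => h)
  · exact ⟨(Fr.refl _ _ _).setReg (by decide), fun u hu => by omega⟩
  · rintro k h' - ⟨hf, -⟩ -
    simp [(hf.1 0 (by decide)).trans hi.reg0]
  · rintro k h' hk ⟨hf, hdone⟩ h2
    have hi' := hi.frame hf (by decide) (by decide) (by decide)
    refine ((run_listRow G hB h' hi' ⟨k, hk⟩ h2).seq
      (T₂ := (Nat.log 2 M + 1) * (150 * n + 60) + 20) (fun g ⟨f1, r1, d1, a1, b1⟩ =>
      (run_sortRow G hB g (hi'.frame f1 (by decide) (by decide) (by decide)) ⟨k, hk⟩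
        ((f1.1 2 (by decide)).trans h2) _ ((List.nodup_finRange n).filter _) (fun v => by
          simp [← G.entry_ne_zero_iff]) d1 r1).conseq le_rfl ?_)).conseq (by omega) (fun _ h => h)
    rintro g' ⟨f2, r2, a2⟩
    have f3 := f1.trans f2 (S := [3, 4, 5, 6, 7]) (C := [2, 3, 8]) (by decide) (by decide)
      (by decide) (by decide)
    refine ⟨(f3.1 2 (by decide)).trans h2,
      (hf.trans f3 (by decide) (by decide) (by decide) (by decide)).setReg (by decide), ?_⟩
    intro u hu
    rw [State.setReg_arr]
    rcases Nat.lt_succ_iff_lt_or_eq.1 hu with hlt | heq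
    · obtain ⟨l, l1, l2, l3⟩ := hdone u hlt
      have hln : l.length ≤ n := by simpa using l1.nodup.length_le_card
      refine ⟨l, l1, l2.congr (fun i hi'' => ?_), ?_⟩
      · have := Nat.mul_le_mul_right n (Nat.succ_le_of_lt hlt)
        rw [Nat.succ_mul] at this
        simp only [] at a1 a2 ⊢
        rw [a2 _ (Or.inl (by omega)), a1 _ (Or.inl (by omega))]
      · rw [f2.2 3 (by decide), b1 u (by simp; omega), l3]
    · obtain rfl : u = ⟨k, hk⟩ := Fin.ext heq
      exact r2
  · rintro h' ⟨hf, hdone⟩ -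
    choose L hL using fun u : Fin n => hdone u u.2
    exact ⟨hf, L, ⟨fun u => (hL u).1, fun u => (hL u).2.1, fun u => (hL u).2.2⟩⟩
  · simp only [show (Expr.var 0).cost = 1 from rfl]
    have : (Nat.log 2 M + 1) * (150 * n + 60) + 50 * n + 40 + 1 + 7 ≤
      (Nat.log 2 M + 1) * (150 * n + 60) + 50 * n + 60 := by omega
    have := Nat.mul_le_mul_left n this
    omega

end WordRAM


/-! ### Growing an exploration tree -/

namespace WGraph

variable {n M : ℕ} {G : WGraph n M} {b t : ℕ} {s : Fin n} {D P F D' P' F' : ℕ → ℕ}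

/-- The parent lies within the threshold and the last edge adds at most `M`. For `b = 0` the
threshold may really be exceeded by that edge. -/
theorem PTree.D_le (T : G.PTree b t s D P F) (v : Fin n) (hv : F v ≠ 0) : D v ≤ t + M := by
  by_cases hvs : v = s
  · rw [hvs, T.D_root]; omega
  · obtain ⟨u, -, -, -, hD, hle, -⟩ := T.step v hv hvs
    have := G.entry_le u v
    have := Nat.le_of_add_right_le hle
    omega

theorem PTree.congr (T : G.PTree b t s D P F) (hD : ∀ v : Fin n, D' v = D v)
    (hP : ∀ v : Fin n, P' v = P v) (hF : ∀ v : Fin n, F' v = F v) : G.PTree b t s D' P' F' := by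
  refine ⟨by rw [hF, T.F_root], by rw [hD, T.D_root], by rw [hP, T.P_root], fun v hv hvs => ?_⟩
  rw [hF] at hv
  obtain ⟨u, h1, h2, h3, h4, h5, h6⟩ := T.step v hv hvs
  exact ⟨u, by rw [hP, h1], by rwa [hF], h3, by rw [hD, hD, h4], by rwa [hD], by rw [hF, hF, h6]⟩

/-- Add a vertex to a tree. -/
theorem PTree.insert (T : G.PTree b t s D P F) {u v : Fin n} (hu : F u ≠ 0) (hv : F v = 0)
    (ha : G.graph.Adj u v) (hle : D u + b * G.entry u v ≤ t)
    (hD : ∀ x : Fin n, D' x = if x = v then D u + G.entry u v else D x)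
    (hP : ∀ x : Fin n, P' x = if x = v then (u : ℕ) else P x)
    (hF : ∀ x : Fin n, F' x = if x = v then (if u = s then (v : ℕ) + 1 else F u) else F x) :
    G.PTree b t s D' P' F' := by
  have hsv : s ≠ v := by rintro rfl; rw [T.F_root] at hv; omega
  have hne : ∀ x : Fin n, F x ≠ 0 → x ≠ v := by rintro x hx rfl; exact hx hv
  refine ⟨?_, ?_, ?_, fun x hx hxs => ?_⟩
  · rw [hF, if_neg hsv, T.F_root]
  · rw [hD, if_neg hsv, T.D_root]
  · rw [hP, if_neg hsv, T.P_root]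
  · by_cases hxv : x = v
    · subst hxv
      refine ⟨u, by rw [hP, if_pos rfl], ?_, ha, ?_, ?_, ?_⟩
      · rw [hF, if_neg (hne u hu)]; exact hu
      · rw [hD, hD, if_pos rfl, if_neg (hne u hu)]
      · rw [hD, if_neg (hne u hu)]; exact hle
      · rw [hF, hF, if_pos rfl, if_neg (hne u hu)]
    · rw [hF, if_neg hxv] at hx
      obtain ⟨y, h1, h2, h3, h4, h5, h6⟩ := T.step x hx hxs
      have hy := hne y h2
      refine ⟨y, by rw [hP, if_neg hxv, h1], by rwa [hF, if_neg hy], h3, ?_, ?_, ?_⟩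
      · rw [hD, hD, if_neg hxv, if_neg hy, h4]
      · rw [hD, if_neg hy]; exact h5
      · rw [hF, hF, if_neg hxv, if_neg hy, h6]

end WGraph

/-! ### The invariant of breadth first search -/

namespace WordRAM

open WGraph

variable {n M : ℕ}

/-- The edge `uv` is in the tree if it may be explored from `u`. -/
def EdgeDone (G : WGraph n M) (b t : ℕ) (D P F : ℕ → ℕ) (u v : Fin n) : Prop :=
  D u + b * G.entry u v ≤ t → F v ≠ 0 ∧ (P v = u ∨ P u = v)

/-- The invariant of breadth first search with the queue `Q`; the first `head` vertices are finished,
and of the next one the first `j` neighbors. -/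
structure Bfs (G : WGraph n M) (L : Fin n → List (Fin n)) (b t : ℕ) (s : Fin n) (D P F : ℕ → ℕ)
    (Q : List (Fin n)) (head j : ℕ) : Prop where
  tree : G.PTree b t s D P F
  nodup : Q.Nodup
  mem : ∀ v, v ∈ Q ↔ F v ≠ 0
  head_le : head ≤ Q.length
  done : ∀ i : ℕ, i < head → ∀ u : Fin n, Q[i]? = some u → ∀ v, G.graph.Adj u v → EdgeDone G b t D P F u v
  cur : ∀ u : Fin n, Q[head]? = some u → ∀ v ∈ (L u).take j, EdgeDone G b t D P F u v
  kids : ∀ v : Fin n, F v ≠ 0 → v ≠ s → ∃ (i : ℕ) (u : Fin n), Q[i]? = some u ∧ P v = u ∧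
    (i < head ∨ i = head ∧ v ∈ (L u).take j)

variable {G : WGraph n M} {L : Fin n → List (Fin n)} {b t : ℕ} {s : Fin n} {D P F D' P' F' : ℕ → ℕ}
  {Q : List (Fin n)} {head j : ℕ}

/-- With the queue exhausted, every visited vertex is among the finished ones. -/
theorem Bfs.complete (I : Bfs G L b t s D P F Q Q.length j) : G.Complete b t D P F := by
  intro u v hu ha hle
  obtain ⟨i, hi, rfl⟩ := List.getElem_of_mem ((I.mem u).2 hu)
  exact I.done i hi _ (by simp [hi]) v ha hle

/-- Covers both reasons for leaving the current vertex: the list is exhausted, or the rest of the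
sorted list is too heavy, in which case `EdgeDone` holds vacuously. -/
theorem Bfs.advance (I : Bfs G L b t s D P F Q head j) {u : Fin n} (hu : Q[head]? = some u)
    (h : ∀ v, G.graph.Adj u v → v ∉ (L u).take j → EdgeDone G b t D P F u v) :
    Bfs G L b t s D P F Q (head + 1) 0 := by
  have hlt := (List.getElem?_eq_some_iff.1 hu).1
  refine ⟨I.tree, I.nodup, I.mem, hlt, fun i hi x hx v ha => ?_, by simp, fun v hv hvs => ?_⟩
  · rcases Nat.lt_succ_iff_lt_or_eq.1 hi with h1 | h1
    · exact I.done i h1 x hx v ha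
    · subst h1
      obtain rfl : u = x := by rw [hu] at hx; exact Option.some.inj hx
      by_cases hm : v ∈ (L u).take j
      · exact I.cur u hu v hm
      · exact h v ha hm
  · obtain ⟨i, x, h1, h2, h3⟩ := I.kids v hv hvs
    exact ⟨i, x, h1, h2, Or.inl (by omega)⟩

/-- Serves for the edge that leads back to the parent of the current vertex. -/
theorem Bfs.skip (I : Bfs G L b t s D P F Q head j) {u v : Fin n} (hu : Q[head]? = some u)
    (hv : (L u)[j]? = some v) (h : EdgeDone G b t D P F u v) :
    Bfs G L b t s D P F Q head (j + 1) := by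
  refine ⟨I.tree, I.nodup, I.mem, I.head_le, I.done, fun x hx y hy => ?_, fun x hx hxs => ?_⟩
  · obtain rfl : u = x := by rw [hu] at hx; exact Option.some.inj hx
    rw [List.take_add_one, hv, List.mem_append] at hy
    rcases hy with hy | hy
    · exact I.cur u hu y hy
    · obtain rfl : y = v := by simpa using hy
      exact h
  · obtain ⟨i, y, h1, h2, h3⟩ := I.kids x hx hxs
    refine ⟨i, y, h1, h2, h3.imp_right (fun h4 => ⟨h4.1, ?_⟩)⟩
    rw [List.take_add_one, List.mem_append]
    exact Or.inl h4.2

/-- The edges handled so far stay handled: where their condition applies, both of their ends were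
visited before, and the updates touch only the new vertex. -/
theorem Bfs.insert (I : Bfs G L b t s D P F Q head j) {u v : Fin n} (hu : Q[head]? = some u)
    (hv : (L u)[j]? = some v) (hFv : F v = 0) (ha : G.graph.Adj u v)
    (hle : D u + b * G.entry u v ≤ t)
    (hD : ∀ x : Fin n, D' x = if x = v then D u + G.entry u v else D x)
    (hP : ∀ x : Fin n, P' x = if x = v then (u : ℕ) else P x)
    (hF : ∀ x : Fin n, F' x = if x = v then (if u = s then (v : ℕ) + 1 else F u) else F x) :
    Bfs G L b t s D' P' F' (Q ++ [v]) head (j + 1) := by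
  have hlt := (List.getElem?_eq_some_iff.1 hu).1
  have hFu : F u ≠ 0 := (I.mem u).1 (List.mem_of_getElem? hu)
  have hvQ : v ∉ Q := fun h => (I.mem v).1 h hFv
  have hne : ∀ x : Fin n, F x ≠ 0 → x ≠ v := by rintro x hx rfl; exact hx hFv
  have hFv' : F' v ≠ 0 := by rw [hF, if_pos rfl]; split_ifs <;> omega
  have hget : ∀ i : ℕ, ∀ x : Fin n, i ≤ head → (Q ++ [v])[i]? = some x → Q[i]? = some x := by
    intro i x hi hx
    rwa [List.getElem?_append_left (by omega)] at hx
  have hed : ∀ x y : Fin n, F x ≠ 0 → EdgeDone G b t D P F x y → EdgeDone G b t D' P' F' x y := by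
    intro x y hx h hle'
    rw [hD, if_neg (hne x hx)] at hle'
    obtain ⟨h1, h2⟩ := h hle'
    rw [hF, hP, hP, if_neg (hne x hx), if_neg (hne y h1), if_neg (hne y h1)]
    exact ⟨h1, h2⟩
  have hQF : ∀ i : ℕ, ∀ x : Fin n, Q[i]? = some x → F x ≠ 0 := fun i x hx =>
    (I.mem x).1 (List.mem_of_getElem? hx)
  refine ⟨I.tree.insert hFu hFv ha hle hD hP hF, ?_, fun x => ?_, by simp; omega,
    fun i hi x hx y hxy => ?_, fun x hx y hy => ?_, fun x hx hxs => ?_⟩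
  · exact List.nodup_append.2 ⟨I.nodup, by simp, by
      rintro a h1 b h2 rfl; simp at h2; exact hvQ (h2 ▸ h1)⟩
  · rw [List.mem_append, I.mem, hF]
    by_cases hxv : x = v
    · subst hxv; rw [← hF]; simp [hFv']
    · simp [hxv]
  · have hx' := hget i x (by omega) hx
    exact hed x y (hQF i x hx') (I.done i hi x hx' y hxy)
  · have hx' := hget head x le_rfl hx
    obtain rfl : u = x := by rw [hu] at hx'; exact Option.some.inj hx'
    rw [List.take_add_one, hv, List.mem_append] at hy
    rcases hy with hy | hy
    · exact hed u y hFu (I.cur u hu y hy)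
    · obtain rfl : y = v := by simpa using hy
      intro _
      exact ⟨hFv', Or.inl (by rw [hP, if_pos rfl])⟩
  · by_cases hxv : x = v
    · subst hxv
      refine ⟨head, u, ?_, by rw [hP, if_pos rfl], Or.inr ⟨rfl, ?_⟩⟩
      · rw [List.getElem?_append_left hlt, hu]
      · rw [List.take_add_one, hv]; simp
    · rw [hF, if_neg hxv] at hx
      obtain ⟨i, y, h1, h2, h3⟩ := I.kids x hx hxs
      refine ⟨i, y, ?_, by rw [hP, if_neg hxv, h2], h3.imp_right (fun h4 => ⟨h4.1, ?_⟩)⟩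
      · rw [List.getElem?_append_left (List.getElem?_eq_some_iff.1 h1).1, h1]
      · rw [List.take_add_one, List.mem_append]; exact Or.inl h4.2

/-- The current edge closes a cycle if its other end has been visited and is not the parent. -/
theorem Bfs.closing (I : Bfs G L b t s D P F Q head j) {u v : Fin n}
    (hL : (L u).Nodup) (hu : Q[head]? = some u)
    (hv : (L u)[j]? = some v) (hFv : F v ≠ 0) (ha : G.graph.Adj u v)
    (hle : D u + b * G.entry u v ≤ t) (hPu : P u ≠ v) : G.Closing b t D P F u v := by
  have hFu : F u ≠ 0 := (I.mem u).1 (List.mem_of_getElem? hu)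
  refine ⟨hFu, hFv, ha, hle, fun hP => ?_, hPu⟩
  have hvs : v ≠ s := by
    rintro rfl; rw [I.tree.P_root] at hP; have := u.2; omega
  obtain ⟨i, y, h1, h2, h3⟩ := I.kids v hFv hvs
  obtain rfl : y = u := Fin.ext (by rw [← h2, hP])
  -- If `u` were the parent of `v`, then by the field `kids` the vertex `v` would be among the first
  -- `j` neighbors of `u`. But `v` stands at position `j` in a list without repetitions.
  have hi : i = head := by
    have l1 := List.getElem?_eq_some_iff.1 h1
    have l2 := List.getElem?_eq_some_iff.1 hu
    obtain ⟨l1, e1⟩ := l1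
    obtain ⟨l2, e2⟩ := l2
    exact (I.nodup.getElem_inj_iff).1 (e1.trans e2.symm)
  rcases h3 with h3 | ⟨-, h3⟩
  · omega
  · obtain ⟨k, hk, he⟩ := List.getElem_of_mem h3
    obtain ⟨l2, e2⟩ := List.getElem?_eq_some_iff.1 hv
    rw [List.getElem_take] at he
    have hk' : k < j := by
      rw [List.length_take] at hk; omega
    have := (hL.getElem_inj_iff).1 (he.trans e2.symm)
    omega

theorem Bfs.init (D P F : ℕ → ℕ) (hF : ∀ x : Fin n, F x = if x = s then n + 1 else 0)
    (hD : D s = 0) (hP : P s = n) : Bfs G L b t s D P F [s] 0 0 := by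
  have hs : ∀ x : Fin n, F x ≠ 0 ↔ x = s := by
    intro x; rw [hF]; split_ifs with h <;> simp [h]
  refine ⟨⟨by rw [hF, if_pos rfl], hD, hP, fun v hv hvs => absurd ((hs v).1 hv) hvs⟩, by simp,
    fun v => by rw [hs]; simp, by simp, by simp, by simp,
    fun v hv hvs => absurd ((hs v).1 hv) hvs⟩

end WordRAM


/-! ### Breadth first search in linear time -/

namespace WordRAM

open WGraph

variable {n M : ℕ}

/-- One step of breadth first search from the vertex in register `12` with the parameters in the
registers `10` and `11`. -/
def bfsStep : Stmt :=
  .seq (.asg 16 (.get 7 (.var 14))) <|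
  .ite (.lt (.var 17) (.get 3 (.var 16)))
    (.seq (.asg 18 (.get 2 (.var 16 * .var 0 + .var 17))) <|
     .seq (.asg 19 (.get 4 (.var 12 * .var 0 + .var 16))) <|
     .seq (.asg 22 (.get 0 (.var 16 * .var 0 + .var 18))) <|
     .ite (.lt (.var 11) (.var 19 + .var 10 * .var 22))
      (.seq (.asg 14 (.var 14 + 1)) (.asg 17 0))
      (.ite (.eq (.var 18) (.get 5 (.var 12 * .var 0 + .var 16)))
        (.asg 17 (.var 17 + 1))
        (.ite (.get 6 (.var 12 * .var 0 + .var 18))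
          (.seq (.asg 13 1) <| .seq (.asg 20 (.var 16)) <| .seq (.asg 21 (.var 18)) <|
            .asg 14 (.var 15))
          (.seq (.ite (.eq (.var 16) (.var 12))
              (.put 6 (.var 12 * .var 0 + .var 18) (.var 18 + 1))
              (.put 6 (.var 12 * .var 0 + .var 18) (.get 6 (.var 12 * .var 0 + .var 16)))) <|
           .seq (.put 5 (.var 12 * .var 0 + .var 18) (.var 16)) <|
           .seq (.put 4 (.var 12 * .var 0 + .var 18) (.var 19 + .var 22)) <|
           .seq (.put 7 (.var 15) (.var 18)) <|
           .seq (.asg 15 (.var 15 + 1)) (.asg 17 (.var 17 + 1))))))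
    (.seq (.asg 14 (.var 14 + 1)) (.asg 17 0))

/-- The row of the vertex `s` in the array `a`. -/
def row {n : ℕ} (h : State) (a : ℕ) (s : Fin n) : ℕ → ℕ := fun v => h.arr a (s * n + v)

/-- The state `h` is obtained from `h₀` by filling the rows of `s` with an exploration tree. -/
structure ExpTree (G : WGraph n M) (b t : ℕ) (s : Fin n) (h₀ h : State) : Prop where
  fr : Fr [13, 14, 15, 16, 17, 18, 19, 20, 21, 22] [4, 5, 6, 7] h₀ h
  far : ∀ a i, a ≠ 7 → (i < s * n ∨ s * n + n ≤ i) → h.arr a i = h₀.arr a i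
  tree : G.PTree b t s (row h 4 s) (row h 5 s) (row h 6 s)

/-- Breadth first search stopped with a closing edge. -/
def Found (G : WGraph n M) (b t : ℕ) (s : Fin n) (h : State) : Prop :=
  h.reg 13 = 1 ∧ ∃ u v : Fin n, h.reg 20 = u ∧ h.reg 21 = v ∧
    G.Closing b t (row h 4 s) (row h 5 s) (row h 6 s) u v

/-- The parent of the current vertex has been seen in its adjacency list. -/
def SeenParent (s : Fin n) (h : State) : Prop :=
  ∃ i < h.reg 17, h.arr 2 (h.arr 7 (h.reg 14) * n + i) = row h 5 s (h.arr 7 (h.reg 14))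

open Classical in
/-- The number of remaining steps. -/
noncomputable def bfsLeft (s : Fin n) (h : State) : ℕ :=
  2 * (n - h.reg 15) + 2 * (n - h.reg 14) + if SeenParent s h then 0 else 1

/-- This potential makes an exploration linear in `n`. Finishing a vertex or adding one lowers the
main term by two, enough to pay for a fresh parent bit. The only other step without a closing edge
passes the parent, which happens once per vertex and spends that bit. -/
theorem bfsLeft_lt {s : Fin n} {h h' : State}
    (hx : 2 * (n - h'.reg 15) + 2 * (n - h'.reg 14) + 2 ≤
        2 * (n - h.reg 15) + 2 * (n - h.reg 14) ∨
      h'.reg 15 = h.reg 15 ∧ h'.reg 14 = h.reg 14 ∧ SeenParent s h' ∧ ¬ SeenParent s h) :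
    bfsLeft s h' + 1 ≤ bfsLeft s h := by
  unfold bfsLeft
  rcases hx with hx | ⟨h1, h2, h3, h4⟩
  · split_ifs <;> omega
  · rw [if_pos h3, if_neg h4, h1, h2]

/-- The state during breadth first search. -/
def BfsState (G : WGraph n M) (L : Fin n → List (Fin n)) (b t : ℕ) (s : Fin n)
    (h₀ h : State) : Prop :=
  ExpTree G b t s h₀ h ∧ ((h.reg 13 = 0 ∧ ∃ Q, Bfs G L b t s (row h 4 s) (row h 5 s) (row h 6 s) Q
    (h.reg 14) (h.reg 17) ∧ h.reg 15 = Q.length ∧ Holds (h.arr 7) Q) ∨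
    h.reg 14 = h.reg 15 ∧ Found G b t s h)

/-- A step finishes the current vertex, passes its parent, adds a vertex, or meets a visited vertex
that is not the parent. In the last case the search is stopped by setting the head of the queue to
its tail. -/
theorem run_bfsStep {B : ℕ} (G : WGraph n M) (L : Fin n → List (Fin n)) {b t : ℕ} {s : Fin n}
    (hB : n * n + 4 * (n * M) + 10 * n + 10 * M + 50 < B) (hb : b ≤ 1) (ht : t ≤ n * M + 1)
    (h₀ h : State) (hi : Inp G h₀) (hL : Lists G L h₀) (hrb : h₀.reg 10 = b) (hrt : h₀.reg 11 = t)
    (hrs : h₀.reg 12 = s) (hS : BfsState G L b t s h₀ h) (hlt : h.reg 14 < h.reg 15) :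
    Run B bfsStep.code h bfsStep.cost
      (fun h' => BfsState G L b t s h₀ h' ∧ bfsLeft s h' + 1 ≤ bfsLeft s h) := by
  obtain ⟨⟨fr, far, -⟩, ⟨hflag, Q, hQ, htail, hH⟩ | ⟨hht, -⟩⟩ := hS
  swap
  · omega
  have hi' : Inp G h := hi.frame fr (by decide) (by decide) (by decide)
  have hL' : Lists G L h := hL.frame fr (by decide) (by decide)
  have e0 : h.reg 0 = n := hi'.reg0
  have e10 : h.reg 10 = b := (fr.1 10 (by decide)).trans hrb
  have e11 : h.reg 11 = t := (fr.1 11 (by decide)).trans hrt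
  have e12 : h.reg 12 = s := (fr.1 12 (by decide)).trans hrs
  have hhead : h.reg 14 < Q.length := by omega
  obtain ⟨u, hu⟩ : ∃ u, Q[h.reg 14]? = some u := ⟨_, List.getElem?_eq_getElem hhead⟩
  have e7 : h.arr 7 (h.reg 14) = u := hH _ _ hu
  have edeg := hL'.deg u
  have hFu : row h 6 s u ≠ 0 := (hQ.mem u).1 (List.mem_of_getElem? hu)
  have hDle := hQ.tree.D_le u hFu
  have hQn : Q.length ≤ n := by simpa using hQ.nodup.length_le_card
  have i1 := idx_lt s.2 u.2
  have hsn : (s : ℕ) * n ≤ n * n := by omega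
  refine Stmt.run _ ?_
  -- Leaving the current vertex changes no array, so the two ways of doing so share this argument.
  have hadv : ∀ g : State, (∀ x, x ∉ [14, 16, 17, 18, 19, 22] → g.reg x = h.reg x) → g.arr = h.arr →
      g.reg 14 = h.reg 14 + 1 → g.reg 17 = 0 →
      (∀ v, G.graph.Adj u v → v ∉ (L u).take (h.reg 17) →
        EdgeDone G b t (row h 4 s) (row h 5 s) (row h 6 s) u v) →
      BfsState G L b t s h₀ g ∧ bfsLeft s g + 1 ≤ bfsLeft s h := by
    intro g g1 g2 g3 g4 hdone
    have hrow : ∀ a, row g a s = row h a s := fun a => by unfold row; rw [g2]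
    refine ⟨⟨⟨fr.trans ⟨g1, fun a _ => by rw [g2]⟩ (R' := [14, 16, 17, 18, 19, 22]) (A' := [])
      (by decide) (by decide) (by decide) (by decide), by rw [g2]; exact far, ?_⟩,
      Or.inl ⟨by rw [g1 13 (by decide), hflag], Q, ?_, ?_, ?_⟩⟩, bfsLeft_lt (Or.inl ?_)⟩
    · rw [hrow, hrow, hrow]; exact hQ.tree
    · rw [hrow, hrow, hrow, g3, g4]; exact hQ.advance hu hdone
    · rw [g1 15 (by decide), htail]
    · rw [g2]; exact hH
    · rw [g1 15 (by decide), g3]; omega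
  simp only [bfsStep, Stmt.wp, Expr.ok_get, Expr.ok_add, Expr.ok_mul, Expr.ok_var, Expr.eval_mul,
    Expr.eval_var, Expr.eval_add, Expr.eval_get, Expr.ok_eq, Expr.ok_lt, Expr.eval_lt,
    State.setReg_reg, State.setReg_arr, Expr.eval_eq, State.setArr_reg, reduceIte,
    Expr.eval_ofNat, Expr.ok_ofNat, e0, e10, e11, e12, e7, edeg, Nat.reduceEqDiff,
    Nat.reduceLeDiff, true_and]
  refine ⟨by omega, fun hj => ?_, fun hj => ?_⟩
  swap
  · have hj' : (L u).length ≤ h.reg 17 := by simpa using hj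
    refine ⟨by omega, by omega, ?_⟩
    refine hadv _ (fun x hx => ?_) rfl (by simp) (by simp) (fun v hv hv' => ?_)
    · simp only [List.mem_cons, not_or] at hx
      simp [hx]
    · rw [List.take_of_length_le hj'] at hv'
      exact absurd (((hL'.adj u).mem v).2 hv) hv'
  have hj' : h.reg 17 < (L u).length := by simpa using hj
  obtain ⟨v, hv⟩ : ∃ v, (L u)[h.reg 17]? = some v := ⟨_, List.getElem?_eq_getElem hj'⟩
  have hadj : G.graph.Adj u v := ((hL'.adj u).mem v).1 (List.mem_of_getElem? hv)
  have e2 : h.arr 2 (u * n + h.reg 17) = v := hL'.row u _ _ hv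
  have ew : h.arr 0 (u * n + v) = G.entry u v := hi'.arr0 u v
  have hwM := G.entry_le u v
  have i2 := idx_lt s.2 v.2
  have i3 := idx_lt u.2 v.2
  have hLn : (L u).length ≤ n := by simpa using (hL'.adj u).nodup.length_le_card
  have i4 := idx_lt u.2 (hj'.trans_le hLn)
  have hbw : b * G.entry u v ≤ G.entry u v := by
    simpa using Nat.mul_le_mul_right (G.entry u v) hb
  have eD : h.arr 4 (s * n + u) = row h 4 s u := rfl
  have eP : h.arr 5 (s * n + u) = row h 5 s u := rfl
  have eF : h.arr 6 (s * n + v) = row h 6 s v := rfl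
  have eF' : h.arr 6 (s * n + u) = row h 6 s u := rfl
  simp only [e2, ew, eD, eP, eF, eF']
  refine ⟨by omega, by omega, by omega, by omega, fun hc => ?_, fun hc => ?_⟩
  · have hc' : t < row h 4 s u + b * G.entry u v := by simpa using hc
    refine ⟨by omega, by omega, ?_⟩
    refine hadv _ (fun x hx => ?_) rfl (by simp) (by simp) (fun y hy hy' => ?_)
    · simp only [List.mem_cons, not_or] at hx
      simp [hx]
    · intro hle
      exfalso
      obtain ⟨k, hk, rfl⟩ := List.getElem_of_mem (((hL'.adj u).mem y).2 hy)
      have hk' : h.reg 17 ≤ k := by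
        by_contra! hlt'
        exact hy' (List.mem_take_iff_getElem.2 ⟨k, by omega, rfl⟩)
      -- The list is sorted by weight, so once one edge exceeds the threshold all later ones do.
      have hvw : G.entry u v ≤ G.entry u (L u)[k] := by
        have hv' : v = (L u)[h.reg 17] := by
          rw [List.getElem?_eq_getElem hj'] at hv; exact (Option.some.inj hv).symm
        rw [hv']
        rcases hk'.lt_or_eq with h1 | h1
        · exact List.pairwise_iff_getElem.1 (hL'.adj u).sorted _ _ _ _ h1
        · simp [h1]
      have := Nat.mul_le_mul_left b hvw
      omega
  have hle : row h 4 s u + b * G.entry u v ≤ t := by simpa using hc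
  refine ⟨by omega, fun hc2 => ?_,
    fun hc2 => ?_⟩
  · have hvP : (v : ℕ) = row h 5 s u := by simpa using hc2
    refine ⟨by omega, ?_⟩
    set g := (((((h.setReg 16 ↑u).setReg 18 ↑v).setReg 19 (row h 4 s ↑u)).setReg 22
      (G.entry u v)).setReg 17 (h.reg 17 + 1)) with hg
    have hrow : ∀ a, row g a s = row h a s := fun a => rfl
    have hFv : row h 6 s v ≠ 0 := by
      by_cases hus : u = s
      · subst hus; rw [hQ.tree.P_root] at hvP; have := v.2; omega
      · obtain ⟨y, h1, h2, -⟩ := hQ.tree.step u hFu hus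
        obtain rfl : y = v := Fin.ext (by rw [← h1, hvP])
        exact h2
    -- The parent occurs only once in the list, so its bit in the potential has not been spent
    -- before.
    have hseen : ¬ SeenParent s h := by
      rintro ⟨k, hk, he⟩
      have hk2 : h.arr 2 (u * n + k) = ((L u)[k]'(by omega) : Fin n) :=
        hL'.row u k _ (by simp)
      rw [e7, ← hvP, hk2] at he
      obtain ⟨l2, e2'⟩ := List.getElem?_eq_some_iff.1 hv
      have := ((hL'.adj u).nodup.getElem_inj_iff).1 ((Fin.ext he).trans e2'.symm)
      omega
    refine ⟨⟨⟨((((fr.setReg (by decide)).setReg (by decide)).setReg (by decide)).setReg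
      (by decide)).setReg (by decide), far, hQ.tree⟩,
      Or.inl ⟨by simpa [hg] using hflag, Q, ?_, by simpa [hg] using htail, hH⟩⟩,
      bfsLeft_lt (Or.inr ⟨by simp [hg], by simp [hg], ?_, hseen⟩)⟩
    · simp only [hg, State.setReg_reg, reduceIte, Nat.reduceEqDiff]
      exact hQ.skip hu hv (fun _ => ⟨hFv, Or.inr hvP.symm⟩)
    · refine ⟨h.reg 17, by simp [hg], ?_⟩
      simp only [hg, State.setReg_reg, reduceIte, Nat.reduceEqDiff, State.setReg_arr, e7, e2]
      exact hvP
  have hPne : row h 5 s u ≠ v := by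
    intro h'; simp [h'] at hc2
  refine ⟨by omega, fun hFv => ?_, fun hFv => ?_⟩
  · refine ⟨by omega, ?_⟩
    refine ⟨⟨⟨?_, far, hQ.tree⟩, Or.inr ⟨by simp, by simp, u, v, by simp, by simp, ?_⟩⟩,
      bfsLeft_lt (Or.inl ?_)⟩
    · exact (((((((fr.setReg (by decide)).setReg (by decide)).setReg (by decide)).setReg
        (by decide)).setReg (by decide)).setReg (by decide)).setReg (by decide)).setReg (by decide)
    · exact hQ.closing (hL'.adj u).nodup hu hv hFv hadj hle hPne
    · simp; omega
  have hvQ : v ∉ Q := fun h' => (hQ.mem v).1 h' hFv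
  have hins : ∀ g : State, Fr [15, 16, 17, 18, 19, 22] [4, 5, 6, 7] h g →
      (∀ a, a ≠ 7 → a ∈ [4, 5, 6] → ∀ i, i ≠ s * n + v → g.arr a i = h.arr a i) →
      g.arr 4 (s * n + v) = row h 4 s u + G.entry u v → g.arr 5 (s * n + v) = u →
      g.arr 6 (s * n + v) = (if u = s then (v : ℕ) + 1 else row h 6 s u) →
      g.arr 7 = Function.update (h.arr 7) (h.reg 15) v →
      g.reg 15 = h.reg 15 + 1 → g.reg 17 = h.reg 17 + 1 →
      BfsState G L b t s h₀ g ∧ bfsLeft s g + 1 ≤ bfsLeft s h := by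
    intro g gf gfar g4 g5 g6 g7 g15 g17
    have hrow : ∀ a, a ≠ 7 → a ∈ [4, 5, 6] → ∀ x : Fin n, row g a s x =
        if x = v then g.arr a (s * n + v) else row h a s x := by
      intro a ha ha' x
      split_ifs with hx
      · rw [hx]; rfl
      · exact gfar a ha ha' _ (fun he => hx (Fin.ext (by omega)))
    have hD : ∀ x : Fin n, row g 4 s x =
        if x = v then row h 4 s u + G.entry u v else row h 4 s x := by
      intro x; rw [hrow 4 (by norm_num) (by decide), g4]
    have hP : ∀ x : Fin n, row g 5 s x = if x = v then (u : ℕ) else row h 5 s x := by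
      intro x; rw [hrow 5 (by norm_num) (by decide), g5]
    have hF : ∀ x : Fin n, row g 6 s x =
        if x = v then (if u = s then (v : ℕ) + 1 else row h 6 s u) else row h 6 s x := by
      intro x; rw [hrow 6 (by norm_num) (by decide), g6]
    have hb' := hQ.insert hu hv hFv hadj hle hD hP hF
    have hlen : (Q ++ [v]).length ≤ n := by simpa using hb'.nodup.length_le_card
    rw [List.length_append, List.length_singleton] at hlen
    refine ⟨⟨⟨fr.trans gf (by decide) (by decide) (by decide) (by decide), ?_, hb'.tree⟩,
      Or.inl ⟨by rw [gf.1 13 (by decide), hflag], Q ++ [v], ?_, ?_, ?_⟩⟩,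
      bfsLeft_lt (Or.inl ?_)⟩
    · intro a i ha hai
      rw [← far a i ha hai]
      by_cases ha' : a ∈ [4, 5, 6]
      · exact gfar a ha ha' i (by have := v.2; omega)
      · rw [gf.2 a (by simp only [List.mem_cons, not_or] at ha' ⊢; tauto)]
    · rw [gf.1 14 (by decide), g17]; exact hb'
    · rw [g15, htail]; simp
    · rw [g7]
      refine hH.append (by simp [htail]) (fun i hi => ?_)
      rw [Function.update_of_ne (by omega)]
    · rw [g15, gf.1 14 (by decide)]; omega
  -- A child of the root receives its own label and any other vertex inherits that of its parent;
  -- the remaining writes are the same in both branches.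
  have hcase : ∀ h6 : State, Fr [16, 18, 19, 22] [6] h h6 → h6.reg 16 = u → h6.reg 18 = v →
      h6.reg 19 = row h 4 s u → h6.reg 22 = G.entry u v →
      (∀ i, i ≠ s * n + v → h6.arr 6 i = h.arr 6 i) →
      h6.arr 6 (s * n + v) = (if u = s then (v : ℕ) + 1 else row h 6 s u) →
      (fun h' => BfsState G L b t s h₀ h' ∧ bfsLeft s h' + 1 ≤ bfsLeft s h)
        ((((((h6.setArr 5 (s * n + v) u).setArr 4 (s * n + v) (row h 4 s u + G.entry u v)).setArr 7
          (h.reg 15) v).setReg 15 (h.reg 15 + 1)).setReg 17 (h.reg 17 + 1))) := by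
    intro h6 f6 a1 a2 a3 a4 a5 a6
    refine hins _ ?_ ?_ ?_ ?_ ?_ ?_ ?_ ?_
    · exact (((((f6.mono (by decide) (by decide)).setArr (by decide)).setArr (by decide)).setArr
        (by decide)).setReg (by decide)).setReg (by decide)
    · intro a ha ha' i hi'
      simp only [List.mem_cons, List.not_mem_nil, or_false] at ha'
      rcases ha' with rfl | rfl | rfl
      · simp [hi', f6.2 4 (by decide)]
      · simp [hi', f6.2 5 (by decide)]
      · simp [a5 i hi']
    · simp
    · simp
    · simp [a6]
    · simp [f6.2 7 (by decide)]
    · simp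
    · simp
  refine ⟨by omega, fun hus => ⟨by omega, by omega, by omega, by omega, by omega, by omega, by omega,
    hcase _ ?_ (by simp) (by simp) (by simp) (by simp) (fun i hi' => by simp [hi']) ?_⟩,
    fun hus => ⟨by omega, by omega, by omega, by omega, by omega, by omega, by omega,
    hcase _ ?_ (by simp) (by simp) (by simp) (by simp) (fun i hi' => by simp [hi']) ?_⟩⟩
  · exact (((((Fr.refl _ _ _).setReg (by decide)).setReg (by decide)).setReg (by decide)).setReg
      (by decide)).setArr (by decide)
  · have hus' : u = s := by simpa [Fin.ext_iff] using hus
    simp [hus']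
  · exact (((((Fr.refl _ _ _).setReg (by decide)).setReg (by decide)).setReg (by decide)).setReg
      (by decide)).setArr (by decide)
  · have hus' : u ≠ s := by simpa [Fin.ext_iff] using hus
    simp [hus']

/-- Breadth first search from the vertex in register `12`. -/
def explore : Prog :=
  .seq (forE 19 (.var 0) (Stmt.put 6 (.var 12 * .var 0 + .var 19) 0).code) <|
  .seq (Stmt.seq (.put 6 (.var 12 * .var 0 + .var 12) (.var 0 + 1)) <|
    .seq (.put 4 (.var 12 * .var 0 + .var 12) 0) <|
    .seq (.put 5 (.var 12 * .var 0 + .var 12) (.var 0)) <|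
    .seq (.put 7 0 (.var 12)) <| .seq (.asg 14 0) <| .seq (.asg 15 1) <| .seq (.asg 17 0)
      (.asg 13 0)).code <|
  whileE (.lt (.var 14) (.var 15)) bfsStep.code

/-- Only the labels need to be cleared beforehand, since distances and parents matter only where the
label is nonzero. The potential starts at no more than `4 * n + 1` and each step has constant cost,
so the number of edges does not enter. -/
theorem run_explore {B : ℕ} (G : WGraph n M) (L : Fin n → List (Fin n)) {b t : ℕ} {s : Fin n}
    (hB : n * n + 4 * (n * M) + 10 * n + 10 * M + 50 < B) (hb : b ≤ 1) (ht : t ≤ n * M + 1)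
    (h : State) (hi : Inp G h) (hL : Lists G L h) (hrb : h.reg 10 = b) (hrt : h.reg 11 = t)
    (hrs : h.reg 12 = s) :
    Run B explore h (1000 * n + 100) (fun h' => ExpTree G b t s h h' ∧
      (h'.reg 13 = 0 ∧ G.Complete b t (row h' 4 s) (row h' 5 s) (row h' 6 s) ∨
        Found G b t s h')) := by
  have hsn := idx_lt s.2 s.2
  have h1 : Run B (forE 19 (.var 0) (Stmt.put 6 (.var 12 * .var 0 + .var 19) 0).code) h
      (n * (30 + 1 + 7) + 1 + 5) (fun g => Fr [19] [6] h g ∧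
      (∀ i, (i < s * n ∨ s * n + n ≤ i) → g.arr 6 i = h.arr 6 i) ∧
      ∀ i < n, g.arr 6 (s * n + i) = 0) := by
    refine Run.forE (N := n) (fun k g => Fr [19] [6] h g ∧
      (∀ i, (i < s * n ∨ s * n + n ≤ i) → g.arr 6 i = h.arr 6 i) ∧
      ∀ i < k, g.arr 6 (s * n + i) = 0) 30 (by norm_num) (by omega) ?_ ?_ ?_ ?_
    · exact ⟨(Fr.refl _ _ _).setReg (by decide), by simp, by simp⟩
    · rintro k g - ⟨hf, -⟩ -
      simp [(hf.1 0 (by decide)).trans hi.reg0]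
    · rintro k g hk ⟨hf, hfar, hz⟩ h19
      refine Run.conseq (Stmt.run _ ?_) (by decide) (fun _ h => h)
      have i1 := idx_lt s.2 hk
      simp only [Stmt.wp, Expr.ok_add, Expr.ok_mul, Expr.ok_var, Expr.eval_mul, Nat.reduceLeDiff,
        true_and, Expr.eval_var, Expr.eval_add, (hf.1 0 (by decide)).trans hi.reg0,
        (hf.1 12 (by decide)).trans hrs, h19, Expr.ok_ofNat, Expr.eval_ofNat]
      refine ⟨by omega, by omega, by simpa using h19, (hf.setArr (by decide)).setReg (by decide),
        ?_, ?_⟩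
      · intro i hi'
        have : i ≠ s * n + k := by omega
        simp [this, hfar i hi']
      · intro i hi'
        by_cases hik : i = k
        · simp [hik]
        · have := hz i (by omega)
          simp [hik, this]
    · rintro g hg -
      exact hg
  refine (h1.seq (T₂ := 900 * n + 90) (fun g1 ⟨f1, far1, z1⟩ => ?_)).conseq (by omega)
    (fun _ h => h)
  have h2 : Run B (Stmt.seq (.put 6 (.var 12 * .var 0 + .var 12) (.var 0 + 1)) <|
    .seq (.put 4 (.var 12 * .var 0 + .var 12) 0) <|
    .seq (.put 5 (.var 12 * .var 0 + .var 12) (.var 0)) <|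
    .seq (.put 7 0 (.var 12)) <| .seq (.asg 14 0) <| .seq (.asg 15 1) <| .seq (.asg 17 0)
      (.asg 13 0)).code g1 60 (fun g => BfsState G L b t s h g ∧ g.reg 14 = 0 ∧ g.reg 15 = 1) := by
    refine Run.conseq (Stmt.run _ ?_) (by decide) (fun _ h => h)
    simp only [Stmt.wp, Expr.ok_add, Expr.ok_mul, Expr.ok_var, Expr.eval_mul, Nat.reduceLeDiff,
      true_and, Expr.eval_var, Expr.eval_add, (f1.1 0 (by decide)).trans hi.reg0,
      (f1.1 12 (by decide)).trans hrs, Expr.ok_ofNat, Expr.eval_ofNat, State.setArr_reg]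
    refine ⟨by omega, by omega, by omega, by omega, by omega, by omega, by omega, by omega,
      by omega, by omega, ?_⟩
    set g := ((((((((g1.setArr 6 (↑s * n + ↑s) (n + 1)).setArr 4 (↑s * n + ↑s) 0).setArr 5
      (↑s * n + ↑s) n).setArr 7 0 ↑s).setReg 14 0).setReg 15 1).setReg 17 0).setReg 13 0) with hg
    have hinit : Bfs G L b t s (row g 4 s) (row g 5 s) (row g 6 s) [s] 0 0 := by
      refine Bfs.init _ _ _ (fun x => ?_) ?_ ?_
      · by_cases hx : x = s
        · simp [row, hg, hx]
        · have := z1 x x.2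
          simp [row, hg, hx, Fin.val_inj, this]
      · simp [row, hg]
      · simp [row, hg]
    refine ⟨⟨⟨?_, ?_, hinit.tree⟩, Or.inl ⟨by simp [hg], [s], by simpa [hg] using hinit,
      by simp [hg], ?_⟩⟩, by simp [hg], by simp [hg]⟩
    · refine f1.trans (R' := [14, 15, 17, 13]) (A' := [6, 4, 5, 7]) ?_ (by decide) (by decide)
        (by decide) (by decide)
      exact ((((((((Fr.refl _ _ _).setArr (by decide)).setArr (by decide)).setArr
        (by decide)).setArr (by decide)).setReg (by decide)).setReg (by decide)).setReg
        (by decide)).setReg (by decide)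
    · intro a i ha hi'
      have hne : i ≠ s * n + s := by have := s.2; omega
      by_cases h6 : a = 6
      · subst h6; simp [hg, hne, far1 i hi']
      · rw [← f1.2 a (by simpa using h6)]
        by_cases h4 : a = 4
        · subst h4; simp [hg, hne]
        · by_cases h5 : a = 5
          · subst h5; simp [hg, hne]
          · simp [hg, ha, h6, h4, h5]
    · intro i x hx
      rcases i with _ | i
      · simp at hx; simp [hg, hx]
      · simp at hx
  refine (h2.seq (T₂ := 900 * n + 30) (fun g2 ⟨b2, c2, d2⟩ => ?_)).conseq (by omega)
    (fun _ h => h)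
  have hcost : bfsStep.cost ≤ 120 := by decide
  refine (Run.whileE (BfsState G L b t s h) (fun g => bfsLeft s g * 150) 120 b2 ?_ ?_ ?_).conseq
    ?_ (fun _ h => h)
  · intro g hg; simp; omega
  · intro g hg hc
    have hc' : g.reg 14 < g.reg 15 := by by_contra h'; simp [h'] at hc
    refine (run_bfsStep G L hB hb ht h g hi hL hrb hrt hrs hg hc').conseq hcost ?_
    rintro g' ⟨hg', hlt⟩
    refine ⟨hg', ?_⟩
    have := Nat.mul_le_mul_right 150 hlt
    have : (Expr.lt (.var 14) (.var 15)).cost = 3 := rfl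
    omega
  · rintro g ⟨hE, ⟨hfl, Q, hQ, hlen, hH⟩ | ⟨-, hfound⟩⟩ hc
    · refine ⟨hE, Or.inl ⟨hfl, ?_⟩⟩
      have hc' : g.reg 15 ≤ g.reg 14 := by by_contra! h'; simp [h'] at hc
      have := hQ.head_le
      have heq : g.reg 14 = Q.length := by omega
      rw [heq] at hQ
      exact hQ.complete
    · exact ⟨hE, Or.inr hfound⟩
  · have hle : bfsLeft s g2 ≤ 4 * n + 1 := by
      unfold bfsLeft; split_ifs <;> omega
    have hn := s.pos
    have : (Expr.lt (.var 14) (.var 15)).cost = 3 := rfl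
    have := Nat.mul_le_mul_right 150 hle
    omega

end WordRAM


/-! ### What good and bad thresholds say about cycles -/

namespace WGraph

variable {n M : ℕ}

/-- Exploration from every vertex finds no closing edge. -/
def Good (G : WGraph n M) (b t : ℕ) : Prop :=
  ∀ s : Fin n, ∃ D P F, G.PTree b t s D P F ∧ G.Complete b t D P F

/-- Exploration from some vertex finds a closing edge. -/
def Bad (G : WGraph n M) (b t : ℕ) : Prop :=
  ∃ s D P F u v, G.PTree b t s D P F ∧ G.Closing b t D P F u v

variable {G : WGraph n M}

theorem lt_of_good {t : ℕ} (h : G.Good 1 t) {v : Fin n} (c : G.graph.Walk v v) (hc : c.IsCycle) :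
    t < G.walkWeight c := by
  obtain ⟨c', hcyc, hw⟩ := exists_cyc c hc
  obtain ⟨D, P, F, T, hC⟩ := h (c' 0)
  exact hw ▸ hcyc.lt_of_complete T hC

/-- The case `t = 0` is the untested left end of the binary search; there it suffices that cycles
have positive weight. -/
theorem two_mul_lt_of_good {t : ℕ} (h : t = 0 ∨ G.Good 0 t) {v : Fin n} (c : G.graph.Walk v v)
    (hc : c.IsCycle) : 2 * t < G.walkWeight c := by
  rcases h with rfl | h
  · have := G.length_le_walkWeight c
    have := hc.three_le_length
    omega
  · obtain ⟨l, c', hcyc, hw⟩ : ∃ l c', G.Cyc l c' ∧ G.arc c' l = G.walkWeight c := by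
      obtain ⟨c', h1, h2⟩ := exists_cyc c hc
      exact ⟨_, c', h1, h2⟩
    obtain ⟨D, P, F, T, hC⟩ := h (c' 0)
    exact hw ▸ hcyc.two_mul_lt_of_complete T hC

theorem walkWeight_le_of_isCycle (G : WGraph n M) {v : Fin n} (c : G.graph.Walk v v)
    (hc : c.IsCycle) : G.walkWeight c ≤ n * M := by
  have h1 := G.walkWeight_le c
  have h2 : c.length ≤ n := by
    have := (hc.support_nodup).length_le_card
    simpa using this
  calc _ ≤ _ := h1
    _ ≤ M * n := Nat.mul_le_mul_left _ h2
    _ = _ := mul_comm _ _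

/-- For a closing edge `uv` both `D u + w(uv)` and `D v` are at most `t`. -/
theorem Bad.exists_cycle_one {t : ℕ} (h : G.Bad 1 t) :
    ∃ (v : Fin n) (c : G.graph.Walk v v), c.IsCycle ∧ G.walkWeight c ≤ 2 * t := by
  obtain ⟨s, D, P, F, u, v, T, hC⟩ := h
  obtain ⟨-, -, c, -, -, hc, hw, -⟩ := T.exists_cycle hC.left hC.right hC.adj hC.ne hC.ne'
  refine ⟨v, c, hc, hw.trans ?_⟩
  have h1 := hC.le
  have h2 : D v ≤ t := by
    by_cases hvs : v = s
    · rw [hvs, T.D_root]; omega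
    · obtain ⟨x, -, -, -, hD, hle, -⟩ := T.step v hC.right hvs
      omega
  omega

/-- Now only `D u ≤ t` is certain; the last edge towards `v` and the closing edge may each add up to
`M`. -/
theorem Bad.exists_cycle_zero {t : ℕ} (h : G.Bad 0 t) :
    ∃ (v : Fin n) (c : G.graph.Walk v v), c.IsCycle ∧ G.walkWeight c ≤ 2 * t + 2 * M := by
  obtain ⟨s, D, P, F, u, v, T, hC⟩ := h
  obtain ⟨-, -, c, -, -, hc, hw, -⟩ := T.exists_cycle hC.left hC.right hC.adj hC.ne hC.ne'
  refine ⟨v, c, hc, hw.trans ?_⟩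
  have h1 := hC.le
  have := T.D_le v hC.right
  have := G.entry_le u v
  omega

/-- At `t = 0` with `b = 1` no edge may be explored at all, because weights are positive. -/
theorem PTree.not_closing_of_good {t : ℕ} (h : t = 0 ∨ G.Good 1 t) {s : Fin n} {D P F : ℕ → ℕ}
    (T : G.PTree 1 t s D P F) {u v : Fin n} : ¬ G.Closing 1 t D P F u v := by
  rcases h with rfl | h
  · intro hC
    have := hC.le
    have := entry_pos hC.adj
    omega
  · obtain ⟨D', P', F', T', hC⟩ := h s
    exact T.not_closing T' hC

end WGraph

/-! ### Testing a threshold and binary search -/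

namespace WordRAM

open WGraph

variable {n M : ℕ}

/-- All rows are filled with complete exploration trees. -/
def Rows (G : WGraph n M) (b t : ℕ) (h : State) : Prop :=
  ∀ s : Fin n, G.PTree b t s (row h 4 s) (row h 5 s) (row h 6 s) ∧
    G.Complete b t (row h 4 s) (row h 5 s) (row h 6 s)

theorem Rows.good {G : WGraph n M} {b t : ℕ} {h : State} (hr : Rows G b t h) : G.Good b t :=
  fun s => ⟨_, _, _, hr s⟩

/-- Exploration from the vertex in register `12` stopped with a closing edge. -/
def Stopped (G : WGraph n M) (b t : ℕ) (h : State) : Prop :=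
  ∃ s : Fin n, h.reg 12 = s ∧ G.PTree b t s (row h 4 s) (row h 5 s) (row h 6 s) ∧ Found G b t s h

theorem Stopped.bad {G : WGraph n M} {b t : ℕ} {h : State} (hs : Stopped G b t h) : G.Bad b t := by
  obtain ⟨s, -, T, -, u, v, -, -, hC⟩ := hs
  exact ⟨s, _, _, _, u, v, T, hC⟩

/-- Explore from all vertices, but stop at the first closing edge. -/
def test : Prog :=
  .seq (Stmt.seq (.asg 12 0) (.asg 13 0)).code <|
  whileE (.lt (.var 12 + .var 13 * .var 0) (.var 0))
    (.seq explore (Stmt.asg 12 (.var 12 + (1 - .var 13))).code)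

/-- The loop condition is `s + flag * n < n`, and `s` advances by `1 - flag`. So a raised flag ends
the loop and leaves register `12` at the root whose tree contains the closing edge. Trees of earlier
roots survive because each exploration writes only its own rows. -/
theorem run_test {B : ℕ} (G : WGraph n M) (L : Fin n → List (Fin n)) {b t : ℕ}
    (hB : n * n + 4 * (n * M) + 10 * n + 10 * M + 50 < B) (hb : b ≤ 1) (ht : t ≤ n * M + 1)
    (h : State) (hi : Inp G h) (hL : Lists G L h) (hrb : h.reg 10 = b) (hrt : h.reg 11 = t) :
    Run B test h (n * (1000 * n + 130) + 50) (fun h' =>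
      Fr [12, 13, 14, 15, 16, 17, 18, 19, 20, 21, 22] [4, 5, 6, 7] h h' ∧
      ((h'.reg 13 = 0 ∧ Rows G b t h') ∨ (h'.reg 13 = 1 ∧ Stopped G b t h'))) := by
  let I : State → Prop := fun g => Fr [12, 13, 14, 15, 16, 17, 18, 19, 20, 21, 22] [4, 5, 6, 7] h g ∧
    ((g.reg 13 = 0 ∧ g.reg 12 ≤ n ∧ ∀ s : Fin n, (s : ℕ) < g.reg 12 →
      G.PTree b t s (row g 4 s) (row g 5 s) (row g 6 s) ∧
      G.Complete b t (row g 4 s) (row g 5 s) (row g 6 s)) ∨ (g.reg 13 = 1 ∧ Stopped G b t g))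
  have e0 : ∀ g, I g → g.reg 0 = n := fun g hg => (hg.1.1 0 (by decide)).trans hi.reg0
  have h1 : Run B (Stmt.seq (.asg 12 0) (.asg 13 0)).code h 10
      (fun g => I g ∧ g.reg 12 = 0 ∧ g.reg 13 = 0) := by
    refine Run.conseq (Stmt.run _ ?_) (by decide) (fun _ h => h)
    simp only [Stmt.wp, Expr.ok_ofNat, Expr.eval_ofNat]
    refine ⟨by omega, by omega, ⟨((Fr.refl _ _ _).setReg (by decide)).setReg (by decide),
      Or.inl ⟨by simp, by simp, fun s hs => by simp at hs⟩⟩, by simp, by simp⟩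
  refine (h1.seq (T₂ := n * (1000 * n + 130) + 40) (fun g1 ⟨i1, r12, r13⟩ => ?_)).conseq
    (by omega) (fun _ h => h)
  refine (Run.whileE I (fun g => (n - (g.reg 12 + g.reg 13 * n)) * (1000 * n + 130))
    (1000 * n + 110) i1 ?_ ?_ ?_).conseq ?_ (fun _ h => h)
  · intro g hg
    have : g.reg 12 + g.reg 13 * n < 2 * n + 1 := by
      rcases hg.2 with ⟨h3, h2, -⟩ | ⟨h3, s, h2, -⟩
      · rw [h3]; omega
      · rw [h3, h2]; omega
    have := Nat.le_add_left (g.reg 13 * n) (g.reg 12)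
    simp only [Expr.ok_lt, Expr.ok_add, Expr.ok_mul, Expr.ok_var, Expr.eval_var, Expr.eval_mul,
      e0 g hg, Nat.reduceLeDiff, true_and]
    omega
  · intro g hg hc
    rcases hg.2 with ⟨h3, h2, hrows⟩ | ⟨h3, s, h2, -⟩
    swap
    · exfalso; apply hc
      simp [e0 g hg, h3]
    have hlt : g.reg 12 < n := by
      by_contra h'
      apply hc
      simp [e0 g hg, h3]; omega
    obtain ⟨s, hs⟩ : ∃ s : Fin n, g.reg 12 = s := ⟨⟨_, hlt⟩, rfl⟩
    have hex := run_explore G L (s := s) hB hb ht g (hi.frame hg.1 (by decide) (by decide) (by decide))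
      (hL.frame hg.1 (by decide) (by decide)) ((hg.1.1 10 (by decide)).trans hrb)
      ((hg.1.1 11 (by decide)).trans hrt) hs
    refine (hex.seq (T₂ := 10) (fun g2 ⟨E, hres⟩ => ?_)).conseq (by omega) (fun _ h => h)
    have hf2 : Fr [12, 13, 14, 15, 16, 17, 18, 19, 20, 21, 22] [4, 5, 6, 7] h g2 :=
      hg.1.trans E.fr (by decide) (by decide) (by decide) (by decide)
    have r2 : g2.reg 12 = s := (E.fr.1 12 (by decide)).trans hs
    refine Run.conseq (Stmt.run _ ?_) (by decide) (fun _ h => h)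
    have hcost : (Expr.lt (.var 12 + .var 13 * .var 0) (.var 0)).cost = 7 := rfl
    have hsn := s.2
    simp only [Stmt.wp, Expr.ok_add, Expr.ok_sub, Expr.ok_var, Expr.ok_ofNat, Expr.eval_add,
      Expr.eval_sub, Expr.eval_var, Expr.eval_ofNat, r2, Nat.reduceLeDiff, true_and,
      State.setReg_reg, reduceIte, Nat.reduceEqDiff, hcost, h3, hs]
    rcases hres with ⟨f0, hC⟩ | hF
    · simp only [f0]
      refine ⟨⟨⟨by omega, trivial⟩, by omega⟩, ⟨hf2.setReg (by decide), Or.inl ⟨by simp [f0], by simp only [State.setReg_reg, reduceIte]; omega, ?_⟩⟩, ?_⟩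
      · intro x hx
        simp only [State.setReg_reg, reduceIte] at hx
        by_cases hxs : x = s
        · subst hxs
          exact ⟨E.tree, hC⟩
        · have hne : (x : ℕ) ≠ s := fun h' => hxs (Fin.ext h')
          obtain ⟨T1, C1⟩ := hrows x (by omega)
          have hsame : ∀ a, a ≠ 7 → ∀ v : Fin n, row (g2.setReg 12 (s + (1 - 0))) a x v =
              row g a x v := by
            intro a ha v
            refine E.far a _ ha ?_
            have hv := v.2
            rcases lt_or_gt_of_ne hne with h' | h'
            · left
              have := Nat.mul_le_mul_right n (Nat.succ_le_of_lt h')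
              rw [Nat.succ_mul] at this; omega
            · right
              have := Nat.mul_le_mul_right n (Nat.succ_le_of_lt h')
              rw [Nat.succ_mul] at this; omega
          refine ⟨T1.congr (hsame 4 (by decide)) (hsame 5 (by decide)) (hsame 6 (by decide)), ?_⟩
          intro u v hu ha hle
          rw [hsame 6 (by decide)] at hu ⊢
          rw [hsame 4 (by decide)] at hle
          rw [hsame 5 (by decide), hsame 5 (by decide)]
          exact C1 u v hu ha hle
      · obtain ⟨m, hm⟩ := Nat.exists_eq_add_of_lt hsn
        rw [show n - (s + (1 - 0) + 0 * n) = m by omega, show n - (s + 0 * n) = m + 1 by omega,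
          Nat.succ_mul m]
        generalize m * (1000 * n + 130) = X
        omega
    · have f1 := hF.1
      simp only [f1]
      refine ⟨⟨⟨?_, trivial⟩, ?_⟩, ⟨hf2.setReg (by decide), Or.inr ⟨by simp [f1], s, by simp, E.tree, ?_⟩⟩, ?_⟩
      · omega
      · omega
      · obtain ⟨-, u, v, hu, hv, hC⟩ := hF
        exact ⟨by simp [f1], u, v, by simpa using hu, by simpa using hv, hC⟩
      · obtain ⟨m, hm⟩ := Nat.exists_eq_add_of_lt hsn
        rw [show n - (s + (1 - 1) + 1 * n) = 0 by omega, show n - (s + 0 * n) = m + 1 by omega,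
          Nat.succ_mul m]
        generalize m * (1000 * n + 130) = X
        omega
  · rintro g hg hc
    refine ⟨hg.1, hg.2.imp_left fun ⟨h3, h2, hrows⟩ => ⟨h3, fun s => hrows s ?_⟩⟩
    have hlt : n ≤ g.reg 12 := by
      by_contra h'
      have : g.reg 12 < n := by omega
      simp [e0 g hg, h3, this] at hc
    exact s.2.trans_le hlt
  · rw [r12, r13]
    have hcost : (Expr.lt (.var 12 + .var 13 * .var 0) (.var 0)).cost = 7 := rfl
    rw [hcost]; simp

/-- Binary search for the first parameter for which a closing edge is found. -/
def search : Prog :=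
  .seq (Stmt.seq (.asg 30 0) (.asg 31 (.var 0 * .var 1 + 1))).code <|
  whileE (.lt (.var 30 + 1) (.var 31))
    (.seq (Stmt.asg 11 ((.var 30 + .var 31) / 2)).code <| .seq test
      (Stmt.ite (.var 13) (.asg 31 (.var 11)) (.asg 30 (.var 11))).code)

/-- No monotonicity in the threshold is used: the left end is known to be good, or is `0`, and the
right end is known to be bad, or is the initial `n * M + 1`. -/
theorem run_search {B : ℕ} (G : WGraph n M) (L : Fin n → List (Fin n)) {b : ℕ}
    (hB : n * n + 4 * (n * M) + 10 * n + 10 * M + 50 < B) (hb : b ≤ 1)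
    (h : State) (hi : Inp G h) (hL : Lists G L h) (hrb : h.reg 10 = b) :
    Run B search h (Nat.clog 2 (n * M + 1) * (n * (1000 * n + 130) + 100) + 50) (fun h' =>
      Fr [11, 12, 13, 14, 15, 16, 17, 18, 19, 20, 21, 22, 30, 31] [4, 5, 6, 7] h h' ∧
      h'.reg 30 ≤ n * M ∧ (h'.reg 30 = 0 ∨ G.Good b (h'.reg 30)) ∧
      (h'.reg 30 = n * M ∨ G.Bad b (h'.reg 30 + 1))) := by
  let R : List ℕ := [11, 12, 13, 14, 15, 16, 17, 18, 19, 20, 21, 22, 30, 31]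
  let I : State → Prop := fun g => Fr R [4, 5, 6, 7] h g ∧
    g.reg 30 < g.reg 31 ∧ g.reg 31 ≤ n * M + 1 ∧ (g.reg 30 = 0 ∨ G.Good b (g.reg 30)) ∧
    (g.reg 31 = n * M + 1 ∨ G.Bad b (g.reg 31))
  have h1 : Run B (Stmt.seq (.asg 30 0) (.asg 31 (.var 0 * .var 1 + 1))).code h 20
      (fun g => I g ∧ g.reg 30 = 0 ∧ g.reg 31 = n * M + 1) := by
    refine Run.conseq (Stmt.run _ ?_) (by decide) (fun _ h => h)
    simp only [Stmt.wp, Expr.ok_ofNat, Expr.eval_ofNat, Expr.ok_add, Expr.ok_mul, Expr.ok_var,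
      Expr.eval_mul, Expr.eval_var, Expr.eval_add, State.setReg_reg, reduceIte, Nat.reduceEqDiff,
      hi.reg0, hi.reg1, Nat.reduceLeDiff, true_and]
    refine ⟨by omega, by omega, ⟨((Fr.refl _ _ _).setReg (by decide)).setReg (by decide), by simp,
      by simp, by simp, by simp⟩, trivial⟩
  refine (h1.seq (T₂ := Nat.clog 2 (n * M + 1) * (n * (1000 * n + 130) + 100) + 20)
    (fun g1 ⟨i1, r30, r31⟩ => ?_)).conseq (by omega) (fun _ h => h)
  refine (Run.whileE I (fun g => Nat.clog 2 (g.reg 31 - g.reg 30) * (n * (1000 * n + 130) + 100))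
    (n * (1000 * n + 130) + 80) i1 ?_ ?_ ?_).conseq ?_ (fun _ h => h)
  · intro g hg
    obtain ⟨-, a1, a2, -⟩ := hg
    simp only [Expr.ok_lt, Expr.ok_add, Expr.ok_ofNat, Expr.ok_var, Expr.eval_var, Expr.eval_ofNat,
      Nat.reduceLeDiff, true_and]
    omega
  · intro g ⟨hf, a1, a2, a3, a4⟩ hc
    have hlt : g.reg 30 + 1 < g.reg 31 := by
      by_contra h'
      apply hc
      simp [h']
    have hmid : Run B (Stmt.asg 11 ((.var 30 + .var 31) / 2)).code g 10
        (fun g' => Fr [11] [] g g' ∧ g'.reg 11 = (g.reg 30 + g.reg 31) / 2) := by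
      refine Run.conseq (Stmt.run _ ?_) (by decide) (fun _ h => h)
      simp only [Stmt.wp, Expr.ok_ofNat, Expr.eval_ofNat, Expr.ok_add, Expr.ok_div, Expr.ok_var,
        Expr.eval_div, Expr.eval_var, Expr.eval_add, Nat.reduceLeDiff, true_and]
      exact ⟨by omega, (Fr.refl _ _ _).setReg (by decide), by simp⟩
    refine (hmid.seq (T₂ := n * (1000 * n + 130) + 60) (fun g2 ⟨f2, m2⟩ => ?_)).conseq (by omega)
      (fun _ h => h)
    have hf2 : Fr R [4, 5, 6, 7] h g2 :=
      hf.trans f2 (by decide) (by decide) (by decide) (by decide)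
    set m := (g.reg 30 + g.reg 31) / 2 with hm
    refine ((run_test G L hB hb (t := m) (by omega) g2
      (hi.frame hf2 (by decide) (by decide) (by decide))
      (hL.frame hf2 (by decide) (by decide)) ((hf2.1 10 (by decide)).trans hrb) m2).seq
      (T₂ := 10) (fun g3 ⟨f3, hres⟩ => ?_)).conseq (by omega) (fun _ h => h)
    have hf3 : Fr R [4, 5, 6, 7] h g3 :=
      hf2.trans f3 (by decide) (by decide) (by decide) (by decide)
    have b30 : g3.reg 30 = g.reg 30 := (f3.1 30 (by decide)).trans (f2.1 30 (by decide))
    have b31 : g3.reg 31 = g.reg 31 := (f3.1 31 (by decide)).trans (f2.1 31 (by decide))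
    have b11 : g3.reg 11 = m := (f3.1 11 (by decide)).trans m2
    -- Both halves of an interval of length `d` have length at most `(d + 1) / 2`, which lowers
    -- `Nat.clog` by one.
    have hclog : Nat.clog 2 (g.reg 31 - g.reg 30) =
        Nat.clog 2 ((g.reg 31 - g.reg 30 + 1) / 2) + 1 :=
      Nat.clog_of_two_le (by norm_num) (by omega)
    have hdec : ∀ d, d ≤ (g.reg 31 - g.reg 30 + 1) / 2 →
        Nat.clog 2 d * (n * (1000 * n + 130) + 100) +
          (n * (1000 * n + 130) + 80 + (Expr.lt (.var 30 + 1) (.var 31)).cost + 1) ≤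
        Nat.clog 2 (g.reg 31 - g.reg 30) * (n * (1000 * n + 130) + 100) := by
      intro d hd
      have h5 := Nat.mul_le_mul_right (n * (1000 * n + 130) + 100) (Nat.clog_mono_right 2 hd)
      have hcost : (Expr.lt (.var 30 + 1) (.var 31)).cost = 5 := rfl
      rw [hclog, Nat.succ_mul (Nat.clog 2 _), hcost]
      generalize n * (1000 * n + 130) = X at *
      omega
    refine Run.conseq (Stmt.run _ ?_) (by decide) (fun _ h => h)
    simp only [Stmt.wp, Expr.ok_var, Expr.eval_var, Nat.reduceLeDiff, true_and, b11]
    refine ⟨fun hne => ?_, fun hz => ?_⟩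
    · rcases hres with ⟨h13, -⟩ | ⟨-, hst⟩
      · exact absurd h13 hne
      refine ⟨⟨hf3.setReg (by decide), ?_, ?_, ?_, ?_⟩, ?_⟩
      · simp [b30]; omega
      · simp; omega
      · simpa [b30] using a3
      · right; simpa using hst.bad
      · simp only [State.setReg_reg, reduceIte, Nat.reduceEqDiff, b30]
        exact hdec _ (by omega)
    · rcases hres with ⟨-, hrows⟩ | ⟨h13, -⟩
      swap
      · omega
      refine ⟨⟨hf3.setReg (by decide), ?_, ?_, ?_, ?_⟩, ?_⟩
      · simp [b31]; omega
      · simp [b31]; omega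
      · right; simpa using hrows.good
      · simpa [b31] using a4
      · simp only [State.setReg_reg, reduceIte, Nat.reduceEqDiff, b31]
        exact hdec _ (by omega)
  · rintro g ⟨hf, a1, a2, a3, a4⟩ hc
    have hle : g.reg 31 = g.reg 30 + 1 := by
      by_contra h'
      have : g.reg 30 + 1 < g.reg 31 := by omega
      simp [this] at hc
    rw [hle] at a4 a2
    exact ⟨hf, by omega, a3, a4.imp_left (by omega)⟩
  · rw [r30, r31]
    have : (Expr.lt (.var 30 + 1) (.var 31)).cost = 5 := rfl
    rw [this]; simp only [Nat.sub_zero]; omega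

end WordRAM


/-! ### Triangles as triples of vertices -/

namespace WGraph

variable {n M : ℕ}

/-- The closed walk for the triple `a, b, c` starts in `c`, so that the tail of its support reads
`a, b, c`. -/
theorem minTriangleOutput_cases {G : WGraph n M} {out : List ℕ} (h : MinTriangleOutput G out) :
    (out = [] ∧ ∀ a b c, G.graph.Adj a b → G.graph.Adj b c → ¬ G.graph.Adj c a) ∨
    ∃ a b c : Fin n, out = [(a : ℕ), (b : ℕ), (c : ℕ)] ∧ G.graph.Adj a b ∧ G.graph.Adj b c ∧ G.graph.Adj c a ∧
      ∀ a' b' c', G.graph.Adj a' b' → G.graph.Adj b' c' → G.graph.Adj c' a' →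
        G.entry a b + G.entry b c + G.entry c a ≤ G.entry a' b' + G.entry b' c' + G.entry c' a' := by
  have key : ∀ a b c (hab : G.graph.Adj a b) (hbc : G.graph.Adj b c) (hca : G.graph.Adj c a),
      (SimpleGraph.Walk.cons hca (.cons hab (.cons hbc .nil))).IsCycle ∧
      G.walkWeight (.cons hca (.cons hab (.cons hbc .nil))) =
        G.entry a b + G.entry b c + G.entry c a := by
    intro a b c hab hbc hca
    constructor
    · rw [SimpleGraph.Walk.cons_isCycle_iff]
      have h1 := hab.ne; have h2 := hbc.ne; have h3 := hca.ne
      simp [SimpleGraph.Walk.cons_isPath_iff, h1, h2, h3, h2.symm, h3.symm]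
    · simp only [walkWeight_cons, walkWeight_nil, weight_eq_entry, hab, hbc, hca]; omega
  rcases h with ⟨h1, h2⟩ | ⟨v, c, ⟨⟨hc, hl⟩, hmin⟩, rfl⟩
  · left
    refine ⟨h1, fun a b c hab hbc hca => ?_⟩
    exact h2 _ _ (key a b c hab hbc hca).1 rfl
  · right
    match c, hl with
    | .cons (v := a) hca (.cons (v := b) hab (.cons hbc .nil)), _ =>
      refine ⟨a, b, v, by simp, hab, hbc, hca, fun a' b' c' h1 h2 h3 => ?_⟩
      rw [← (key a b v hab hbc hca).2, ← (key a' b' c' h1 h2 h3).2]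
      exact hmin _ _ (key a' b' c' h1 h2 h3).1 rfl

/-! ### Tripartite graphs -/

/-- The entry of a weighted adjacency matrix of a tripartite graph with parts of size `n`, where the
weights between the parts are given by `X`, `Y` and `Z`. -/
def triEntry (n : ℕ) (X Y Z : ℕ → ℕ → ℕ) (p q : ℕ) : ℕ :=
  if min p q / n < max p q / n then
    (if min p q / n = 0 then (if max p q / n = 1 then X else Y) else Z) (min p q % n) (max p q % n)
  else 0

theorem triEntry_comm (X Y Z : ℕ → ℕ → ℕ) (p q : ℕ) :
    triEntry n X Y Z p q = triEntry n X Y Z q p := by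
  unfold triEntry; rw [min_comm, max_comm]

theorem triEntry_le {X Y Z : ℕ → ℕ → ℕ} {K : ℕ} (hX : ∀ i j, X i j ≤ K) (hY : ∀ i j, Y i j ≤ K)
    (hZ : ∀ i j, i < n → j < n → Z i j ≤ K) (hn : 0 < n) (p q : ℕ) : triEntry n X Y Z p q ≤ K := by
  unfold triEntry
  split_ifs
  exacts [hX _ _, hY _ _, hZ _ _ (Nat.mod_lt _ hn) (Nat.mod_lt _ hn), Nat.zero_le _]

theorem triEntry_same (X Y Z : ℕ → ℕ → ℕ) (k : ℕ) (i j : Fin n) :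
    triEntry n X Y Z (k * n + i) (k * n + j) = 0 := by
  have hn := i.pos
  have key : ∀ i : Fin n, (k * n + i) / n = k := fun i => by
    rw [mul_comm, Nat.mul_add_div hn, Nat.div_eq_of_lt i.2, add_zero]
  unfold triEntry
  rw [if_neg]
  rcases le_total (k * n + i) (k * n + j : ℕ) with h | h
  · rw [min_eq_left h, max_eq_right h, key, key]; simp
  · rw [min_eq_right h, max_eq_left h, key, key]; simp

theorem triEntry_lt (X Y Z : ℕ → ℕ → ℕ) {k l : ℕ} (hkl : k < l) (i j : Fin n) :
    triEntry n X Y Z (k * n + i) (l * n + j) =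
      (if k = 0 then (if l = 1 then X else Y) else Z) i j := by
  have hn := i.pos
  have key : ∀ (k : ℕ) (i : Fin n), (k * n + i) / n = k ∧ (k * n + i) % n = i := fun k i => by
    constructor
    · rw [mul_comm, Nat.mul_add_div hn, Nat.div_eq_of_lt i.2, add_zero]
    · rw [mul_comm, Nat.mul_add_mod, Nat.mod_eq_of_lt i.2]
  have h : (k * n + i) ≤ (l * n + j : ℕ) := by
    have := Nat.mul_le_mul_right n (Nat.succ_le_of_lt hkl)
    rw [Nat.succ_mul] at this; have := i.2; omega
  unfold triEntry
  rw [min_eq_left h, max_eq_right h, (key k i).1, (key l j).1, (key k i).2, (key l j).2, if_pos hkl]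

/-- The tripartite graph with the given weights. -/
def tripartite {K : ℕ} (X Y Z : ℕ → ℕ → ℕ) (hK : ∀ p q, triEntry n X Y Z p q ≤ K) :
    WGraph (3 * n) K where
  graph := 
    { Adj := fun p q => triEntry n X Y Z p q ≠ 0
      symm := ⟨fun p q h => by rwa [triEntry_comm]⟩
      loopless := ⟨fun p h => h (by simp [triEntry])⟩ }
  weight := Sym2.lift ⟨fun p q => triEntry n X Y Z p q, fun p q => triEntry_comm _ _ _ _ _⟩
  weight_mem := by
    intro e
    induction e with
    | _ p q => exact fun h => ⟨Nat.pos_of_ne_zero h, hK _ _⟩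

theorem tripartite_entry {K : ℕ} (X Y Z : ℕ → ℕ → ℕ) (hK : ∀ p q, triEntry n X Y Z p q ≤ K)
    (p q : Fin (3 * n)) : (tripartite X Y Z hK).entry p q = triEntry n X Y Z p q := by
  unfold entry
  split_ifs with h
  · rfl
  · exact (not_not.1 h).symm

theorem tripartite_adj {K : ℕ} (X Y Z : ℕ → ℕ → ℕ) (hK : ∀ p q, triEntry n X Y Z p q ≤ K)
    (p q : Fin (3 * n)) : (tripartite X Y Z hK).graph.Adj p q ↔ triEntry n X Y Z p q ≠ 0 := Iff.rfl

/-- Sorting the vertices of a triangle by parts. -/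
def decode (n a b c : ℕ) (f : ℕ → ℕ) : ℕ → ℕ :=
  Function.update (Function.update (Function.update f (a / n) (a % n)) (b / n) (b % n)) (c / n) (c % n)

/-- Entries within a part are zero, so the corners lie in three different parts, in one of six
orders. Writing the index of each corner at the position of its part sorts them without case
distinctions in the program. -/
theorem tri_decode (X Y Z : ℕ → ℕ → ℕ) {a b c : ℕ} (ha : a < 3 * n) (hb : b < 3 * n)
    (hc : c < 3 * n) (hab : triEntry n X Y Z a b ≠ 0) (hbc : triEntry n X Y Z b c ≠ 0)
    (hca : triEntry n X Y Z c a ≠ 0) (f : ℕ → ℕ) :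
    ∃ s x y : Fin n, X s x ≠ 0 ∧ Y s y ≠ 0 ∧ Z x y ≠ 0 ∧
      triEntry n X Y Z a b + triEntry n X Y Z b c + triEntry n X Y Z c a =
        X s x + Y s y + Z x y ∧ decode n a b c f 0 = s ∧ decode n a b c f 1 = x ∧
        decode n a b c f 2 = y := by
  have hn : 0 < n := by omega
  have key : ∀ (k : ℕ) (i : Fin n), (k * n + i) / n = k ∧ (k * n + i) % n = i := fun k i => by
    constructor
    · rw [mul_comm, Nat.mul_add_div hn, Nat.div_eq_of_lt i.2, add_zero]
    · rw [mul_comm, Nat.mul_add_mod, Nat.mod_eq_of_lt i.2]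
  have ex : ∀ a, a < 3 * n → ∃ k, ∃ i : Fin n, a = k * n + i ∧ k < 3 := fun a ha =>
    ⟨a / n, ⟨a % n, Nat.mod_lt _ hn⟩, by rw [mul_comm]; exact (Nat.div_add_mod a n).symm,
      by rwa [Nat.div_lt_iff_lt_mul hn]⟩
  obtain ⟨k, i, rfl, hk⟩ := ex a ha
  obtain ⟨l, j, rfl, hl⟩ := ex b hb
  obtain ⟨m, o, rfl, hm⟩ := ex c hc
  have hkl : k ≠ l := by rintro rfl; exact hab (triEntry_same _ _ _ _ _ _)
  have hlm : l ≠ m := by rintro rfl; exact hbc (triEntry_same _ _ _ _ _ _)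
  have hmk : m ≠ k := by rintro rfl; exact hca (triEntry_same _ _ _ _ _ _)
  have e01 := triEntry_lt (n := n) X Y Z (show 0 < 1 by norm_num)
  have e02 := triEntry_lt (n := n) X Y Z (show 0 < 2 by norm_num)
  have e12 := triEntry_lt (n := n) X Y Z (show 1 < 2 by norm_num)
  have e10 := fun i j => (triEntry_comm (n := n) X Y Z _ _).trans (e01 i j)
  have e20 := fun i j => (triEntry_comm (n := n) X Y Z _ _).trans (e02 i j)
  have e21 := fun i j => (triEntry_comm (n := n) X Y Z _ _).trans (e12 i j)
  simp only [decode, (key _ _).1, (key _ _).2]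
  have hcase : (k = 0 ∧ l = 1 ∧ m = 2) ∨ (k = 0 ∧ l = 2 ∧ m = 1) ∨ (k = 1 ∧ l = 0 ∧ m = 2) ∨
    (k = 1 ∧ l = 2 ∧ m = 0) ∨ (k = 2 ∧ l = 0 ∧ m = 1) ∨ (k = 2 ∧ l = 1 ∧ m = 0) := by omega
  rcases hcase with ⟨rfl, rfl, rfl⟩ | ⟨rfl, rfl, rfl⟩ | ⟨rfl, rfl, rfl⟩ | ⟨rfl, rfl, rfl⟩ |
    ⟨rfl, rfl, rfl⟩ | ⟨rfl, rfl, rfl⟩ <;>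
  simp only [e01, e02, e12, e10, e20, e21, if_true, one_ne_zero, if_false,
    OfNat.ofNat_ne_one] at hab hbc hca ⊢
  · exact ⟨i, j, o, hab, hca, hbc, by omega, by simp, by simp, by simp⟩
  · exact ⟨i, o, j, hca, hab, hbc, by omega, by simp, by simp, by simp⟩
  · exact ⟨j, i, o, hab, hbc, hca, by omega, by simp, by simp, by simp⟩
  · exact ⟨o, i, j, hca, hbc, hab, by omega, by simp, by simp, by simp⟩
  · exact ⟨j, o, i, hbc, hab, hca, by omega, by simp, by simp, by simp⟩
  · exact ⟨o, j, i, hbc, hca, hab, by omega, by simp, by simp, by simp⟩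

/-- A minimum triangle of a tripartite graph. -/
theorem tripartite_output {K : ℕ} (X Y Z : ℕ → ℕ → ℕ) (hK : ∀ p q, triEntry n X Y Z p q ≤ K)
    {out : List ℕ} (h : MinTriangleOutput (tripartite X Y Z hK) out) (f : ℕ → ℕ) :
    (out = [] ∧ ∀ s x y : Fin n, X s x ≠ 0 → Y s y ≠ 0 → Z x y = 0) ∨
    ∃ a b c : ℕ, out = [a, b, c] ∧ a < 3 * n ∧ b < 3 * n ∧ c < 3 * n ∧
      ∃ s x y : Fin n, X s x ≠ 0 ∧ Y s y ≠ 0 ∧ Z x y ≠ 0 ∧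
        decode n a b c f 0 = s ∧ decode n a b c f 1 = x ∧ decode n a b c f 2 = y ∧
        ∀ s' x' y' : Fin n, X s' x' ≠ 0 → Y s' y' ≠ 0 → Z x' y' ≠ 0 →
          X s x + Y s y + Z x y ≤ X s' x' + Y s' y' + Z x' y' := by
  have ht : ∀ s x y : Fin n, ∃ a b c : Fin (3 * n), triEntry n X Y Z a b = X s x ∧
      triEntry n X Y Z b c = Z x y ∧ triEntry n X Y Z c a = Y s y := by
    intro s x y
    refine ⟨⟨0 * n + s, by omega⟩, ⟨1 * n + x, by omega⟩, ⟨2 * n + y, by omega⟩, ?_, ?_, ?_⟩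
    · rw [triEntry_lt _ _ _ (by norm_num)]; simp
    · rw [triEntry_lt _ _ _ (by norm_num)]; simp
    · rw [triEntry_comm, triEntry_lt _ _ _ (by norm_num)]; simp
  rcases minTriangleOutput_cases h with ⟨h1, h2⟩ | ⟨a, b, c, rfl, hab, hbc, hca, hmin⟩
  · refine Or.inl ⟨h1, fun s x y hX hY => ?_⟩
    obtain ⟨a, b, c, e1, e2, e3⟩ := ht s x y
    have := h2 a b c
    rw [tripartite_adj, tripartite_adj, tripartite_adj, e1, e2, e3] at this
    by_contra hZ
    exact this hX hZ hY
  · refine Or.inr ⟨a, b, c, rfl, a.2, b.2, c.2, ?_⟩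
    rw [tripartite_adj] at hab hbc hca
    obtain ⟨s, x, y, h1, h2, h3, h4, h5, h6, h7⟩ :=
      tri_decode X Y Z a.2 b.2 c.2 hab hbc hca f
    refine ⟨s, x, y, h1, h2, h3, h5, h6, h7, fun s' x' y' h1' h2' h3' => ?_⟩
    obtain ⟨a', b', c', e1, e2, e3⟩ := ht s' x' y'
    have := hmin a' b' c'
    simp only [tripartite_adj, tripartite_entry, e1, e2, e3, h4] at this
    have := this h1' h3' h2'
    omega

/-! ### The graphs for the bits of the first vertices -/

/-- The condition for an edge between a root `s` and a vertex `x` in the graph for the bit `pw`, on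
the side `β`. -/
def Leg (M r pw β D F : ℕ) : Prop :=
  F ≠ 0 ∧ D ≠ 0 ∧ F / pw % 2 = β ∧ r < D + M + 1 ∧ D + M + 1 - r ≤ 4 * M

open Classical in
/-- The weight of an edge between a root `s` and a vertex `x`. -/
noncomputable def legWeight (M r pw β D F : ℕ) : ℕ := if Leg M r pw β D F then D + M + 1 - r else 0

theorem legWeight_le (M r pw β D F : ℕ) : legWeight M r pw β D F ≤ 4 * M := by
  unfold legWeight; split_ifs with h
  · exact h.2.2.2.2
  · exact Nat.zero_le _

theorem legWeight_ne_zero_iff (M r pw β D F : ℕ) :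
    legWeight M r pw β D F ≠ 0 ↔ Leg M r pw β D F := by
  unfold legWeight; split_ifs with h
  · have := h.2.2.2.1
    simp [h]; omega
  · simp [h]

theorem legWeight_eq {M r pw β D F : ℕ} (h : Leg M r pw β D F) :
    legWeight M r pw β D F + r = D + M + 1 := by
  have := h.2.2.2.1
  rw [legWeight, if_pos h]; omega

theorem exists_bit_ne {K a b : ℕ} (ha : a < 2 ^ K) (hb : b < 2 ^ K) (h : a ≠ b) :
    ∃ k < K, a / 2 ^ k % 2 ≠ b / 2 ^ k % 2 := by
  by_contra! hc
  apply h
  apply Nat.eq_of_testBit_eq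
  intro i
  by_cases hi : i < K
  · have := hc i hi
    simp only [Nat.testBit_eq_decide_div_mod_eq, this]
  · rw [Nat.testBit_lt_two_pow (ha.trans_le (Nat.pow_le_pow_right (by norm_num) (by omega))),
      Nat.testBit_lt_two_pow (hb.trans_le (Nat.pow_le_pow_right (by norm_num) (by omega)))]

end WGraph


namespace WordRAM

/-! ### Simulation of a program inside of another one -/

/-- A bound for the registers that a program mentions. -/
def Prog.regBound : Prog → ℕ
  | .skip => 0
  | .const x _ => x + 1
  | .op _ x y z => max (x + 1) (max (y + 1) (z + 1))
  | .load x _ i => max (x + 1) (i + 1)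
  | .store _ i x => max (i + 1) (x + 1)
  | .seq p q => max p.regBound q.regBound
  | .ite x p q => max (x + 1) (max p.regBound q.regBound)
  | .loop x p => max (x + 1) p.regBound

/-- The address of the cell with the given index. -/
def addr (e : Expr) : Expr := e * .var 50 + .var 51

/-- The content of a simulated register. -/
def simReg (x : ℕ) : Expr := .get 10 (addr (.lit x))

/-- The program `P` with its registers in the array `10` and its arrays `a` in the arrays `a + 11`.
Only the cells with indices that are congruent to register `51` modulo register `50` are used. -/
def sim : Prog → Prog
  | .skip => .skip
  | .const x k => put 10 (addr (.lit x)) (.lit k)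
  | .op o x y z => put 10 (addr (.lit x)) (.bin o (simReg y) (simReg z))
  | .load x a i => put 10 (addr (.lit x)) (.get (a + 11) (addr (simReg i)))
  | .store a i x => put (a + 11) (addr (simReg i)) (simReg x)
  | .seq p q => .seq (sim p) (sim q)
  | .ite x p q => ifE (simReg x) (sim p) (sim q)
  | .loop x p => whileE (simReg x) (sim p)

/-- The state `h` is obtained from `h₀` by changing only memory for the simulation, in which it
contains the state `s`. -/
structure Sim (K k : ℕ) (h₀ : State) (s h : State) : Prop where
  reg : ∀ x, h.arr 10 (x * K + k) = s.reg x
  arr : ∀ a i, h.arr (a + 11) (i * K + k) = s.arr a i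
  user : h.reg = h₀.reg
  low : ∀ a < 10, h.arr a = h₀.arr a
  other : ∀ a j, j % K ≠ k → h.arr a j = h₀.arr a j

theorem setArr_cell_other {K k i v : ℕ} {h h₀ : State} (hk : k < K) {b : ℕ}
    (hh : ∀ a j, j % K ≠ k → h.arr a j = h₀.arr a j) :
    ∀ a j, j % K ≠ k → (h.setArr b (i * K + k) v).arr a j = h₀.arr a j := by
  intro a j hj
  rw [State.setArr_arr]
  split_ifs with hb
  · subst hb
    rw [Function.update_of_ne, hh _ _ hj]
    rintro rfl
    apply hj
    rw [Nat.add_mod, Nat.mul_mod_left, zero_add, Nat.mod_mod, Nat.mod_eq_of_lt hk]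
  · exact hh _ _ hj

theorem update_cell {K k i j v : ℕ} (hK : 0 < K) (f : ℕ → ℕ) :
    Function.update f (i * K + k) v (j * K + k) = if j = i then v else f (j * K + k) := by
  split_ifs with hji
  · subst hji; simp
  · rw [Function.update_of_ne]
    intro h
    exact hji (Nat.eq_of_mul_eq_mul_right hK (Nat.add_right_cancel h))

theorem Sim.setReg {K k : ℕ} {h₀ s h : State} (S : Sim K k h₀ s h) (hk : k < K) (x v : ℕ) :
    Sim K k h₀ (s.setReg x v) (h.setArr 10 (x * K + k) v) := by
  refine ⟨fun y => ?_, fun a i => ?_, S.user, fun a ha => ?_, setArr_cell_other hk S.other⟩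
  · rw [State.setReg_reg, State.setArr_arr, if_pos rfl, update_cell (by omega), S.reg]
  · rw [State.setReg_arr, State.setArr_arr, if_neg (by omega), S.arr]
  · rw [State.setArr_arr, if_neg (by omega), S.low a ha]

theorem Sim.setArr {K k : ℕ} {h₀ s h : State} (S : Sim K k h₀ s h) (hk : k < K) (a i v : ℕ) :
    Sim K k h₀ (s.setArr a i v) (h.setArr (a + 11) (i * K + k) v) := by
  refine ⟨fun y => ?_, fun b j => ?_, S.user, fun b hb => ?_, setArr_cell_other hk S.other⟩
  · rw [State.setArr_arr, if_neg (by omega), S.reg]; rfl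
  · simp only [State.setArr_arr, Nat.add_right_cancel_iff]
    by_cases hba : b = a
    · subst hba
      rw [if_pos rfl, if_pos rfl, update_cell (by omega), S.arr, Function.update_apply]
    · rw [if_neg hba, if_neg hba, S.arr]
  · rw [State.setArr_arr, if_neg (by omega), S.low b hb]

theorem Run.whileE_stop {B : ℕ} {e : Expr} {p : Prog} {h : State} {Q : State → Prop}
    (hok : e.Ok B h) (hz : e.eval h = 0) (hQ : Q h) : Run B (WordRAM.whileE e p) h (e.cost + 1) Q := by
  intro s hs
  obtain ⟨s1, h1, r1, v1, -, -⟩ := e.exec_code 0 hs hok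
  exact ⟨_, s1, h, .seq h1 (.loopStop (v1.trans hz)), le_rfl, r1, hQ⟩

/-- For a simulated loop there is no potential, only an execution to do induction on, so loops are
unrolled one round at a time. The test at the end of a round is the same code as the test at the
head of the remaining loop, and its execution is taken from there. -/
theorem Run.whileE_step {B : ℕ} {e : Expr} {p : Prog} {h : State} {R Q : State → Prop} {T₁ T₂ : ℕ}
    (hok : e.Ok B h) (hz : e.eval h ≠ 0) (hp : Run B p h T₁ R)
    (hl : ∀ h', R h' → Run B (WordRAM.whileE e p) h' T₂ Q) :
    Run B (WordRAM.whileE e p) h (e.cost + T₁ + T₂ + 1) Q := by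
  intro s hs
  obtain ⟨s1, h1, r1, v1, -, -⟩ := e.exec_code 0 hs hok
  obtain ⟨t2, s2, h2, he2, ht2, r2, hR⟩ := hp s1 r1
  obtain ⟨t3, s3, h3, he3, ht3, r3, hQ⟩ := hl h2 hR s2 r2
  cases he3 with
  | seq ha hb =>
    refine ⟨_, s3, h3, .seq h1 (.loopStep ?_ (.seq he2 ha) hb), by omega, r3, hQ⟩
    have : s1.reg 101 = e.eval h := v1
    rwa [this]

theorem opOk_of_eval_lt {B : ℕ} (hB : 1 < B) {o : Op} {u v : ℕ} (h : o.eval u v < B) :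
    Expr.OpOk B o u v := by
  cases o <;> first | exact h | exact hB | trivial

/-- Residue classes modulo `K` provide `K` disjoint copies of memory that are zero at the start, so
several runs need no clearing in between. Simulated indices are below `B₀` and register names below
`X`; the bounds on `B₀ * K` and `X * K` make all addresses words. Every simulated step costs at most
`30`. -/
theorem Exec.run_sim {B₀ B K k X : ℕ} {P : Prog} {s s' h₀ : State} {t : ℕ} (he : Exec B₀ P s t s')
    (hB : B₀ * K ≤ B) (hB1 : 1 < B) (hX : X * K ≤ B) (hk : k < K) (hK : h₀.reg 50 = K)
    (hk' : h₀.reg 51 = k) : P.regBound ≤ X →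
    ∀ h, s.Bounded B₀ → Sim K k h₀ s h → Run B (sim P) h (30 * t) (Sim K k h₀ s') := by
  have hB' : B₀ ≤ B := (Nat.le_mul_of_pos_right _ (by omega)).trans hB
  have hX' : X ≤ B := (Nat.le_mul_of_pos_right _ (by omega)).trans hX
  have haddr : ∀ {v Y}, Y * K ≤ B → v < Y → v * K + k < B := by
    intro v Y hY hv
    have := Nat.mul_le_mul_right K (Nat.succ_le_of_lt hv)
    rw [Nat.succ_mul] at this; omega
  have hlit : ∀ {s h : State} {x : ℕ}, Sim K k h₀ s h → x < X →
      (addr (.lit x)).Ok B h ∧ (addr (.lit x)).eval h = x * K + k := by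
    intro s h x S hx
    have h50 : h.reg 50 = K := by rw [S.user, hK]
    have h51 : h.reg 51 = k := by rw [S.user, hk']
    have h1 := haddr hX hx
    have e : (addr (.lit x)).eval h = x * K + k := by
      change x * h.reg 50 + h.reg 51 = _; rw [h50, h51]
    refine ⟨⟨⟨hx.trans_le hX', by simp, ?_⟩, by simp, ?_⟩, e⟩
    · change x * h.reg 50 < B; rw [h50]; omega
    · change x * h.reg 50 + h.reg 51 < B; rw [h50, h51]; exact h1
  have hreg : ∀ {s h : State} {x : ℕ}, Sim K k h₀ s h → x < X →
      (simReg x).Ok B h ∧ (simReg x).eval h = s.reg x := by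
    intro s h x S hx
    obtain ⟨h1, h2⟩ := hlit S hx
    refine ⟨h1, ?_⟩
    rw [simReg, Expr.eval_get, h2, S.reg]
  have hcell : ∀ {s h : State} {x : ℕ}, Sim K k h₀ s h → s.Bounded B₀ → x < X →
      (addr (simReg x)).Ok B h ∧ (addr (simReg x)).eval h = s.reg x * K + k := by
    intro s h x S hb hx
    have h50 : h.reg 50 = K := by rw [S.user, hK]
    have h51 : h.reg 51 = k := by rw [S.user, hk']
    obtain ⟨h1, h2⟩ := hreg S hx
    have h3 := haddr hB (hb.1 x)
    refine ⟨?_, ?_⟩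
    · simp only [addr, Expr.ok_add, Expr.ok_mul, Expr.ok_var, Expr.eval_mul, Expr.eval_var, h2, h50,
        h51, Nat.reduceLeDiff, true_and]
      exact ⟨⟨h1, by omega⟩, h3⟩
    · simp only [addr, Expr.eval_add, Expr.eval_mul, Expr.eval_var, h2, h50, h51]
  have c1 : ∀ x, (addr (.lit x)).cost = 5 := fun x => rfl
  have c2 : ∀ x, (simReg x).cost = 6 := fun x => rfl
  have c3 : ∀ x, (addr (simReg x)).cost = 10 := fun x => rfl
  induction he with
  | skip s =>
    intro _ h _ S s1 hs1
    exact ⟨1, s1, h, .skip _, by omega, hs1, S⟩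
  | const s x v hv =>
    intro hle h _ S
    simp only [Prog.regBound] at hle
    obtain ⟨h1, h2⟩ := hlit S (show x < X by omega)
    refine (Run.put (f := .lit v) h1 (show v < B by omega) ?_).conseq
      (by rw [c1]; simp only [Expr.cost]; omega) (fun _ h => h)
    rw [h2]
    exact S.setReg hk _ _
  | op s o x y z ho =>
    intro hle h _ S
    simp only [Prog.regBound] at hle
    obtain ⟨h1, h2⟩ := hlit S (show x < X by omega)
    obtain ⟨h3, h4⟩ := hreg S (show y < X by omega)
    obtain ⟨h5, h6⟩ := hreg S (show z < X by omega)
    rw [← h4, ← h6] at ho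
    refine (Run.put (f := .bin o (simReg y) (simReg z)) h1 ⟨h3, h5, opOk_of_eval_lt hB1 (by omega)⟩ ?_).conseq
      (by rw [c1]; simp only [Expr.cost, c2]; omega) (fun _ h => h)
    rw [h2, Expr.eval, h4, h6]
    exact S.setReg hk _ _
  | load s x a i =>
    intro hle h hb S
    simp only [Prog.regBound] at hle
    obtain ⟨h1, h2⟩ := hlit S (show x < X by omega)
    obtain ⟨h3, h4⟩ := hcell S hb (show i < X by omega)
    refine (Run.put (f := .get (a + 11) (addr (simReg i))) h1 h3 ?_).conseq (by rw [c1]; simp only [Expr.cost, c3]; omega) (fun _ h => h)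
    rw [h2, Expr.eval_get, h4, S.arr]
    exact S.setReg hk _ _
  | store s a i x =>
    intro hle h hb S
    simp only [Prog.regBound] at hle
    obtain ⟨h1, h2⟩ := hreg S (show x < X by omega)
    obtain ⟨h3, h4⟩ := hcell S hb (show i < X by omega)
    refine (Run.put h3 h1 ?_).conseq (by rw [c3, c2]; omega) (fun _ h => h)
    rw [h4, h2]
    exact S.setArr hk _ _ _
  | seq hp hq ihp ihq =>
    intro hle h hb S
    simp only [Prog.regBound] at hle
    refine ((ihp (by omega) h hb S).seq (fun g hg => ihq (by omega) g (hp.bounded hb) hg)).conseq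
      (by omega) (fun _ h => h)
  | @iteTrue x _ _ _ _ _ hx hp ih =>
    intro hle h hb S
    simp only [Prog.regBound] at hle
    obtain ⟨h1, h2⟩ := hreg S (show x < X by omega)
    exact (Run.ifE h1 (fun _ => ih (by omega) h hb S) (fun hc => absurd (h2 ▸ hc) hx)).conseq
      (by rw [c2]; omega) (fun _ h => h)
  | @iteFalse x _ _ _ _ _ hx hp ih =>
    intro hle h hb S
    simp only [Prog.regBound] at hle
    obtain ⟨h1, h2⟩ := hreg S (show x < X by omega)
    exact (Run.ifE h1 (fun hc => absurd hx (h2 ▸ hc)) (fun _ => ih (by omega) h hb S)).conseq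
      (by rw [c2]; omega) (fun _ h => h)
  | @loopStop x _ _ hx =>
    intro hle h hb S
    simp only [Prog.regBound] at hle
    obtain ⟨h1, h2⟩ := hreg S (show x < X by omega)
    exact (Run.whileE_stop h1 (h2.trans hx) S).conseq (by rw [c2]; omega) (fun _ h => h)
  | @loopStep x _ _ _ _ _ _ hx hp hl ih1 ih2 =>
    intro hle h hb S
    have hle' := hle
    simp only [Prog.regBound] at hle'
    obtain ⟨h1, h2⟩ := hreg S (show x < X by omega)
    exact (Run.whileE_step h1 (by rwa [h2]) (ih1 (by omega) h hb S)
      (fun g hg => ih2 hle g (hp.bounded hb) hg)).conseq (by rw [c2]; omega) (fun _ h => h)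

end WordRAM


namespace WordRAM

open WGraph

variable {n M : ℕ}

/-! ### The auxiliary graphs -/

/-- The weights between roots and vertices in the auxiliary graph for the bit `pw`. -/
noncomputable def legs (n M r pw β : ℕ) (h : State) (s x : ℕ) : ℕ :=
  legWeight M r pw β (h.arr 4 (s * n + x)) (h.arr 6 (s * n + x))

/-- The weights between vertices in the auxiliary graphs. -/
def links (n : ℕ) (h : State) (x y : ℕ) : ℕ := h.arr 0 (x * n + y)

/-- The entries of the auxiliary graph for the bit `pw`. -/
noncomputable def auxEntry (n M r pw : ℕ) (h : State) : ℕ → ℕ → ℕ :=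
  triEntry n (legs n M r pw 0 h) (legs n M r pw 1 h) (links n h)

/-- The distances of visited vertices are bounded. -/
def DistLe (n N : ℕ) (h : State) : Prop :=
  ∀ i, i < n * n → h.arr 6 i ≠ 0 → h.arr 4 i ≤ N

theorem legs_congr {r pw β : ℕ} {h h' : State} (h4 : h'.arr 4 = h.arr 4) (h6 : h'.arr 6 = h.arr 6) :
    legs n M r pw β h' = legs n M r pw β h := by
  unfold legs; rw [h4, h6]

theorem links_congr {h h' : State} (h0 : h'.arr 0 = h.arr 0) : links n h' = links n h := by
  unfold links; rw [h0]

/-- The weight of the edge between a root in register `26` and a vertex in register `28`. -/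
def legStmt : Stmt :=
  .seq (.asg 33 (.get 6 (.var 26 * .var 0 + .var 28))) <|
  .ite (.var 33) (.seq (.asg 32 (.get 4 (.var 26 * .var 0 + .var 28))) <|
    .ite (.var 32) (.ite (.eq (.var 33 / .var 56 % 2) (.var 27 - 1))
      (.seq (.asg 34 (.var 32 + .var 1 + 1 - .var 41)) <|
       .ite (.lt (.var 41) (.var 32 + .var 1 + 1))
        (.ite (.lt (4 * .var 1) (.var 34)) .skip (.asg 29 (.var 34))) .skip) .skip) .skip) .skip

/-- The nested branches are the conjuncts of `Leg`. The truncated difference in register `34` is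
computed early but used only after the test that it is positive. Register `27` holds the part of the
second vertex, which is `β + 1`. -/
theorem run_legStmt {B r pw β : ℕ} {h : State}
    (hB : n * n + 4 * (n * M) + 10 * n + 10 * M + 50 < B) (hD : DistLe n (n * M + M) h)
    (e0 : h.reg 0 = n) (e1 : h.reg 1 = M) (e41 : h.reg 41 = r) (e56 : h.reg 56 = pw)
    (e27 : h.reg 27 = β + 1) {s x : ℕ} (hs : s < n) (hx : x < n) (e26 : h.reg 26 = s)
    (e28 : h.reg 28 = x) (e29 : h.reg 29 = 0) :
    Run B legStmt.code h 60 (fun g => Fr [29, 32, 33, 34] [] h g ∧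
      g.reg 29 = legs n M r pw β h s x) := by
  refine Run.conseq (Stmt.run _ ?_) (by decide) (fun _ h => h)
  have hi := idx_lt hs hx
  have hsn : s * n ≤ n * n := by omega
  have hd := hD _ hi
  unfold legs
  generalize hF : h.arr 6 (s * n + x) = F at *
  generalize hDD : h.arr 4 (s * n + x) = D at *
  simp only [legStmt, Stmt.wp, Expr.ok_get, Expr.ok_add, Expr.ok_mul, Expr.ok_var, Expr.eval_mul,
    Expr.eval_var, Expr.eval_add, Expr.eval_get, Expr.ok_eq, Expr.ok_mod, Expr.ok_div, Expr.ok_lt,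
    Expr.ok_sub, Expr.eval_sub, Expr.eval_lt,
    State.setReg_reg, State.setReg_arr, Expr.eval_eq, Expr.eval_mod, Expr.eval_div,
    Expr.eval_ofNat, Expr.ok_ofNat, e0, e1, e41, e56, e27, e26, e28, e29, hF, hDD, reduceIte,
    Nat.reduceEqDiff, Nat.reduceLeDiff, true_and, Nat.add_sub_cancel]
  have f0 : ∀ v, Fr [29, 32, 33, 34] [] h (h.setReg 33 v) := fun v =>
    (Fr.refl _ _ _).setReg (by decide)
  refine ⟨by omega, fun h1 => ⟨by omega, fun h2 => ⟨by omega, fun h3 => ⟨⟨by omega, trivial⟩, by omega,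
    fun h4 => ⟨by omega, fun h5 => ?_, fun h5 => ?_⟩, fun h4 => ?_⟩, fun h3 => ?_⟩, fun h2 => ?_⟩, fun h1 => ?_⟩
  · refine ⟨((f0 _).setReg (by decide)).setReg (by decide), ?_⟩
    rw [legWeight, if_neg]
    rintro ⟨-, -, -, -, h6⟩
    apply h5; rw [if_neg]; omega
  · refine ⟨(((f0 _).setReg (by decide)).setReg (by decide)).setReg (by decide), ?_⟩
    rw [legWeight, if_pos]
    refine ⟨h1, h2, by by_contra h'; simp [h'] at h3, by by_contra h'; simp [h'] at h4,
      by by_contra! h'; simp [h'] at h5⟩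
  · refine ⟨((f0 _).setReg (by decide)).setReg (by decide), ?_⟩
    rw [legWeight, if_neg]
    rintro ⟨-, -, -, h6, -⟩
    simp [h6] at h4
  · refine ⟨(f0 _).setReg (by decide), ?_⟩
    rw [legWeight, if_neg]
    rintro ⟨-, -, h6, -⟩
    simp [h6] at h3
  · refine ⟨(f0 _).setReg (by decide), ?_⟩
    rw [legWeight, if_neg]
    rintro ⟨-, h6, -⟩
    exact h6 h2
  · refine ⟨f0 _, ?_⟩
    rw [legWeight, if_neg]
    rintro ⟨h6, -⟩
    exact h6 h1

/-- Compute the parts and the indices of the two vertices of the pair in register `55`. -/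
def locate : Prog :=
  .seq (Stmt.seq (.asg 23 (.var 55 / (3 * .var 0))) <| .seq (.asg 24 (.var 55 % (3 * .var 0))) <|
    .ite (.lt (.var 24) (.var 23)) (.seq (.asg 25 (.var 23)) <| .seq (.asg 23 (.var 24))
      (.asg 24 (.var 25))) .skip).code <|
  (Stmt.seq (.asg 25 (.var 23 / .var 0)) <| .seq (.asg 26 (.var 23 % .var 0)) <|
    .seq (.asg 27 (.var 24 / .var 0)) <| .seq (.asg 28 (.var 24 % .var 0)) (.asg 29 0)).code

theorem run_locate {B i p q : ℕ} {h : State}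
    (hB : n * n + 4 * (n * M) + 10 * n + 10 * M + 50 < B) (e0 : h.reg 0 = n)
    (e55 : h.reg 55 = i) (hp : i / (3 * n) = p) (hq : i % (3 * n) = q) :
    Run B locate h 60 (fun g => Fr [23, 24, 25, 26, 27, 28, 29] [] h g ∧
      g.reg 25 = min p q / n ∧ g.reg 26 = min p q % n ∧ g.reg 27 = max p q / n ∧
      g.reg 28 = max p q % n ∧ g.reg 29 = 0) := by
  refine (Run.seq (Q := fun g => Fr [23, 24, 25] [] h g ∧ g.reg 23 = min p q ∧ g.reg 24 = max p q)
    (T₁ := 30) (T₂ := 30) (Run.conseq (Stmt.run _ ?_) (by decide) (fun _ h => h))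
    (fun g ⟨f, e23, e24⟩ => ?_)).conseq (by norm_num) (fun _ h => h)
  · simp only [Stmt.wp, Expr.ok_mul, Expr.ok_var, Expr.eval_mul,
      Expr.eval_var, Expr.ok_mod, Expr.ok_div, Expr.ok_lt, Expr.eval_lt,
      State.setReg_reg, Expr.eval_mod, Expr.eval_div,
      Expr.eval_ofNat, Expr.ok_ofNat, e0, e55, hp, hq, reduceIte,
      Nat.reduceEqDiff, Nat.reduceLeDiff, true_and]
    refine ⟨by omega, by omega, by omega, fun hc => ?_, fun hc => ?_⟩
    · have h1 : q < p := by by_contra h'; simp [h'] at hc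
      refine ⟨?_, by omega, by omega⟩
      exact (((((Fr.refl _ _ _).setReg (by decide)).setReg (by decide)).setReg (by decide)).setReg
        (by decide)).setReg (by decide)
    · have h1 : p ≤ q := by by_contra! h'; simp [h'] at hc
      exact ⟨((Fr.refl _ _ _).setReg (by decide)).setReg (by decide), by omega, by omega⟩
  · refine (Stmt.run _ ?_).conseq (by decide) (fun _ h => h)
    simp only [Stmt.wp, Expr.ok_var, Expr.eval_var, Expr.ok_mod, Expr.ok_div,
      State.setReg_reg, Expr.eval_mod, Expr.eval_div,
      Expr.eval_ofNat, Expr.ok_ofNat, (f.1 0 (by decide)).trans e0, e23, e24, reduceIte,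
      Nat.reduceEqDiff, Nat.reduceLeDiff, true_and, and_true]
    refine ⟨by omega, ?_⟩
    have := f.mono (R' := [23, 24, 25, 26, 27, 28, 29]) (by decide) (List.Subset.refl _)
    exact ((((this.setReg (by decide)).setReg (by decide)).setReg (by decide)).setReg
      (by decide)).setReg (by decide)

/-- Write the entry of the auxiliary graph for the pair in register `55`. -/
def buildEntry : Prog :=
  .seq locate <|
  .seq (ifE (.lt (.var 25) (.var 27))
    (ifE (.var 25) (asg 29 (.get 0 (.var 26 * .var 0 + .var 28))) legStmt.code) .skip) <|
  put 11 (.var 55 * .var 50 + .var 51) (.var 29)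

/-- Registers that may be changed in the construction of the auxiliary graphs. -/
abbrev auxRegs : List ℕ := [23, 24, 25, 26, 27, 28, 29, 32, 33, 34]

/-- The result is given as one exact write, so that all other cells of the array, among them those
of other residue classes, are known to be unchanged. -/
theorem run_buildEntry {B r pw K k i : ℕ} {h : State}
    (hB : n * n + 4 * (n * M) + 10 * n + 10 * M + 50 < B) (hD : DistLe n (n * M + M) h)
    (e0 : h.reg 0 = n) (e1 : h.reg 1 = M) (e41 : h.reg 41 = r) (e56 : h.reg 56 = pw)
    (e50 : h.reg 50 = K) (e51 : h.reg 51 = k) (e55 : h.reg 55 = i) (hi : i < 3 * n * (3 * n))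
    (hik : i * K + k < B) :
    Run B buildEntry h 150 (fun g => ∃ g₀, Fr auxRegs [] h g₀ ∧
      g = g₀.setArr 11 (i * K + k) (auxEntry n M r pw h (i / (3 * n)) (i % (3 * n)))) := by
  have hn : 0 < n := Nat.pos_of_ne_zero (by rintro rfl; simp at hi)
  have hp : i / (3 * n) < 3 * n := by rwa [Nat.div_lt_iff_lt_mul (by omega)]
  have hq : i % (3 * n) < 3 * n := Nat.mod_lt _ (by omega)
  refine ((run_locate hB e0 e55 rfl rfl).seq (T₂ := 90)
    (fun g1 ⟨f1, b25, b26, b27, b28, b29⟩ => ?_)).conseq (by norm_num) (fun _ h => h)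
  set p := i / (3 * n)
  set q := i % (3 * n)
  have hlt : max p q / n < 3 := by rw [Nat.div_lt_iff_lt_mul hn]; omega
  have hm1 := Nat.mod_lt (min p q) hn
  have hm2 := Nat.mod_lt (max p q) hn
  have c0 : g1.reg 0 = n := (f1.1 0 (by decide)).trans e0
  have f1' : Fr auxRegs [] h g1 := f1.mono (by decide) (List.Subset.refl _)
  refine (Run.seq (T₁ := 80) (T₂ := 10) (Q := fun g => Fr auxRegs [] h g ∧
    g.reg 29 = auxEntry n M r pw h p q) (Run.conseq (Run.ifE (T := 70) ?_ (fun hc => ?_)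
    (fun hc => ?_)) (by decide) (fun _ h => h)) (fun g2 ⟨f2, b29⟩ => ?_)).conseq (by norm_num)
    (fun _ h => h)
  · simp; omega
  · have h1 : min p q / n < max p q / n := by
      by_contra h'; rw [← b25, ← b27] at h'; simp [h'] at hc
    refine Run.conseq (Run.ifE (T := 60) ?_ (fun hc' => ?_) (fun hc' => ?_)) (by decide)
      (fun _ h => h)
    · simp
    · rw [Expr.eval_var, b25] at hc'
      have h2 := idx_lt hm1 hm2
      refine Run.conseq (Run.asg ?_ ?_) (by decide) (fun _ h => h)
      · simp only [Expr.ok_get, Expr.ok_add, Expr.ok_mul, Expr.ok_var, Expr.eval_mul,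
          Expr.eval_var, c0, b26, b28, Nat.reduceLeDiff, true_and]
        omega
      · refine ⟨f1'.setReg (by decide), ?_⟩
        simp only [State.setReg_reg, reduceIte, Expr.eval_get, Expr.eval_add, Expr.eval_mul,
          Expr.eval_var, c0, b26, b28, f1.2 0 (by decide)]
        unfold auxEntry triEntry
        rw [if_pos h1, if_neg hc']
        rfl
    · rw [Expr.eval_var, b25] at hc'
      have hβ : max p q / n = 1 ∨ max p q / n = 2 := by omega
      refine (run_legStmt (β := max p q / n - 1) hB (r := r) (pw := pw) ?_ c0 ?_ ?_ ?_ ?_ hm1 hm2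
        b26 b28 b29).conseq le_rfl (fun g hg => ⟨?_, ?_⟩)
      · intro j hj hj'
        rw [f1.2 6 (by decide)] at hj'
        rw [f1.2 4 (by decide)]
        exact hD j hj hj'
      · exact (f1.1 1 (by decide)).trans e1
      · exact (f1.1 41 (by decide)).trans e41
      · exact (f1.1 56 (by decide)).trans e56
      · rw [b27]; omega
      · exact f1'.trans hg.1 (List.Subset.refl _) (by decide) (List.Subset.refl _) (by decide)
      · rw [hg.2, legs_congr (f1.2 4 (by decide)) (f1.2 6 (by decide))]
        unfold auxEntry triEntry
        rw [if_pos h1, if_pos hc']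
        rcases hβ with h2 | h2
        · rw [h2, if_pos rfl]
        · rw [h2, if_neg (by norm_num)]
  · have h1 : ¬ min p q / n < max p q / n := by
      intro h'; rw [← b25, ← b27] at h'; simp [h'] at hc
    intro s hs
    refine ⟨1, s, g1, .skip s, by norm_num, hs, f1', ?_⟩
    rw [b29, auxEntry, triEntry, if_neg h1]
  · have d50 : g2.reg 50 = K := (f2.1 50 (by decide)).trans e50
    have d51 : g2.reg 51 = k := (f2.1 51 (by decide)).trans e51
    have d55 : g2.reg 55 = i := (f2.1 55 (by decide)).trans e55
    refine Run.conseq (Run.put ?_ (by simp) ?_) (by decide) (fun _ h => h)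
    · simp only [Expr.ok_add, Expr.ok_mul, Expr.ok_var, Expr.eval_mul,
        Expr.eval_var, d50, d51, d55, Nat.reduceLeDiff, true_and]
      omega
    · refine ⟨g2, f2, ?_⟩
      simp only [Expr.eval_add, Expr.eval_mul, Expr.eval_var, d50, d51, d55, b29]

/-- Write the adjacency matrix of the auxiliary graph for the bit in register `56`. -/
def build : Prog := forE 55 (.var 54) buildEntry

theorem run_build {B r pw K k : ℕ} {h : State}
    (hB : n * n + 4 * (n * M) + 10 * n + 10 * M + 50 < B) (hD : DistLe n (n * M + M) h)
    (e0 : h.reg 0 = n) (e1 : h.reg 1 = M) (e41 : h.reg 41 = r) (e56 : h.reg 56 = pw)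
    (e50 : h.reg 50 = K) (e51 : h.reg 51 = k) (e54 : h.reg 54 = 3 * n * (3 * n)) (hk : k < K)
    (hBK : 3 * n * (3 * n) * K + 2 < B) :
    Run B build h (3 * n * (3 * n) * 160 + 10) (fun g => Fr (55 :: auxRegs) [11] h g ∧
      (∀ i < 3 * n * (3 * n), g.arr 11 (i * K + k) =
        auxEntry n M r pw h (i / (3 * n)) (i % (3 * n))) ∧
      (∀ j, (∀ i < 3 * n * (3 * n), j ≠ i * K + k) → g.arr 11 j = h.arr 11 j)) := by
  have hN : 3 * n * (3 * n) ≤ 3 * n * (3 * n) * K := Nat.le_mul_of_pos_right _ (by omega)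
  refine (Run.forE (N := 3 * n * (3 * n)) (fun m g => Fr (55 :: auxRegs) [11] h g ∧
      (∀ i < m, g.arr 11 (i * K + k) =
        auxEntry n M r pw h (i / (3 * n)) (i % (3 * n))) ∧
      (∀ j, (∀ i < m, j ≠ i * K + k) → g.arr 11 j = h.arr 11 j)) 150 (by norm_num) (by omega)
      ?_ ?_ ?_ (fun g hg _ => hg)).conseq (by simp only [Expr.cost]; omega) (fun _ h => h)
  · exact ⟨(Fr.refl _ _ _).setReg (by decide), by simp, by simp⟩
  · rintro m g - ⟨f, -⟩ -
    simp [(f.1 54 (by decide)).trans e54]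
  · rintro m g hm ⟨f, h1, h2⟩ e55
    have hmK := Nat.mul_le_mul_right K (Nat.succ_le_of_lt hm)
    rw [Nat.succ_mul] at hmK
    have haux : auxEntry n M r pw g = auxEntry n M r pw h := by
      unfold auxEntry
      rw [legs_congr (f.2 4 (by decide)) (f.2 6 (by decide)),
        legs_congr (f.2 4 (by decide)) (f.2 6 (by decide)), links_congr (f.2 0 (by decide))]
    refine (run_buildEntry hB (r := r) (pw := pw) (K := K) (k := k) ?_ ((f.1 0 (by decide)).trans e0)
      ((f.1 1 (by decide)).trans e1) ((f.1 41 (by decide)).trans e41)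
      ((f.1 56 (by decide)).trans e56) ((f.1 50 (by decide)).trans e50)
      ((f.1 51 (by decide)).trans e51) e55 hm (by omega)).conseq le_rfl ?_
    · intro j hj hj'
      rw [f.2 6 (by decide)] at hj'
      rw [f.2 4 (by decide)]
      exact hD j hj hj'
    · rintro g' ⟨g₀, f₀, rfl⟩
      have hf : Fr (55 :: auxRegs) [11] h g₀ :=
        f.trans f₀ (List.Subset.refl _) (by decide) (List.Subset.refl _) (by decide)
      refine ⟨by simpa using (f₀.1 55 (by decide)).trans e55,
        (hf.setArr (by decide)).setReg (by decide), fun i hi => ?_, fun j hj => ?_⟩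
      · rw [State.setReg_arr, State.setArr_arr, if_pos rfl]
        by_cases him : i = m
        · subst him; rw [Function.update_self, haux]
        · rw [Function.update_of_ne, f₀.2 11 (by decide), h1 i (by omega)]
          intro he
          exact him (Nat.eq_of_mul_eq_mul_right (by omega) (Nat.add_right_cancel he))
      · rw [State.setReg_arr, State.setArr_arr, if_pos rfl, Function.update_of_ne (hj m (by omega)),
          f₀.2 11 (by decide)]
        exact h2 j (fun i hi => hj i (by omega))

end WordRAM


namespace WordRAM

open WGraph

variable {n M : ℕ}

/-! ### Collecting the minimum triangles -/

/-- A triangle of the auxiliary graph for the bit `pw`. -/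
def Cand (n M r pw : ℕ) (h : State) (s x y : ℕ) : Prop :=
  legs n M r pw 0 h s x ≠ 0 ∧ legs n M r pw 1 h s y ≠ 0 ∧ links n h x y ≠ 0

/-- The weight of the closed walk that consists of two paths from `s` and an edge. -/
def total (n : ℕ) (h : State) (s x y : ℕ) : ℕ :=
  h.arr 4 (s * n + x) + h.arr 4 (s * n + y) + links n h x y

/-- Both legs are shifted by the same amount `M + 1 - r`. Thus triangle weights and totals differ by
a constant, and minimizing one minimizes the other. -/
theorem Cand.weight {r pw s x y : ℕ} {h : State} (hc : Cand n M r pw h s x y) :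
    legs n M r pw 0 h s x + legs n M r pw 1 h s y + links n h x y + 2 * r =
      total n h s x y + 2 * M + 2 := by
  have h1 := legWeight_eq ((legWeight_ne_zero_iff _ _ _ _ _ _).1 hc.1)
  have h2 := legWeight_eq ((legWeight_ne_zero_iff _ _ _ _ _ _).1 hc.2.1)
  unfold total legs
  omega

/-- Allows `0` in register `60` to mean that no triangle has been found yet. -/
theorem Cand.total_ne_zero {r pw s x y : ℕ} {h : State} (hc : Cand n M r pw h s x y) :
    total n h s x y ≠ 0 := by
  have := hc.2.2
  unfold total; omega

/-- The registers `60`, …, `63` contain the best triangle for the first `k` bits. -/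
def Best (n M r : ℕ) (h : State) (k : ℕ) (g : State) : Prop :=
  (g.reg 60 = 0 ∧ ∀ k' < k, ∀ s x y : Fin n, ¬ Cand n M r (2 ^ k') h s x y) ∨
  ∃ (k' : ℕ) (s x y : Fin n), g.reg 61 = s ∧ g.reg 62 = x ∧ g.reg 63 = y ∧
    Cand n M r (2 ^ k') h s x y ∧ g.reg 60 = total n h s x y ∧
    ∀ k'' < k, ∀ s' x' y' : Fin n, Cand n M r (2 ^ k'') h s' x' y' →
      total n h s x y ≤ total n h s' x' y'

theorem Best.congr {r k : ℕ} {h g g' : State} (hb : Best n M r h k g)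
    (hr : ∀ x, 60 ≤ x → x ≤ 63 → g'.reg x = g.reg x) : Best n M r h k g' := by
  unfold Best at *
  rwa [hr 60 (by norm_num) (by norm_num), hr 61 (by norm_num) (by norm_num),
    hr 62 (by norm_num) (by norm_num), hr 63 (by norm_num) (by norm_num)]

theorem Best.succ_of_forall_not {r k : ℕ} {h g : State} (hb : Best n M r h k g)
    (hn : ∀ s x y : Fin n, ¬ Cand n M r (2 ^ k) h s x y) : Best n M r h (k + 1) g := by
  rcases hb with ⟨h1, h2⟩ | ⟨k', s, x, y, h1, h2, h3, h4, h5, h6⟩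
  · refine Or.inl ⟨h1, fun k' hk' => ?_⟩
    rcases Nat.lt_succ_iff_lt_or_eq.1 hk' with h3 | rfl
    exacts [h2 k' h3, hn]
  · refine Or.inr ⟨k', s, x, y, h1, h2, h3, h4, h5, fun k'' hk'' => ?_⟩
    rcases Nat.lt_succ_iff_lt_or_eq.1 hk'' with h7 | rfl
    exacts [h6 k'' h7, fun s' x' y' hc => absurd hc (hn s' x' y')]

/-- Sort the vertices of the triangle that was found. -/
def readTriangle : Stmt :=
  .seq (.asg 35 (.get 12 (.var 51))) <| .seq (.asg 36 (.get 12 (.var 50 + .var 51))) <|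
  .seq (.asg 37 (.get 12 (.var 50 + .var 50 + .var 51))) <|
  .seq (.put 9 (.var 35 / .var 0) (.var 35 % .var 0)) <|
  .seq (.put 9 (.var 36 / .var 0) (.var 36 % .var 0)) <|
  .seq (.put 9 (.var 37 / .var 0) (.var 37 % .var 0)) <|
  .seq (.asg 35 (.get 9 0)) <| .seq (.asg 36 (.get 9 1)) (.asg 37 (.get 9 2))

/-- Store the triangle in the registers `35`, …, `37` as the best one. -/
def setBest : Stmt :=
  .seq (.asg 60 (.var 38)) <| .seq (.asg 61 (.var 35)) <| .seq (.asg 62 (.var 36))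
    (.asg 63 (.var 37))

/-- Compare the triangle in the registers `35`, …, `37` with the best one. -/
def compareBest : Stmt :=
  .seq (.asg 38 (.get 4 (.var 35 * .var 0 + .var 36) + .get 4 (.var 35 * .var 0 + .var 37) +
    .get 0 (.var 36 * .var 0 + .var 37))) <|
  .ite (.var 60) (.ite (.lt (.var 38) (.var 60)) setBest .skip) setBest

theorem run_readTriangle {B K k a b c : ℕ} {h : State} (e0 : h.reg 0 = n) (e50 : h.reg 50 = K)
    (e51 : h.reg 51 = k) (hk : k < K) (hB : 3 * K + 2 < B) (ha : h.arr 12 k = a)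
    (hb : h.arr 12 (K + k) = b) (hc : h.arr 12 (K + K + k) = c) :
    Run B readTriangle.code h 60 (fun g => Fr [35, 36, 37] [9] h g ∧
      g.reg 35 = decode n a b c (h.arr 9) 0 ∧ g.reg 36 = decode n a b c (h.arr 9) 1 ∧
      g.reg 37 = decode n a b c (h.arr 9) 2) := by
  refine Run.conseq (Stmt.run _ ?_) (by decide) (fun _ h => h)
  simp only [readTriangle, Stmt.wp, Expr.ok_get, Expr.ok_add, Expr.ok_var,
    Expr.eval_var, Expr.eval_add, Expr.eval_get, Expr.ok_mod, Expr.ok_div,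
    State.setReg_reg, State.setReg_arr, State.setArr_reg, State.setArr_arr, Expr.eval_mod,
    Expr.eval_div, Expr.eval_ofNat, Expr.ok_ofNat, e0, e50, e51, ha, hb, hc, reduceIte,
    Nat.reduceEqDiff, Nat.reduceLeDiff, true_and, and_true]
  refine ⟨by omega, by omega, by omega, by omega, by omega, ?_, rfl, rfl, rfl⟩
  exact ((((((((((Fr.refl _ _ _).setReg (by decide)).setReg (by decide)).setReg (by decide)).setArr
    (by decide)).setArr (by decide)).setArr (by decide)).setReg (by decide)).setReg
    (by decide)).setReg (by decide))

/-- The totals do not depend on the bit, so the winners of different rounds can be compared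
directly. -/
theorem run_compareBest {B r k : ℕ} {h₀ h : State} {s x y : Fin n}
    (hB : n * n + 4 * (n * M) + 10 * n + 10 * M + 50 < B) (hD : DistLe n (n * M + M) h₀)
    (hW : links n h₀ x y ≤ M) (e0 : h.reg 0 = n) (h4 : h.arr 4 = h₀.arr 4) (h0 : h.arr 0 = h₀.arr 0)
    (e35 : h.reg 35 = s) (e36 : h.reg 36 = x) (e37 : h.reg 37 = y)
    (hc : Cand n M r (2 ^ k) h₀ s x y)
    (hmin : ∀ s' x' y' : Fin n, Cand n M r (2 ^ k) h₀ s' x' y' →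
      total n h₀ s x y ≤ total n h₀ s' x' y')
    (hb : Best n M r h₀ k h) :
    Run B compareBest.code h 60 (fun g => Fr [38, 60, 61, 62, 63] [] h g ∧
      Best n M r h₀ (k + 1) g) := by
  refine Run.conseq (Stmt.run _ ?_) (by decide) (fun _ h => h)
  have i1 := idx_lt s.2 x.2
  have i2 := idx_lt s.2 y.2
  have i3 := idx_lt x.2 y.2
  have d1 := hD _ i1 ((legWeight_ne_zero_iff _ _ _ _ _ _).1 hc.1).1
  have d2 := hD _ i2 ((legWeight_ne_zero_iff _ _ _ _ _ _).1 hc.2.1).1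
  have htot : h₀.arr 4 (s * n + x) + h₀.arr 4 (s * n + y) + h₀.arr 0 (x * n + y) =
    total n h₀ s x y := rfl
  have hW' : h₀.arr 0 (x * n + y) ≤ M := hW
  simp only [compareBest, setBest, Stmt.wp, Expr.ok_get, Expr.ok_add, Expr.ok_mul, Expr.ok_var,
    Expr.eval_var, Expr.eval_add, Expr.eval_mul, Expr.eval_get, Expr.ok_lt, Expr.eval_lt,
    State.setReg_reg, e0, e35, e36, e37, h4, h0, reduceIte,
    Nat.reduceEqDiff, Nat.reduceLeDiff, true_and, htot]
  have hset : ∀ g : State, g.reg 60 = total n h₀ s x y → g.reg 61 = s → g.reg 62 = x →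
      g.reg 63 = y → (h.reg 60 = 0 ∨ total n h₀ s x y < h.reg 60) → Best n M r h₀ (k + 1) g := by
    intro g a1 a2 a3 a4 hlt
    refine Or.inr ⟨k, s, x, y, a2, a3, a4, hc, a1, fun k'' hk'' s' x' y' hc' => ?_⟩
    rcases Nat.lt_succ_iff_lt_or_eq.1 hk'' with h7 | rfl
    swap
    · exact hmin s' x' y' hc'
    rcases hb with ⟨b1, b2⟩ | ⟨k', s1, x1, y1, b1, b2, b3, b4, b5, b6⟩
    · exact absurd hc' (b2 _ h7 _ _ _)
    · have := b6 k'' h7 s' x' y' hc'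
      have := b4.total_ne_zero
      omega
  have hf : ∀ v w a b c, Fr [38, 60, 61, 62, 63] []
      h (((((h.setReg 38 v).setReg 60 w).setReg 61 a).setReg 62 b).setReg 63 c) := by
    intro v w a b c
    exact (((((Fr.refl _ _ _).setReg (by decide)).setReg (by decide)).setReg (by decide)).setReg
      (by decide)).setReg (by decide)
  refine ⟨by omega, fun h1 => ⟨by omega, fun h2 => ⟨hf _ _ _ _ _, hset _ (by simp) (by simp)
    (by simp) (by simp) (Or.inr ?_)⟩, fun h2 => ⟨(Fr.refl _ _ _).setReg (by decide), ?_⟩⟩,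
    fun h1 => ⟨hf _ _ _ _ _, hset _ (by simp) (by simp) (by simp) (by simp) (Or.inl h1)⟩⟩
  · by_contra h'; simp [h'] at h2
  · have h3 : h.reg 60 ≤ total n h₀ s x y := by by_contra! h'; simp [h'] at h2
    refine Best.congr (g := h) ?_ (fun z hz hz' => by rw [State.setReg_reg, if_neg (by omega)])
    rcases hb with ⟨b1, -⟩ | ⟨k', s1, x1, y1, b1, b2, b3, b4, b5, b6⟩
    · exact absurd b1 h1
    · refine Or.inr ⟨k', s1, x1, y1, b1, b2, b3, b4, b5, fun k'' hk'' s' x' y' hc' => ?_⟩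
      rcases Nat.lt_succ_iff_lt_or_eq.1 hk'' with h7 | rfl
      · exact b6 _ h7 _ _ _ hc'
      · have := hmin s' x' y' hc'
        omega

/-- Take over the triangle that was found. -/
def collect : Prog :=
  .seq (asg 57 (.get 10 (.var 51)))
    (ifE (.var 57) (.seq readTriangle.code compareBest.code) .skip)

/-- Write the parameters of the auxiliary graph. -/
def setInput : Stmt :=
  .seq (.put 10 (.var 51) (3 * .var 0)) (.put 10 (.var 50 + .var 51) (4 * .var 1))

/-- Find a minimum triangle in one auxiliary graph. -/
def round (P : Prog) : Prog :=
  .seq build <| .seq setInput.code <| .seq (sim P) <| .seq collect (asg 56 (.var 56 * 2))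

/-- The state after the rounds for the first `k` bits. -/
structure RoundState (n M r K : ℕ) (h : State) (k : ℕ) (g : State) : Prop where
  keep : ∀ x, x ≤ 22 ∨ (39 ≤ x ∧ x ≤ 50) ∨ x = 54 → g.reg x = h.reg x
  low : ∀ a < 9, g.arr a = h.arr a
  pw : g.reg 56 = 2 ^ k
  cells : ∀ a, 10 ≤ a → ∀ i k', k ≤ k' → k' < K → g.arr a (i * K + k') = 0
  best : Best n M r h k g

theorem RoundState.setReg51 {r K k : ℕ} {h g : State}
    (S : RoundState n M r K h k g) (v : ℕ) : RoundState n M r K h k (g.setReg 51 v) := by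
  refine ⟨fun x hx => ?_, S.low, ?_, S.cells, S.best.congr fun x _ _ => ?_⟩
  · rw [State.setReg_reg, if_neg (by omega), S.keep x hx]
  · rw [State.setReg_reg, if_neg (by omega), S.pw]
  · rw [State.setReg_reg, if_neg (by omega)]

theorem input_arr (G : WGraph n M) (i : ℕ) (hi : i < n * n) :
    ∃ p q : Fin n, (p : ℕ) = i / n ∧ (q : ℕ) = i % n ∧ G.input.arr 0 i = G.entry p q := by
  refine ⟨(⟨i, hi⟩ : Fin (n * n)).divNat, (⟨i, hi⟩ : Fin (n * n)).modNat, rfl, rfl, ?_⟩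
  simp only [input, true_and, dif_pos hi]

/-- Residue class `k` is zero before the round. Once the matrix and the two parameters are written,
it is exactly the initial memory of a run on the tripartite graph. Later classes are not touched and
remain zero for their own rounds. -/
theorem run_round {B B₀ K k r τ : ℕ} {P : Prog} (G : WGraph n M) {h g : State}
    (hB : n * n + 4 * (n * M) + 10 * n + 10 * M + 50 < B) (hi : Inp G h)
    (hBK : 3 * n * (3 * n) * K + 3 * K + 2 < B) (hB₀ : B₀ * K ≤ B)
    (hX : P.regBound * K ≤ B) (h3 : 3 * n < B₀)
    (h4 : 4 * M < B₀) (hpow : 2 ^ (k + 1) < B)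
    (hP : ∀ G' : WGraph (3 * n) (4 * M), ∃ t s, Exec B₀ P G'.input t s ∧
      MinTriangleOutput G' s.output ∧ t ≤ τ)
    (hD : DistLe n (n * M + M) h) (e41 : h.reg 41 = r) (e50 : h.reg 50 = K)
    (e54 : h.reg 54 = 3 * n * (3 * n)) (hk : k < K) (S : RoundState n M r K h k g)
    (e51 : g.reg 51 = k) :
    Run B (round P) g (3 * n * (3 * n) * 160 + 30 * τ + 250)
      (fun g' => g'.reg 51 = k ∧ RoundState n M r K h (k + 1) g') := by
  have a0 : g.reg 0 = n := (S.keep 0 (by omega)).trans hi.reg0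
  have a1 : g.reg 1 = M := (S.keep 1 (by omega)).trans hi.reg1
  have hlegs : ∀ {g' : State} pw β, (∀ a < 9, g'.arr a = h.arr a) →
      legs n M r pw β g' = legs n M r pw β h := fun pw β hl =>
    legs_congr (hl 4 (by norm_num)) (hl 6 (by norm_num))
  have haux : ∀ {g' : State} pw, (∀ a < 9, g'.arr a = h.arr a) →
      auxEntry n M r pw g' = auxEntry n M r pw h := fun pw hl => by
    unfold auxEntry
    rw [hlegs _ _ hl, hlegs _ _ hl, links_congr (hl 0 (by norm_num))]
  have hlink : ∀ x y : Fin n, links n h x y ≤ M := fun x y => by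
    rw [links, hi.arr0]; exact G.entry_le _ _
  have hDg : DistLe n (n * M + M) g := by
    intro j hj hj'
    rw [S.low 6 (by norm_num)] at hj'
    rw [S.low 4 (by norm_num)]
    exact hD j hj hj'
  have hle : ∀ p q, auxEntry n M r (2 ^ k) h p q ≤ 4 * M := by
    intro p q
    rcases Nat.eq_zero_or_pos n with rfl | hn
    · simp [auxEntry, triEntry]
    · refine triEntry_le (fun _ _ => legWeight_le _ _ _ _ _ _) (fun _ _ => legWeight_le _ _ _ _ _ _)
        (fun i j hi' hj => ?_) hn p q
      have := hlink ⟨i, hi'⟩ ⟨j, hj⟩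
      simp only at this; omega
  refine ((run_build (r := r) (pw := 2 ^ k) (K := K) (k := k) hB hDg a0 a1
    ((S.keep 41 (by omega)).trans e41) S.pw ((S.keep 50 (by omega)).trans e50) e51
    ((S.keep 54 (by omega)).trans e54) hk (by omega)).seq
    (T₂ := 30 * τ + 240) (fun g1 ⟨f1, b1, b2⟩ => ?_)).conseq (by omega)
    (fun _ h => h)
  rw [haux _ S.low] at b1
  have c0 : g1.reg 0 = n := (f1.1 0 (by decide)).trans a0
  have c1 : g1.reg 1 = M := (f1.1 1 (by decide)).trans a1
  have c50 : g1.reg 50 = K := (f1.1 50 (by decide)).trans ((S.keep 50 (by omega)).trans e50)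
  have c51 : g1.reg 51 = k := (f1.1 51 (by decide)).trans e51
  have hin : Run B setInput.code g1 30 (fun g' =>
      g' = (g1.setArr 10 (0 * K + k) (3 * n)).setArr 10 (1 * K + k) (4 * M)) := by
    refine Run.conseq (Stmt.run _ ?_) (by decide) (fun _ h => h)
    simp only [setInput, Stmt.wp, Expr.ok_mul, Expr.ok_add, Expr.ok_ofNat, Expr.ok_var,
      Expr.eval_var, Expr.eval_ofNat, Expr.eval_mul, Expr.eval_add, Nat.reduceLeDiff, true_and,
      State.setArr_reg, c0, c1, c50, c51, zero_mul, zero_add, one_mul, and_true]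
    omega
  refine (hin.seq (T₂ := 30 * τ + 200) (fun g3 hg3 => ?_)).conseq (by omega) (fun _ h => h)
  let G' : WGraph (3 * n) (4 * M) := tripartite _ _ _ hle
  obtain ⟨t, s', hex, hout, ht⟩ := hP G'
  have r3 : g3.reg = g1.reg := by rw [hg3]; rfl
  have m3 : ∀ a, a ≠ 10 → g3.arr a = g1.arr a := by
    intro a ha
    rw [hg3, State.setArr_arr, if_neg ha, State.setArr_arr, if_neg ha]
  have m3' : ∀ i k', k' < K → (k' ≠ k ∨ 2 ≤ i) → g3.arr 10 (i * K + k') = g.arr 10 (i * K + k') := by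
    intro i k' hk' hne
    rw [hg3, State.setArr_arr, if_pos rfl, State.setArr_arr, if_pos rfl, Function.update_of_ne,
      Function.update_of_ne, f1.2 10 (by decide)]
    · intro he; have := idx_inj hk' hk he; omega
    · intro he; have := idx_inj hk' hk he; omega
  -- Array `10` plays the registers and array `11` the simulated array `0`. Every cell of the class
  -- that has not just been written is zero by the invariant `cells`.
  have hsim : Sim K k g3 G'.input g3 := by
    refine ⟨fun x => ?_, fun a i => ?_, rfl, fun _ _ => rfl, fun _ _ _ => rfl⟩
    · rcases x with _ | _ | x
      · rw [hg3]
        simp only [State.setArr_arr, reduceIte, update_cell (show 0 < K by omega)]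
        simp [input]
      · rw [hg3]
        simp only [State.setArr_arr, reduceIte, update_cell (show 0 < K by omega)]
        simp [input]
      · rw [m3' _ k hk (Or.inr (by omega)), S.cells 10 le_rfl _ k le_rfl hk]
        simp [input]
    · rw [m3 _ (by omega)]
      by_cases ha : a = 0
      · subst ha
        by_cases hi' : i < 3 * n * (3 * n)
        · obtain ⟨p, q, h1, h2, h3⟩ := input_arr G' i hi'
          rw [h3, zero_add, b1 i hi', show G'.entry p q = auxEntry n M r (2 ^ k) h p q from
            tripartite_entry _ _ _ hle p q, h1, h2]
        · have : G'.input.arr 0 i = 0 := by simp [input, hi']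
          rw [this, b2 _ (fun i' hi'' he => ?_), S.cells 11 (by norm_num) i k le_rfl hk]
          have := (idx_inj hk hk he).1
          omega
      · have : G'.input.arr a i = 0 := by simp [input, ha]
        rw [this, f1.2 _ (by simp; omega), S.cells _ (by omega) i k le_rfl hk]
  refine ((hex.run_sim hB₀ (by omega) hX hk (by rw [r3, c50]) (by rw [r3, c51]) le_rfl g3
    (G'.input_bounded h3 h4) hsim).seq (T₂ := 160) (fun g4 S4 => ?_)).conseq (by omega)
    (fun _ h => h)
  have r4 : ∀ x, x ∉ 55 :: auxRegs → g4.reg x = g.reg x := by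
    intro x hx
    rw [S4.user, r3, f1.1 x hx]
  have l4 : ∀ a < 10, g4.arr a = g.arr a := by
    intro a ha
    rw [S4.low a ha, m3 a (by omega), f1.2 a (by simp; omega)]
  have low4 : ∀ a < 9, g4.arr a = h.arr a := fun a ha => (l4 a (by omega)).trans (S.low a ha)
  have cells4 : ∀ a, 10 ≤ a → ∀ i k', k + 1 ≤ k' → k' < K → g4.arr a (i * K + k') = 0 := by
    intro a ha i k' hk1 hk2
    have hmod : (i * K + k') % K = k' := by
      rw [mul_comm, Nat.mul_add_mod, Nat.mod_eq_of_lt hk2]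
    rw [S4.other _ _ (by omega)]
    by_cases ha0 : a = 10
    · subst ha0
      rw [m3' i k' hk2 (Or.inl (by omega)), S.cells 10 le_rfl i k' (by omega) hk2]
    rw [m3 a ha0]
    by_cases ha' : a = 11
    · subst ha'
      rw [b2 _ (fun i' _ he => ?_), S.cells 11 (by norm_num) i k' (by omega) hk2]
      have := (idx_inj hk2 hk he).2
      omega
    · rw [f1.2 a (by simpa using ha'), S.cells a ha i k' (by omega) hk2]
  have best4 : Best n M r h k g4 := S.best.congr fun x h1 h2 => r4 x (by simp; omega)
  have hcol : Run B collect g4 130 (fun g' => Fr [35, 36, 37, 38, 57, 60, 61, 62, 63] [9] g4 g' ∧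
      Best n M r h (k + 1) g') := by
    have h51 : g4.reg 51 = k := (r4 51 (by decide)).trans e51
    have hlen0 : g4.arr 10 k = s'.reg 0 := by
      have := S4.reg 0; rwa [zero_mul, zero_add] at this
    refine ((Run.asg (x := 57) (e := .get 10 (.var 51))
      (Q := fun g' => g' = g4.setReg 57 (s'.reg 0)) (by simp) (by simp [h51, hlen0])).seq (T₂ := 124)
      (fun g5 hg5 => ?_)).conseq (by decide) (fun _ h => h)
    have f5 : Fr [35, 36, 37, 38, 57, 60, 61, 62, 63] [9] g4 g5 := by
      rw [hg5]; exact (Fr.refl _ _ _).setReg (by decide)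
    have b5 : Best n M r h k g5 := best4.congr fun x h1 h2 => by
      rw [hg5, State.setReg_reg, if_neg (by omega)]
    have m5 : g5.arr = g4.arr := by rw [hg5]; rfl
    have r57 : g5.reg 57 = s'.reg 0 := by rw [hg5]; simp
    refine (Run.ifE (T := 120) (by simp) (fun hc => ?_) (fun hc => ?_)).conseq (by decide)
      (fun _ h => h)
    · rcases tripartite_output _ _ _ hle hout (g5.arr 9) with ⟨h1, -⟩ |
        ⟨a, b, c, h1, ha, hb, hc', s, x, y, h5, h6, h7, h8, h9, h10, hmin⟩
      · rw [State.output, List.map_eq_nil_iff, List.range_eq_nil] at h1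
        exact absurd (r57.trans h1) hc
      · have hcand : Cand n M r (2 ^ k) h s x y := ⟨h5, h6, h7⟩
        have hlen : s'.reg 0 = 3 := by
          have := congrArg List.length h1
          simpa [State.output] using this
        rw [State.output, hlen] at h1
        simp only [List.range_succ, List.range_zero, List.nil_append, List.map_cons,
          List.map_nil, List.cons_append, List.cons.injEq, and_true] at h1
        obtain ⟨o0, o1, o2⟩ := h1
        have A := fun j => S4.arr 1 j
        refine ((run_readTriangle (n := n) (K := K) (k := k) (a := a) (b := b) (c := c) ?_ ?_ ?_ hk
          (by omega) ?_ ?_ ?_).seq (T₂ := 60) (fun g6 ⟨f6, c35, c36, c37⟩ => ?_)).conseq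
          (by norm_num) (fun _ h => h)
        · rw [f5.1 0 (by decide), r4 0 (by decide), a0]
        · rw [f5.1 50 (by decide), S4.user, r3, c50]
        · rw [f5.1 51 (by decide), S4.user, r3, c51]
        · have := A 0; rw [zero_mul, zero_add] at this
          rw [m5]; exact this.trans o0
        · have := A 1; rw [one_mul] at this
          rw [m5]; exact this.trans o1
        · have := A 2; rw [two_mul] at this
          rw [m5]; exact this.trans o2
        · have f6' := f5.trans f6 (List.Subset.refl _) (by decide) (List.Subset.refl _) (by decide)
          have low6 : ∀ a < 9, g6.arr a = h.arr a := fun a ha =>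
            (f6'.2 a (by simp; omega)).trans (low4 a ha)
          refine (run_compareBest (r := r) (k := k) (h₀ := h) hB hD (hlink x y) ?_
            (low6 4 (by norm_num)) (low6 0 (by norm_num)) (c35.trans h8) (c36.trans h9)
            (c37.trans h10) hcand (fun s1 x1 y1 hc1 => ?_) (b5.congr fun z h1 h2 => ?_)).conseq le_rfl
            (fun g' hg' => ⟨f6'.trans hg'.1 (List.Subset.refl _) (by decide) (List.Subset.refl _)
              (by decide), hg'.2⟩)
          · rw [f6'.1 0 (by decide), r4 0 (by decide), a0]
          · have := hmin s1 x1 y1 hc1.1 hc1.2.1 hc1.2.2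
            have := hcand.weight
            have := hc1.weight
            omega
          · exact f6.1 z (by simp; omega)
    · rw [Expr.eval_var, r57] at hc
      intro s1 hs1
      refine ⟨1, s1, g5, .skip s1, by norm_num, hs1, f5, b5.succ_of_forall_not fun s x y hcand => ?_⟩
      rcases tripartite_output _ _ _ hle hout (g5.arr 9) with ⟨h1, h2⟩ | ⟨a, b, c, h1, -⟩
      · exact hcand.2.2 (h2 s x y hcand.1 hcand.2.1)
      · rw [State.output, hc] at h1
        simp at h1
  refine (hcol.seq (T₂ := 10) (fun g5 ⟨f5, best5⟩ => ?_)).conseq (by norm_num) (fun _ h => h)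
  have p5 : g5.reg 56 = 2 ^ k := (f5.1 56 (by decide)).trans ((r4 56 (by decide)).trans S.pw)
  have hv : (Expr.var 56 * 2).eval g5 = 2 ^ (k + 1) := by
    simp [p5, pow_succ]
  refine Run.conseq (Run.asg ?_ ?_) (by decide) (fun _ h => h)
  · simp only [Expr.ok_mul, Expr.ok_var, Expr.ok_ofNat, Expr.eval_var, Expr.eval_ofNat, p5,
      Nat.reduceLeDiff, true_and]
    rw [pow_succ] at hpow
    exact ⟨by omega, hpow⟩
  rw [hv]
  refine ⟨?_, ⟨fun x hx => ?_, fun a ha => ?_, by simp, ?_,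
    best5.congr fun x h1 h2 => ?_⟩⟩
  · rw [State.setReg_reg, if_neg (by norm_num), f5.1 51 (by decide), r4 51 (by decide),
      e51]
  · rw [State.setReg_reg, if_neg (by omega), f5.1 x (by simp; omega), r4 x (by simp; omega),
      S.keep x hx]
  · rw [State.setReg_arr, f5.2 a (by simp; omega), low4 a ha]
  · intro a ha
    rw [State.setReg_arr, f5.2 a (by simp; omega)]
    exact cells4 a ha
  · rw [State.setReg_reg, if_neg (by omega)]

end WordRAM


/-! ### Correctness: auxiliary triangles and minimum cycles -/

namespace WGraph

variable {n M : ℕ}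

/-- A closing edge that belongs to a minimum weight cycle. -/
structure Best (G : WGraph n M) (s u v : Fin n) (D P F : ℕ → ℕ) : Prop where
  tree : ∃ b t, G.PTree b t s D P F
  left : F u ≠ 0
  right : F v ≠ 0
  adj : G.graph.Adj u v
  ne : P v ≠ u
  ne' : P u ≠ v
  min : ∀ (x : Fin n) (c : G.graph.Walk x x), c.IsCycle → D u + D v + G.entry u v ≤ G.walkWeight c

end WGraph

namespace WordRAM

open WGraph

variable {n M : ℕ} {G : WGraph n M}

/-- The labels of `x` and `y` differ in the bit, and neither vertex is the root because their
distances are nonzero. A child of a vertex other than the root inherits its label, so neither is the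
parent of the other. -/
theorem Cand.closing {t r pw : ℕ} {h : State} (hi : Inp G h) (hR : Rows G 1 t h) {s x y : Fin n}
    (hc : Cand n M r pw h s x y) : row h 6 s x ≠ 0 ∧ row h 6 s y ≠ 0 ∧ G.graph.Adj x y ∧
      row h 5 s y ≠ x ∧ row h 5 s x ≠ y ∧
      total n h s x y = row h 4 s x + row h 4 s y + G.entry x y := by
  obtain ⟨h1, h2, h3⟩ := hc
  have l1 := (legWeight_ne_zero_iff _ _ _ _ _ _).1 h1
  have l2 := (legWeight_ne_zero_iff _ _ _ _ _ _).1 h2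
  obtain ⟨T, -⟩ := hR s
  have hF : row h 6 s x ≠ row h 6 s y := by
    intro he
    have e1 := l1.2.2.1
    have e2 := l2.2.2.1
    unfold row at he
    rw [he] at e1
    omega
  have key : ∀ x y : Fin n, row h 6 s x ≠ 0 → row h 4 s x ≠ 0 → row h 4 s y ≠ 0 →
      row h 5 s x = y → row h 6 s x = row h 6 s y := by
    intro x y h1 h2 h3 h4
    have hx : x ≠ s := by rintro rfl; exact h2 T.D_root
    have hy : y ≠ s := by rintro rfl; exact h3 T.D_root
    obtain ⟨u, hu, -, -, -, -, h5⟩ := T.step x h1 hx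
    obtain rfl : u = y := Fin.ext (hu.symm.trans h4)
    rw [h5, if_neg hy]
  rw [links, hi.arr0] at h3
  refine ⟨l1.1, l2.1, (G.entry_ne_zero_iff x y).1 h3, fun he => hF ?_, fun he => hF ?_, ?_⟩
  · exact (key y x l2.1 l2.2.1 l1.2.1 he).symm
  · exact key x y l1.1 l1.2.1 l2.2.1 he
  · rw [total, links, hi.arr0]; rfl

/-- Let `W` be the weight of the cycle. `Cyc.exists_triple` provides `s, x, y`, whose labels differ
in some bit. Both distances lie between `W / 2 - M` and `W / 2`, and `r < W / 2 ≤ r + 1 + M`, so `D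
+ M + 1 - r` is between `1` and `2M + 2 ≤ 4M`: no leg is lost. The bit decides which of `x` and `y`
goes to which side. -/
theorem exists_cand {t r K : ℕ} {h : State} (hi : Inp G h) (hR : Rows G 1 t h) (hn : n < 2 ^ K)
    {v : Fin n} (c : G.graph.Walk v v) (hc : c.IsCycle) (ht : G.walkWeight c ≤ 2 * t + 1)
    (hr : 2 * r < G.walkWeight c) (hr' : G.walkWeight c ≤ 2 * r + 2 + 2 * M) :
    ∃ k < K, ∃ s x y : Fin n, Cand n M r (2 ^ k) h s x y ∧ total n h s x y = G.walkWeight c := by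
  obtain ⟨c', hcyc, hw⟩ := exists_cyc c hc
  obtain ⟨s, x, y, hx, hy, hadj, hT⟩ := hcyc.exists_triple (by rwa [hw])
  obtain ⟨T, hC⟩ := hR s
  obtain ⟨f1, f2, f3, f4, f5, f6⟩ := hT _ _ _ T hC
  rw [hw] at f4 f5 f6
  have hM := G.entry_le x y
  have hM1 := entry_pos hadj
  have hlegs : ∀ pw β (x : Fin n), x ≠ s → row h 6 s x ≠ 0 → row h 6 s x / pw % 2 = β →
      2 * row h 4 s x ≤ G.walkWeight c → G.walkWeight c ≤ 2 * row h 4 s x + 2 * M →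
      legs n M r pw β h s x ≠ 0 := by
    intro pw β x h1 h2 h3 h4 h5
    refine (legWeight_ne_zero_iff _ _ _ _ _ _).2 ⟨h2, ?_, h3, ?_, ?_⟩
    · obtain ⟨u, -, -, ha, hD, -⟩ := T.step x h2 h1
      have := entry_pos ha
      change row h 4 s x ≠ 0
      omega
    · change r < row h 4 s x + M + 1
      omega
    · change row h 4 s x + M + 1 - r ≤ 4 * M
      omega
  have hlt : ∀ x : Fin n, x ≠ s → row h 6 s x < 2 ^ K := fun x hx =>
    ((T.F_ne_zero_le x).2 hx).trans_lt hn
  obtain ⟨k, hk, hbit⟩ := exists_bit_ne (hlt x hx) (hlt y hy) f3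
  have htot : ∀ x y : Fin n, total n h s x y = row h 4 s x + row h 4 s y + G.entry x y :=
    fun x y => by rw [total, links, hi.arr0]; rfl
  have hlink : links n h x y ≠ 0 := by rw [links, hi.arr0]; omega
  have hlink' : links n h y x ≠ 0 := by rw [links, hi.arr0, entry_symm]; omega
  have e1 := entry_symm G x y
  rcases Nat.mod_two_eq_zero_or_one (row h 6 s x / 2 ^ k) with h0 | h0
  · refine ⟨k, hk, s, x, y, ⟨hlegs _ _ x hx f1 h0 f5 (by omega),
      hlegs _ _ y hy f2 (by omega) f6 (by omega), hlink⟩, by rw [htot, f4]⟩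
  · refine ⟨k, hk, s, y, x, ⟨hlegs _ _ y hy f2 (by omega) f6 (by omega),
      hlegs _ _ x hx f1 h0 f5 (by omega), hlink'⟩, by rw [htot]; omega⟩

/-- The parameters after the two binary searches. -/
structure Params (G : WGraph n M) (t r : ℕ) : Prop where
  lt : ∀ (v : Fin n) (c : G.graph.Walk v v), c.IsCycle → 2 * r < G.walkWeight c
  cyc : ∃ (v : Fin n) (c : G.graph.Walk v v), c.IsCycle ∧ G.walkWeight c ≤ 2 * r + 2 + 2 * M
  bad : G.Bad 1 (t + 1)

/-- A cycle heavier than `2r + 2 + 2M` may be invisible in the auxiliary graphs. The cycle from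
`Params.cyc` is lighter, still weighs at most `2t + 1`, and takes its place. -/
theorem Best.le_of_isCycle {t r K : ℕ} {h g : State} (hi : Inp G h) (hR : Rows G 1 t h)
    (hn : n < 2 ^ K) (hp : Params G t r) (hb : Best n M r h K g) {v : Fin n}
    (c : G.graph.Walk v v) (hc : c.IsCycle) (ht : G.walkWeight c ≤ 2 * t + 1) :
    g.reg 60 ≠ 0 ∧ g.reg 60 ≤ G.walkWeight c := by
  by_cases hc' : G.walkWeight c ≤ 2 * r + 2 + 2 * M
  · obtain ⟨k, hk, s, x, y, h1, h2⟩ := exists_cand hi hR hn c hc ht (hp.lt _ c hc) hc'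
    rcases hb with ⟨-, b2⟩ | ⟨k', s1, x1, y1, b1, b2, b3, b4, b5, b6⟩
    · exact absurd h1 (b2 k hk s x y)
    · have := b4.total_ne_zero
      have := b6 k hk s x y h1
      omega
  · obtain ⟨v, c', hc1, hc2⟩ := hp.cyc
    obtain ⟨k, hk, s, x, y, h1, h2⟩ := exists_cand hi hR hn c' hc1 (by omega) (hp.lt _ c' hc1) hc2
    rcases hb with ⟨-, b2⟩ | ⟨k', s1, x1, y1, b1, b2, b3, b4, b5, b6⟩
    · exact absurd h1 (b2 k hk s x y)
    · have := b4.total_ne_zero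
      have := b6 k hk s x y h1
      omega

/-- The best triangle is a minimum weight cycle if it is light. -/
theorem Best.best {t r K : ℕ} {h g : State} (hi : Inp G h) (hR : Rows G 1 t h)
    (hn : n < 2 ^ K) (hp : Params G t r) (hb : Best n M r h K g) (h0 : g.reg 60 ≠ 0)
    (hle : g.reg 60 ≤ 2 * t + 1) : ∃ s x y : Fin n, g.reg 61 = s ∧ g.reg 62 = x ∧ g.reg 63 = y ∧
      G.Best s x y (row h 4 s) (row h 5 s) (row h 6 s) := by
  have key := fun (v : Fin n) (c : G.graph.Walk v v) hc => hb.le_of_isCycle hi hR hn hp c hc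
  rcases hb with ⟨b1, -⟩ | ⟨k', s, x, y, b1, b2, b3, b4, b5, b6⟩
  · exact absurd b1 h0
  · obtain ⟨c1, c2, c3, c4, c5, c6⟩ := b4.closing hi hR
    refine ⟨s, x, y, b1, b2, b3, ⟨⟨1, t, (hR s).1⟩, c1, c2, c3, c4, c5, fun v c hc => ?_⟩⟩
    rw [← c6, ← b5]
    -- Heavier cycles cannot beat a triangle whose total is at most `2 * t + 1`.
    by_cases hcw : G.walkWeight c ≤ 2 * t + 1
    · exact (key v c hc hcw).2
    · omega

/-- If no triangle is light, then an exploration with the next parameter finds a minimum weight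
cycle. -/
theorem Stopped.best {t r K : ℕ} {h g g' : State} (hi : Inp G h) (hR : Rows G 1 t h)
    (hn : n < 2 ^ K) (hp : Params G t r) (hb : Best n M r h K g)
    (hle : g.reg 60 = 0 ∨ 2 * t + 1 < g.reg 60) (hS : Stopped G 1 (t + 1) g') :
    ∃ s u v : Fin n, g'.reg 12 = s ∧ g'.reg 20 = u ∧ g'.reg 21 = v ∧
      G.Best s u v (row g' 4 s) (row g' 5 s) (row g' 6 s) := by
  obtain ⟨s, h12, T, -, u, v, h20, h21, hC⟩ := hS
  refine ⟨s, u, v, h12, h20, h21, ⟨⟨1, t + 1, T⟩, hC.left, hC.right, hC.adj, hC.ne, hC.ne',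
    fun x c hc => ?_⟩⟩
  have h1 := hC.le
  have h2 : row g' 4 s v ≤ t + 1 := by
    by_cases hvs : v = s
    · rw [hvs, T.D_root]; omega
    · obtain ⟨y, -, -, -, hD, hle, -⟩ := T.step v hC.right hvs
      omega
  -- A cycle of weight at most `2t + 1` would have produced a light triangle. So all cycles weigh at
  -- least `2 * (t + 1)`, which bounds the weight that the closing edge yields from above.
  have h3 : 2 * t + 1 < G.walkWeight c := by
    by_contra! h'
    have := hb.le_of_isCycle hi hR hn hp c hc h'
    omega
  omega

/-! ### All rounds -/

/-- Compute the number of bits of `n`. -/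
def computeBits : Prog :=
  .seq (Stmt.seq (.asg 50 0) (.asg 56 1)).code <|
  whileE (.lt (.var 56) (.var 0 + 1)) (Stmt.seq (.asg 56 (.var 56 * 2)) (.asg 50 (.var 50 + 1))).code

/-- The crude potential `n + 1 - 2 ^ k` gives only linear time, which is negligible here. -/
theorem run_computeBits {B : ℕ} {h : State} (hB : 2 * n + 50 < B) (e0 : h.reg 0 = n) :
    Run B computeBits h (30 * n + 40) (fun g => Fr [50, 56] [] h g ∧ ∃ K, g.reg 50 = K ∧
      n < 2 ^ K ∧ K ≤ Nat.log 2 n + 1 ∧ 2 ^ K ≤ 2 * n + 1) := by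
  let I : State → Prop := fun g => Fr [50, 56] [] h g ∧ g.reg 56 = 2 ^ g.reg 50 ∧
    (g.reg 50 = 0 ∨ 2 ^ (g.reg 50 - 1) ≤ n)
  have h1 : Run B (Stmt.seq (.asg 50 0) (.asg 56 1)).code h 10
      (fun g => I g ∧ g.reg 56 = 1) := by
    refine Run.conseq (Stmt.run _ ?_) (by decide) (fun _ h => h)
    simp only [Stmt.wp, Expr.ok_ofNat, Expr.eval_ofNat]
    exact ⟨by omega, by omega, ⟨((Fr.refl _ _ _).setReg (by decide)).setReg (by decide),
      by simp, by simp⟩, by simp⟩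
  have hpow : ∀ g, I g → g.reg 56 ≤ 2 * n + 1 := by
    rintro g ⟨-, g2, g3⟩
    rcases g3 with g3 | g3
    · rw [g2, g3]; omega
    · rw [g2]
      by_cases hz : g.reg 50 = 0
      · rw [hz]; omega
      · rw [show g.reg 50 = g.reg 50 - 1 + 1 by omega, pow_succ]; omega
  refine (h1.seq (T₂ := 30 * n + 30) (fun g1 ⟨i1, r1⟩ => ?_)).conseq (by omega) (fun _ h => h)
  have hcost : (Expr.lt (.var 56) (.var 0 + 1)).cost = 5 := rfl
  refine (Run.whileE I (fun g => (n + 1 - g.reg 56) * 20) 10 i1 ?_ ?_ ?_).conseq ?_ (fun _ h => h)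
  · intro g hg
    simp only [Expr.ok_lt, Expr.ok_add, Expr.ok_ofNat, Expr.ok_var, Expr.eval_var, Expr.eval_ofNat,
      Nat.reduceLeDiff, true_and, (hg.1.1 0 (by decide)).trans e0]
    omega
  · intro g hg hc
    have hp := hpow g hg
    obtain ⟨f, g2, g3⟩ := hg
    have g0 := (f.1 0 (by decide)).trans e0
    have hle : g.reg 56 ≤ n := by
      by_contra! h'
      have : ¬ g.reg 56 < n + 1 := by omega
      simp [g0, this] at hc
    have h2 : g.reg 50 < 2 ^ g.reg 50 := Nat.lt_two_pow_self
    refine Run.conseq (Stmt.run _ ?_) (by decide) (fun _ h => h)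
    simp only [Stmt.wp, Expr.ok_mul, Expr.ok_add, Expr.ok_ofNat, Expr.ok_var, Expr.eval_var,
      Expr.eval_ofNat, Expr.eval_mul, Expr.eval_add, Nat.reduceLeDiff, true_and, State.setReg_reg,
      reduceIte, Nat.reduceEqDiff, hcost]
    have hpos : 0 < 2 ^ g.reg 50 := by positivity
    refine ⟨by omega, by omega, ⟨(f.setReg (by decide)).setReg (by decide), ?_, Or.inr ?_⟩, by omega⟩
    · simp [g2, pow_succ]
    · simp [← g2, hle]
  · rintro g hg hc
    have hp := hpow g hg
    obtain ⟨f, g2, g3⟩ := hg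
    have g0 := (f.1 0 (by decide)).trans e0
    have hlt : n < g.reg 56 := by
      by_contra! h'
      have : g.reg 56 < n + 1 := by omega
      simp [g0, this] at hc
    refine ⟨f, _, rfl, by rwa [← g2], ?_, by rwa [← g2]⟩
    rcases g3 with g3 | g3
    · omega
    · have hn : n ≠ 0 := by
        rintro rfl
        have : 0 < 2 ^ (g.reg 50 - 1) := by positivity
        omega
      have := (Nat.le_log_iff_pow_le (by norm_num) hn).2 g3
      omega
  · rw [r1, hcost]; omega

/-- Find the best triangle in all auxiliary graphs. -/
def allRounds (P : Prog) : Prog :=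
  .seq computeBits <|
  .seq (Stmt.seq (.asg 56 1) <| .seq (.asg 54 (3 * .var 0 * (3 * .var 0))) (.asg 60 0)).code <|
  forE 51 (.var 50) (round P)

/-- There are at most `Nat.log 2 n + 1` rounds. For the word bounds the cruder estimate of their
number by `n + 1` suffices. -/
theorem run_allRounds {B B₀ r τ : ℕ} {P : Prog} (G : WGraph n M) {h : State}
    (hB : n * n + 4 * (n * M) + 10 * n + 10 * M + 50 < B) (hi : Inp G h)
    (hBK : (3 * n * (3 * n) + 3) * (n + 1) + 2 < B) (hB₀ : B₀ * (n + 1) ≤ B)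
    (hX : P.regBound * (n + 1) ≤ B) (h3 : 3 * n < B₀)
    (h4 : 4 * M < B₀)
    (hP : ∀ G' : WGraph (3 * n) (4 * M), ∃ t s, Exec B₀ P G'.input t s ∧
      MinTriangleOutput G' s.output ∧ t ≤ τ)
    (hD : DistLe n (n * M + M) h) (e41 : h.reg 41 = r)
    (hcells : ∀ a i, 10 ≤ a → h.arr a i = 0) :
    Run B (allRounds P) h ((Nat.log 2 n + 1) * (3 * n * (3 * n) * 160 + 30 * τ + 260) +
      30 * n + 100) (fun g =>
      (∀ x, x ≤ 22 ∨ (39 ≤ x ∧ x ≤ 49) → g.reg x = h.reg x) ∧ (∀ a < 9, g.arr a = h.arr a) ∧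
      ∃ K, n < 2 ^ K ∧ Best n M r h K g) := by
  refine ((run_computeBits (B := B) (n := n) (h := h) (by omega) hi.reg0).seq
    (T₂ := (Nat.log 2 n + 1) * (3 * n * (3 * n) * 160 + 30 * τ + 260) + 50)
    (fun g1 ⟨f1, K, k50, hK1, hK2, hK3⟩ => ?_)).conseq (by omega) (fun _ h => h)
  have hKn : K ≤ n + 1 := hK2.trans (by have := Nat.log_le_self 2 n; omega)
  have hBK' : 3 * n * (3 * n) * K + 3 * K + 2 < B := by
    have := Nat.mul_le_mul_left (3 * n * (3 * n) + 3) hKn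
    rw [Nat.add_mul _ _ K] at this; omega
  have hB₀' : B₀ * K ≤ B := (Nat.mul_le_mul_left _ hKn).trans hB₀
  have hX' : P.regBound * K ≤ B := (Nat.mul_le_mul_left _ hKn).trans hX
  have h9 : 3 * n * (3 * n) + 2 < B := by
    have : 3 * n * (3 * n) + 3 ≤ (3 * n * (3 * n) + 3) * (n + 1) :=
      Nat.le_mul_of_pos_right _ (by omega)
    omega
  have h2 : Run B (Stmt.seq (.asg 56 1) <| .seq (.asg 54 (3 * .var 0 * (3 * .var 0)))
      (.asg 60 0)).code g1 20 (fun g => Fr [50, 54, 56, 60] [] h g ∧ g.reg 50 = K ∧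
      g.reg 54 = 3 * n * (3 * n) ∧ g.reg 56 = 1 ∧ g.reg 60 = 0) := by
    refine Run.conseq (Stmt.run _ ?_) (by decide) (fun _ h => h)
    simp only [Stmt.wp, Expr.ok_mul, Expr.ok_ofNat, Expr.ok_var, Expr.eval_var,
      Expr.eval_ofNat, Expr.eval_mul, Nat.reduceLeDiff, true_and, and_true, State.setReg_reg,
      reduceIte, Nat.reduceEqDiff, (f1.1 0 (by decide)).trans hi.reg0]
    refine ⟨by omega, ⟨by omega, by omega, by omega⟩, by omega, ?_, k50⟩
    exact (((f1.mono (by decide) (List.Subset.refl _)).setReg (by decide)).setReg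
      (by decide)).setReg (by decide)
  refine (h2.seq (T₂ := (Nat.log 2 n + 1) * (3 * n * (3 * n) * 160 + 30 * τ + 260) +
    20) (fun g2 ⟨f2, c50, c54, c56, c60⟩ => ?_)).conseq (by omega) (fun _ h => h)
  have hi2 : Inp G g2 := hi.frame f2 (by decide) (by decide) (by decide)
  have m2 : g2.arr = h.arr := funext fun a => f2.2 a (by simp)
  have hD2 : DistLe n (n * M + M) g2 := by
    intro j; rw [m2]; exact hD j
  have hbest : ∀ g, Best n M r g2 K g → Best n M r h K g := by
    intro g hb
    simpa only [Best, Cand, total, legs, links, m2] using hb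
  refine (Run.forE (N := K) (fun k g => RoundState n M r K g2 k g)
    (3 * n * (3 * n) * 160 + 30 * τ + 250) (by norm_num) (by omega)
    ?_ ?_ ?_ ?_).conseq ?_ (fun _ h => h)
  · have : RoundState n M r K g2 0 g2 := by
      refine ⟨fun _ _ => rfl, fun _ _ => rfl, by simpa using c56, fun a ha i k' _ _ => ?_,
        Or.inl ⟨c60, fun k' hk' => absurd hk' (by omega)⟩⟩
      rw [m2, hcells a _ ha]
    exact this.setReg51 0
  · rintro k g - S -
    simpa using (S.keep 50 (by omega)).trans c50
  · intro k g hk S e51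
    refine (run_round G (h := g2) hB hi2 hBK' hB₀' hX' h3 h4 ?_ hP hD2
      ((f2.1 41 (by decide)).trans e41) c50 c54 hk S e51).conseq le_rfl
      (fun g' hg' => ⟨hg'.1, hg'.2.setReg51 _⟩)
    have := Nat.pow_le_pow_right (show 0 < 2 by norm_num) (Nat.succ_le_of_lt hk)
    simp only [Nat.succ_eq_add_one] at this
    omega
  · intro g hg _
    refine ⟨fun x hx => ?_, fun a ha => ?_, K, hK1, hbest _ hg.best⟩
    · rw [hg.keep x (by omega), f2.1 x (by simp; omega)]
    · rw [hg.low a ha, m2]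
  · rw [show (Expr.var 50).cost = 1 from rfl]
    generalize 3 * n * (3 * n) * 160 + 30 * τ = Y
    have h1 := Nat.mul_le_mul_right (Y + 260) hK2
    have h2 := Nat.zero_le K
    linarith

end WordRAM


namespace WGraph

variable {n M : ℕ} {G : WGraph n M}

theorem IsUp.getVert {P : ℕ → ℕ} {u v : Fin n} {p : G.graph.Walk u v} (h : IsUp P p) :
    ∀ i < p.length, P (p.getVert i) = p.getVert (i + 1) := by
  induction p with
  | nil => simp
  | cons ha p ih =>
    intro i hi
    rcases i with _ | i
    · simpa using h.1
    · simpa using ih h.2 i (by simpa using hi)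

end WGraph

namespace WordRAM

open WGraph

variable {n M : ℕ} {G : WGraph n M}

/-! ### Writing the cycle -/

/-- The parent of the vertex in register `71` in the tree with the root in register `12`. -/
def parent : Expr := .get 5 (.var 12 * .var 0 + .var 71)

/-- Write the path from the vertex in register `20` to the root. -/
def writeUp : Prog :=
  .seq (Stmt.seq (.asg 71 (.var 20)) (.asg 70 0)).code <|
  whileE (.lt (.var 71) (.var 0)) (Stmt.seq (.put 1 (.var 70) (.var 71)) <|
    .seq (.asg 70 (.var 70 + 1)) (.asg 71 parent)).code

/-- Compute the length of the path from the vertex in register `21` to the root. -/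
def countUp : Prog :=
  .seq (Stmt.seq (.asg 71 (.var 21)) (.asg 72 0)).code <|
  whileE (.lt parent (.var 0)) (Stmt.seq (.asg 72 (.var 72 + 1)) (.asg 71 parent)).code

/-- Write the path from the root to the vertex in register `21`, without the root. -/
def writeDown : Prog :=
  .seq (Stmt.seq (.asg 70 (.var 70 + .var 72)) <| .seq (.asg 71 (.var 21)) (.asg 73 (.var 70))).code <|
  .seq (whileE (.lt parent (.var 0)) (Stmt.seq (.asg 73 (.var 73 - 1)) <|
    .seq (.put 1 (.var 73) (.var 71)) (.asg 71 parent)).code) <|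
  asg 0 (.var 70)

section

variable {B : ℕ} {s u v : Fin n} {p : G.graph.Walk u s} {q : G.graph.Walk v s} {h : State}

/-- The parent entry of the root is `n`, so the loop ends just after the root has been written. -/
theorem run_writeUp (hB : n * n + 4 * (n * M) + 10 * n + 10 * M + 50 < B) (e0 : h.reg 0 = n)
    (e12 : h.reg 12 = s) (e20 : h.reg 20 = u) (hp : IsUp (row h 5 s) p) (hs : row h 5 s s = n)
    (hl : p.length < n) :
    Run B writeUp h (30 * n + 60) (fun g => Fr [70, 71] [1] h g ∧ g.reg 70 = p.length + 1 ∧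
      ∀ i ≤ p.length, g.arr 1 i = p.getVert i) := by
  let I : State → Prop := fun g => Fr [70, 71] [1] h g ∧
    (g.reg 70 ≤ p.length ∧ g.reg 71 = p.getVert (g.reg 70) ∨ g.reg 70 = p.length + 1 ∧ g.reg 71 = n) ∧
    ∀ i < g.reg 70, g.arr 1 i = p.getVert i
  have h1 : Run B (Stmt.seq (.asg 71 (.var 20)) (.asg 70 0)).code h 10
      (fun g => I g ∧ g.reg 70 = 0) := by
    refine Run.conseq (Stmt.run _ ?_) (by decide) (fun _ h => h)
    simp only [Stmt.wp, Expr.ok_ofNat, Expr.eval_ofNat, Expr.ok_var, Expr.eval_var,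
      Nat.reduceLeDiff, true_and]
    exact ⟨by omega, ⟨((Fr.refl _ _ _).setReg (by decide)).setReg (by decide),
      Or.inl ⟨by simp, by simp [e20]⟩, by simp⟩, by simp⟩
  refine (h1.seq (T₂ := 30 * n + 50) (fun g1 ⟨i1, r1⟩ => ?_)).conseq (by omega) (fun _ h => h)
  have hcost : (Expr.lt (.var 71) (.var 0)).cost = 3 := rfl
  have hcost' : parent.cost = 6 := rfl
  refine (Run.whileE I (fun g => (p.length + 1 - g.reg 70) * 30) 20 i1 ?_ ?_ ?_).conseq ?_
    (fun _ h => h)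
  · intro g hg; simp; omega
  · rintro g ⟨f, h2, h3⟩ hc
    have g0 := (f.1 0 (by decide)).trans e0
    have g12 := (f.1 12 (by decide)).trans e12
    rcases h2 with ⟨h2, h4⟩ | ⟨h2, h4⟩
    swap
    · simp [g0, h4] at hc
    have hlt := idx_lt s.2 (p.getVert (g.reg 70)).2
    have hpar : h.arr 5 (s * n + p.getVert (g.reg 70)) = row h 5 s (p.getVert (g.reg 70)) := rfl
    refine Run.conseq (Stmt.run _ ?_) (by decide) (fun _ h => h)
    simp only [Stmt.wp, parent, Expr.ok_get, Expr.eval_get, Expr.ok_mul, Expr.ok_add, Expr.ok_ofNat,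
      Expr.ok_var, Expr.eval_var,
      Expr.eval_ofNat, Expr.eval_mul, Expr.eval_add, Nat.reduceLeDiff, true_and, State.setReg_reg,
      reduceIte, Nat.reduceEqDiff, hcost, State.setArr_reg, g0, g12, h4, State.setReg_arr,
      State.setArr_arr, f.2 5 (by decide), hpar]
    refine ⟨by omega, by omega, ⟨((f.setArr (by decide)).setReg (by decide)).setReg (by decide),
      ?_, ?_⟩, by omega⟩
    · by_cases hk : g.reg 70 < p.length
      · left
        simp only [State.setReg_reg, reduceIte, Nat.reduceEqDiff, hp.getVert _ hk, and_true]
        omega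
      · right
        have : g.reg 70 = p.length := by omega
        simp [this, hs]
    · intro i hi
      simp only [State.setReg_reg, reduceIte, Nat.reduceEqDiff] at hi
      simp only [State.setReg_arr, State.setArr_arr, reduceIte]
      by_cases hik : i = g.reg 70
      · subst hik; simp
      · rw [Function.update_of_ne hik]; exact h3 i (by omega)
  · rintro g ⟨f, h2, h3⟩ hc
    have g0 := (f.1 0 (by decide)).trans e0
    rcases h2 with ⟨h2, h4⟩ | ⟨h2, h4⟩
    · simp [g0, h4] at hc
    · exact ⟨f, h2, fun i hi => h3 i (by omega)⟩
  · rw [r1, hcost]; omega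

/-- The loop tests the parent of the current vertex rather than the vertex, so the root is not
counted. -/
theorem run_countUp (hB : n * n + 4 * (n * M) + 10 * n + 10 * M + 50 < B) (e0 : h.reg 0 = n)
    (e12 : h.reg 12 = s) (e21 : h.reg 21 = v) (hq : IsUp (row h 5 s) q) (hs : row h 5 s s = n)
    (hl : q.length < n) :
    Run B countUp h (30 * n + 60) (fun g => Fr [71, 72] [] h g ∧ g.reg 72 = q.length) := by
  let I : State → Prop := fun g => Fr [71, 72] [] h g ∧ g.reg 72 ≤ q.length ∧
    g.reg 71 = q.getVert (g.reg 72)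
  have h1 : Run B (Stmt.seq (.asg 71 (.var 21)) (.asg 72 0)).code h 10
      (fun g => I g ∧ g.reg 72 = 0) := by
    refine Run.conseq (Stmt.run _ ?_) (by decide) (fun _ h => h)
    simp only [Stmt.wp, Expr.ok_ofNat, Expr.eval_ofNat, Expr.ok_var, Expr.eval_var,
      Nat.reduceLeDiff, true_and]
    exact ⟨by omega, ⟨((Fr.refl _ _ _).setReg (by decide)).setReg (by decide), by simp,
      by simp [e21]⟩, by simp⟩
  refine (h1.seq (T₂ := 30 * n + 50) (fun g1 ⟨i1, r1⟩ => ?_)).conseq (by omega) (fun _ h => h)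
  have hcost : (Expr.lt parent (.var 0)).cost = 8 := rfl
  have key : ∀ g, I g → g.reg 0 = n ∧ g.reg 12 = s ∧
      h.arr 5 (s * n + q.getVert (g.reg 72)) = row h 5 s (q.getVert (g.reg 72)) ∧
      (s : ℕ) * n + q.getVert (g.reg 72) < n * n := fun g hg =>
    ⟨(hg.1.1 0 (by decide)).trans e0, (hg.1.1 12 (by decide)).trans e12, rfl, idx_lt s.2 (Fin.is_lt _)⟩
  refine (Run.whileE I (fun g => (q.length - g.reg 72) * 30) 20 i1 ?_ ?_ ?_).conseq ?_
    (fun _ h => h)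
  · intro g hg
    obtain ⟨k0, k1, k2, k3⟩ := key g hg
    simp only [parent, Expr.ok_lt, Expr.ok_get, Expr.ok_mul, Expr.ok_add, Expr.ok_var, Expr.eval_var,
      Expr.eval_mul, k0, k1, hg.2.2, Nat.reduceLeDiff, true_and]
    omega
  · rintro g hg hc
    obtain ⟨k0, k1, k2, k3⟩ := key g hg
    obtain ⟨f, h2, h3⟩ := hg
    have hlt : g.reg 72 < q.length := by
      by_contra! h'
      have : g.reg 72 = q.length := by omega
      rw [this, SimpleGraph.Walk.getVert_length] at k2 h3
      simp [parent, k0, k1, h3, f.2 5 (by simp), k2, hs] at hc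
    refine Run.conseq (Stmt.run _ ?_) (by decide) (fun _ h => h)
    simp only [Stmt.wp, parent, Expr.ok_get, Expr.eval_get, Expr.ok_mul, Expr.ok_add, Expr.ok_ofNat,
      Expr.ok_var, Expr.eval_var, Expr.eval_ofNat, Expr.eval_mul, Expr.eval_add, Nat.reduceLeDiff,
      true_and, State.setReg_reg, reduceIte, Nat.reduceEqDiff, State.setReg_arr, k0, k1, h3,
      f.2 5 (by simp), k2]
    refine ⟨by omega, by omega, ⟨(f.setReg (by decide)).setReg (by decide), by simp; omega, ?_⟩, ?_⟩
    · simp only [State.setReg_reg, reduceIte, Nat.reduceEqDiff]; exact hq.getVert _ hlt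
    · change (q.length - (g.reg 72 + 1)) * 30 + (20 + 8 + 1) ≤ _
      omega
  · rintro g hg hc
    obtain ⟨k0, k1, k2, k3⟩ := key g hg
    obtain ⟨f, h2, h3⟩ := hg
    refine ⟨f, le_antisymm h2 ?_⟩
    by_contra! hlt
    have := hq.getVert _ hlt
    simp [parent, k0, k1, h3, f.2 5 (by simp), k2, this] at hc
  · rw [r1, hcost]; omega

/-- The second path is needed downwards but parents lead upwards. It is therefore written from the
back, for which its length had to be counted first. -/
theorem run_writeDown (hB : n * n + 4 * (n * M) + 10 * n + 10 * M + 50 < B) (e0 : h.reg 0 = n)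
    (e12 : h.reg 12 = s) (e21 : h.reg 21 = v) (hq : IsUp (row h 5 s) q) (hs : row h 5 s s = n)
    {a : ℕ} (hl : a + q.length ≤ n) (e70 : h.reg 70 = a) (e72 : h.reg 72 = q.length) :
    Run B writeDown h (40 * n + 80) (fun g => g.reg 0 = a + q.length ∧
      (∀ i < a, g.arr 1 i = h.arr 1 i) ∧
      ∀ i < q.length, g.arr 1 (a + q.length - 1 - i) = q.getVert i) := by
  let I : State → Prop := fun g => Fr [70, 71, 73] [1] h g ∧ g.reg 70 = a + q.length ∧
    ∃ k ≤ q.length, g.reg 73 + k = a + q.length ∧ g.reg 71 = q.getVert k ∧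
      (∀ i < a, g.arr 1 i = h.arr 1 i) ∧
      ∀ i < k, g.arr 1 (a + q.length - 1 - i) = q.getVert i
  have h1 : Run B (Stmt.seq (.asg 70 (.var 70 + .var 72)) <| .seq (.asg 71 (.var 21))
      (.asg 73 (.var 70))).code h 20 (fun g => I g ∧ g.reg 73 = a + q.length) := by
    refine Run.conseq (Stmt.run _ ?_) (by decide) (fun _ h => h)
    simp only [Stmt.wp, Expr.ok_add, Expr.eval_add, Expr.ok_var, Expr.eval_var,
      Nat.reduceLeDiff, true_and, e70, e72, State.setReg_reg, reduceIte, Nat.reduceEqDiff, and_true]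
    exact ⟨by omega, (((Fr.refl _ _ _).setReg (by decide)).setReg (by decide)).setReg (by decide),
      by simp, 0, by simp, by simp, by simp [e21], by simp, by simp⟩
  refine (h1.seq (T₂ := 40 * n + 60) (fun g1 ⟨i1, r1⟩ => ?_)).conseq (by omega) (fun _ h => h)
  have hcost : (Expr.lt parent (.var 0)).cost = 8 := rfl
  have key : ∀ g, I g → g.reg 0 = n ∧ g.reg 12 = s := fun g hg =>
    ⟨(hg.1.1 0 (by decide)).trans e0, (hg.1.1 12 (by decide)).trans e12⟩
  have key' : ∀ k, h.arr 5 (s * n + q.getVert k) = row h 5 s (q.getVert k) ∧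
      (s : ℕ) * n + q.getVert k < n * n := fun k => ⟨rfl, idx_lt s.2 (Fin.is_lt _)⟩
  refine ((Run.whileE I (fun g => (g.reg 73 - a) * 40) 25 i1 ?_ ?_ ?_
    (Q := fun g => g.reg 70 = a + q.length ∧ (∀ i < a, g.arr 1 i = h.arr 1 i) ∧
      ∀ i < q.length, g.arr 1 (a + q.length - 1 - i) = q.getVert i)).seq (T₂ := 10)
      (fun g hg => ?_)).conseq ?_ (fun _ h => h)
  · intro g hg
    obtain ⟨k0, k1⟩ := key g hg
    obtain ⟨-, -, k, -, -, h2, -⟩ := hg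
    have := (key' k).2
    simp only [parent, Expr.ok_lt, Expr.ok_get, Expr.ok_mul, Expr.ok_add, Expr.ok_var, Expr.eval_var,
      Expr.eval_mul, k0, k1, h2, Nat.reduceLeDiff, true_and]
    omega
  · rintro g hg hc
    obtain ⟨k0, k1⟩ := key g hg
    obtain ⟨f, hr, k, h2, h3, h4, h5, h6⟩ := hg
    obtain ⟨k2, k3⟩ := key' k
    have hlt : k < q.length := by
      by_contra! h'
      obtain rfl : k = q.length := by omega
      rw [SimpleGraph.Walk.getVert_length] at k2 h4
      simp [parent, k0, k1, h4, f.2 5 (by simp), k2, hs] at hc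
    have hidx : g.reg 73 - 1 = a + q.length - 1 - k := by omega
    refine Run.conseq (Stmt.run _ ?_) (by decide) (fun _ h => h)
    simp only [Stmt.wp, parent, Expr.ok_get, Expr.eval_get, Expr.ok_mul, Expr.ok_add, Expr.ok_ofNat,
      Expr.ok_var, Expr.eval_var, Expr.eval_ofNat, Expr.eval_mul, Expr.eval_add, Nat.reduceLeDiff,
      Expr.ok_sub, Expr.eval_sub, State.setArr_reg, State.setArr_arr,
      true_and, State.setReg_reg, reduceIte, Nat.reduceEqDiff, State.setReg_arr, k0, k1, h4,
      f.2 5 (by simp), k2]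
    refine ⟨by omega, by omega, ⟨((f.setReg (by decide)).setArr (by decide)).setReg (by decide),
      by simpa using hr, k + 1, hlt, by simp; omega, ?_, fun i hi => ?_, fun i hi => ?_⟩, ?_⟩
    · simp only [State.setReg_reg, reduceIte]; exact hq.getVert _ hlt
    · simp only [State.setReg_arr, State.setArr_arr, reduceIte]
      rw [Function.update_of_ne (by omega), h5 i hi]
    · simp only [State.setReg_arr, State.setArr_arr, reduceIte]
      by_cases hik : i = k
      · subst hik; rw [← hidx, Function.update_self]
      · rw [Function.update_of_ne (by omega), h6 i (by omega)]
    · change (g.reg 73 - 1 - a) * 40 + (25 + 8 + 1) ≤ _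
      omega
  · rintro g hg hc
    obtain ⟨k0, k1⟩ := key g hg
    obtain ⟨f, hr, k, h2, h3, h4, h5, h6⟩ := hg
    obtain ⟨k2, k3⟩ := key' k
    have hk : k = q.length := by
      refine le_antisymm h2 ?_
      by_contra! hlt
      have := hq.getVert _ hlt
      simp [parent, k0, k1, h4, f.2 5 (by simp), k2, this] at hc
    subst hk
    exact ⟨hr, h5, h6⟩
  · refine Run.conseq (Run.asg (by simp) ?_) (by decide) (fun _ h => h)
    simpa using hg
  · rw [r1, hcost]; omega

end

/-- Write the cycle that is given by the registers `12`, `20` and `21`. -/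
def writeCycle : Prog := .seq writeUp (.seq countUp writeDown)

/-- Minimality forces equality in `PTree.exists_cycle`. Hence the two tree paths meet only in the
root, and concatenating them with no shortcuts lists a minimum cycle. -/
theorem run_writeCycle {B : ℕ} {s u v : Fin n} {h : State}
    (hB : n * n + 4 * (n * M) + 10 * n + 10 * M + 50 < B) (e0 : h.reg 0 = n)
    (e12 : h.reg 12 = s) (e20 : h.reg 20 = u) (e21 : h.reg 21 = v)
    (hb : G.Best s u v (row h 4 s) (row h 5 s) (row h 6 s)) :
    Run B writeCycle h (100 * n + 200) (fun g => MinCycleOutput G g.output) := by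
  obtain ⟨b, t, T⟩ := hb.tree
  obtain ⟨p, q, c, hp, hq, hc, hw, heq⟩ := T.exists_cycle hb.left hb.right hb.adj hb.ne hb.ne'
  obtain ⟨hsup, hlen⟩ := heq (le_antisymm hw (hb.min _ c hc))
  have hmin : G.IsMinCycle c := ⟨hc, fun x d hd => hw.trans (hb.min x d hd)⟩
  have hs := T.P_root
  refine ((run_writeUp hB e0 e12 e20 hp hs (by omega)).seq (T₂ := 70 * n + 140)
    (fun g1 ⟨f1, a70, a1⟩ => ?_)).conseq (by omega) (fun _ h => h)
  have hrow : row g1 5 s = row h 5 s := by unfold row; rw [f1.2 5 (by decide)]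
  refine ((run_countUp (q := q) hB ((f1.1 0 (by decide)).trans e0) ((f1.1 12 (by decide)).trans e12)
    ((f1.1 21 (by decide)).trans e21) (by rwa [hrow]) (by rwa [hrow]) (by omega)).seq
    (T₂ := 40 * n + 80) (fun g2 ⟨f2, b72⟩ => ?_)).conseq (by omega) (fun _ h => h)
  have hrow2 : row g2 5 s = row h 5 s := by unfold row; rw [f2.2 5 (by decide), f1.2 5 (by decide)]
  refine (run_writeDown (q := q) (a := p.length + 1) hB
    ((f2.1 0 (by decide)).trans ((f1.1 0 (by decide)).trans e0))
    ((f2.1 12 (by decide)).trans ((f1.1 12 (by decide)).trans e12))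
    ((f2.1 21 (by decide)).trans ((f1.1 21 (by decide)).trans e21)) (by rwa [hrow2])
    (by rwa [hrow2]) (by omega) ((f2.1 70 (by decide)).trans a70) b72).conseq (by omega)
    (fun g ⟨c0, c1, c2⟩ => Or.inr ⟨v, c, hmin, ?_⟩)
  rw [hsup]
  refine List.ext_getElem ?_ (fun i hi hi' => ?_)
  · simp [State.output, c0]
  · have hi2 : i < p.length + 1 + q.length := by
      rw [← c0]; simpa [State.output] using hi
    have hlhs : g.output[i] = g.arr 1 i := by simp [State.output]
    rw [hlhs, List.getElem_map]
    by_cases hip : i < p.length + 1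
    · rw [List.getElem_append_left (by simpa using hip), SimpleGraph.Walk.support_getElem_eq_getVert,
        c1 i hip, f2.2 1 (by decide), a1 i (by omega)]
    · rw [List.getElem_append_right (by simp; omega)]
      simp only [List.getElem_tail, List.getElem_reverse, SimpleGraph.Walk.length_support,
        SimpleGraph.Walk.support_getElem_eq_getVert]
      have := c2 (p.length + 1 + q.length - 1 - i) (by omega)
      rw [show p.length + 1 + q.length - 1 - (p.length + 1 + q.length - 1 - i) = i by omega] at this
      rw [this]
      congr 2
      omega

end WordRAM


/-! ### Assembling the cycle algorithm -/

namespace WordRAM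

open WGraph

variable {n M : ℕ}

/-- Explore again with the next parameter. -/
def retest : Prog := .seq (asg 11 (.var 40 + 1)) test

/-- Choose between the best triangle and a closing edge for the next parameter. -/
def choose : Prog :=
  ifE (.var 60) (ifE (.lt (.var 60) (2 * .var 40 + 2))
    (Stmt.seq (.asg 12 (.var 61)) <| .seq (.asg 20 (.var 62)) (.asg 21 (.var 63))).code retest) retest

/-- A triangle of total at most `2t + 1` is optimal. Otherwise the exploration is repeated at `t +
1`; it has to stop with a closing edge since that threshold is bad. -/
theorem run_choose {B t r K : ℕ} (G : WGraph n M) (L : Fin n → List (Fin n)) {h g : State}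
    (hB : n * n + 4 * (n * M) + 10 * n + 10 * M + 50 < B) (ht : t < n * M) (hi : Inp G h)
    (hig : Inp G g) (hL : Lists G L g) (e10 : g.reg 10 = 1) (e40 : g.reg 40 = t)
    (hR : Rows G 1 t h) (harr : ∀ a < 9, g.arr a = h.arr a) (hn : n < 2 ^ K) (hp : Params G t r)
    (hb : Best n M r h K g) :
    Run B choose g (n * (1000 * n + 130) + 100) (fun g' => g'.reg 0 = n ∧
      ∃ s u v : Fin n, g'.reg 12 = s ∧ g'.reg 20 = u ∧ g'.reg 21 = v ∧
        G.Best s u v (row g' 4 s) (row g' 5 s) (row g' 6 s)) := by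
  have hre : (g.reg 60 = 0 ∨ 2 * t + 1 < g.reg 60) →
      Run B retest g (n * (1000 * n + 130) + 60) (fun g' => g'.reg 0 = n ∧
      ∃ s u v : Fin n, g'.reg 12 = s ∧ g'.reg 20 = u ∧ g'.reg 21 = v ∧
        G.Best s u v (row g' 4 s) (row g' 5 s) (row g' 6 s)) := by
    intro hle
    have h1 : Run B (asg 11 (.var 40 + 1)) g 5 (fun g' => Fr [11] [] g g' ∧ g'.reg 11 = t + 1) :=
      Run.conseq (Run.asg (by simp [e40]; omega)
        ⟨(Fr.refl _ _ _).setReg (by decide), by simp [e40]⟩) (by decide) (fun _ h => h)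
    refine (h1.seq (T₂ := n * (1000 * n + 130) + 50) (fun g1 ⟨f1, e11⟩ => ?_)).conseq (by omega)
      (fun _ h => h)
    refine (run_test G L (b := 1) (t := t + 1) hB le_rfl (by omega) g1
      (hig.frame f1 (by decide) (by decide) (by decide)) (hL.frame f1 (by decide) (by decide))
      ((f1.1 10 (by decide)).trans e10) e11).conseq le_rfl (fun g2 ⟨f2, hres⟩ => ⟨?_, ?_⟩)
    · rw [f2.1 0 (by decide), f1.1 0 (by decide), hig.reg0]
    · rcases hres with ⟨-, hrows⟩ | ⟨-, hS⟩
      · obtain ⟨s, D, P, F, u, v, T, hC⟩ := hp.bad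
        exact absurd hC (T.not_closing_of_good (Or.inr hrows.good))
      · exact hS.best hi hR hn hp hb hle
  refine (Run.ifE (T := n * (1000 * n + 130) + 80) (by simp) (fun hc => ?_) (fun hc => ?_)).conseq
    (by simp only [Expr.cost]; omega) (fun _ h => h)
  · have hc0 : g.reg 60 ≠ 0 := hc
    have hcost : (Expr.lt (.var 60) (2 * .var 40 + 2)).cost = 7 := rfl
    refine (Run.ifE (T := n * (1000 * n + 130) + 60) ?_ (fun hc => ?_) (fun hc => ?_)).conseq
      (by rw [hcost]; omega) (fun _ h => h)
    · simp only [Expr.ok_lt, Expr.ok_add, Expr.ok_mul, Expr.ok_var, Expr.ok_ofNat, Expr.eval_mul,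
        Expr.eval_ofNat, Expr.eval_var, e40, Nat.reduceLeDiff, true_and]
      omega
    · have hlt : g.reg 60 < 2 * t + 2 := by by_contra h'; simp [e40, h'] at hc
      obtain ⟨s, x, y, e61, e62, e63, hbest⟩ := hb.best hi hR hn hp hc0 (by omega)
      refine Run.conseq (Stmt.run _ ?_) (T' := n * (1000 * n + 130) + 60)
        ((show _ ≤ 60 by decide).trans (by omega)) (fun _ h => h)
      simp only [Stmt.wp, Expr.ok_var, Expr.eval_var, Nat.reduceLeDiff, true_and, State.setReg_reg,
        reduceIte, Nat.reduceEqDiff, e61, e62, e63]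
      refine ⟨hig.reg0, s, x, y, rfl, rfl, rfl, ?_⟩
      unfold row at *
      simpa only [State.setReg_arr, harr 4 (by norm_num), harr 5 (by norm_num),
        harr 6 (by norm_num)] using hbest
    · have hlt : 2 * t + 2 ≤ g.reg 60 := by by_contra! h'; simp [e40, h'] at hc
      exact hre (Or.inr (by omega))
  · exact (hre (Or.inl hc)).conseq (by omega) (fun _ h => h)

/-- Find a minimum weight cycle in a graph with cycles. -/
def findCycle (P : Prog) : Prog :=
  .seq (asg 10 0) <| .seq search <|
  .seq (Stmt.seq (.asg 41 (.var 30)) <| .seq (.asg 10 1) (.asg 11 (.var 40))).code <|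
  .seq test <| .seq (allRounds P) <| .seq choose writeCycle

theorem Rows.distLe {G : WGraph n M} {t : ℕ} {h : State} (hR : Rows G 1 t h) (ht : t ≤ n * M) :
    DistLe n (n * M + M) h := by
  intro i hi hF
  have hn : 0 < n := Nat.pos_of_ne_zero (by rintro rfl; omega)
  have hlt : i / n < n := by rwa [Nat.div_lt_iff_lt_mul hn]
  obtain ⟨T, -⟩ := hR ⟨i / n, hlt⟩
  have he : i / n * n + i % n = i := by rw [mul_comm]; exact Nat.div_add_mod i n
  have h1 := T.D_le ⟨i % n, Nat.mod_lt _ hn⟩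
  simp only [row, he] at h1
  have := h1 hF
  omega

/-- The search for `r` overwrites the trees, so they are computed once more for `b = 1` and the
threshold `t`. That test cannot stop, as `t` is good or zero. -/
theorem run_findCycle {B B₀ t τ : ℕ} {P : Prog} (G : WGraph n M) (L : Fin n → List (Fin n))
    {h : State}
    (hB : n * n + 4 * (n * M) + 10 * n + 10 * M + 50 < B) (hi : Inp G h) (hL : Lists G L h)
    (hBK : (3 * n * (3 * n) + 3) * (n + 1) + 2 < B) (hB₀ : B₀ * (n + 1) ≤ B)
    (hX : P.regBound * (n + 1) ≤ B) (h3 : 3 * n < B₀) (h4 : 4 * M < B₀)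
    (hP : ∀ G' : WGraph (3 * n) (4 * M), ∃ t s, Exec B₀ P G'.input t s ∧
      MinTriangleOutput G' s.output ∧ t ≤ τ)
    (hcells : ∀ a i, 10 ≤ a → h.arr a i = 0) (e40 : h.reg 40 = t) (ht : t < n * M)
    (hgood : t = 0 ∨ G.Good 1 t) (hbad : G.Bad 1 (t + 1)) :
    Run B (findCycle P) h (Nat.clog 2 (n * M + 1) * (n * (1000 * n + 130) + 100) +
      (2 * (n * (1000 * n + 130)) +
      ((Nat.log 2 n + 1) * (3 * n * (3 * n) * 160 + 30 * τ + 260) + 130 * n + 1000)))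
      (fun g => MinCycleOutput G g.output) := by
  have s1 : Run B (asg 10 0) h 5 (fun g => Fr [10] [] h g ∧ g.reg 10 = 0) :=
    Run.conseq (Run.asg (show 0 < B by omega) ⟨(Fr.refl _ _ _).setReg (by decide), by simp⟩)
      (by decide) (fun _ h => h)
  -- Products are hidden behind variables so that the time estimates become linear for `omega`.
  obtain ⟨C, hC⟩ : ∃ C, C = (Nat.log 2 n + 1) * (3 * n * (3 * n) * 160 + 30 * τ + 260) := ⟨_, rfl⟩
  rw [← hC]
  obtain ⟨D, hD⟩ : ∃ D, D = n * (1000 * n + 130) := ⟨_, rfl⟩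
  rw [← hD]
  obtain ⟨S, hS⟩ : ∃ S, S = Nat.clog 2 (n * M + 1) * (D + 100) := ⟨_, rfl⟩
  rw [← hS]
  refine (s1.seq (T₂ := S + 2 * D + C + 130 * n + 990) (fun g1 ⟨f1, e10⟩ => ?_)).conseq (by omega)
    (fun _ h => h)
  refine ((run_search G L (b := 0) hB (by omega) g1 (hi.frame f1 (by decide) (by decide) (by decide))
    (hL.frame f1 (by decide) (by decide)) e10).seq (T₂ := 2 * D + C + 130 * n + 900)
    (fun g2 ⟨f2, r1, r2, r3⟩ => ?_)).conseq (by rw [← hD, ← hS]; omega) (fun _ h => h)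
  obtain ⟨r, hr⟩ : ∃ r, g2.reg 30 = r := ⟨_, rfl⟩
  rw [hr] at r1 r2 r3
  have hp : Params G t r := by
    refine ⟨fun v c hc => two_mul_lt_of_good r2 c hc, ?_, hbad⟩
    rcases r3 with r3 | r3
    -- The right end cannot be reached: some cycle exists, and it would weigh more than `2 * (n *
    -- M)`, whereas no cycle weighs more than `n * M`.
    · obtain ⟨v, c, hc, -⟩ := hbad.exists_cycle_one
      have := two_mul_lt_of_good r2 c hc
      have := G.walkWeight_le_of_isCycle c hc
      omega
    · obtain ⟨v, c, hc, hw⟩ := r3.exists_cycle_zero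
      exact ⟨v, c, hc, by omega⟩
  have s3 : Run B (Stmt.seq (.asg 41 (.var 30)) <| .seq (.asg 10 1) (.asg 11 (.var 40))).code g2 20
      (fun g => Fr [10, 11, 41] [] g2 g ∧ g.reg 41 = r ∧ g.reg 10 = 1 ∧ g.reg 11 = t) := by
    have g40 : g2.reg 40 = t := by rw [f2.1 40 (by decide), f1.1 40 (by decide), e40]
    refine Run.conseq (Stmt.run _ ?_) (by decide) (fun _ h => h)
    simp only [Stmt.wp, Expr.ok_var, Expr.eval_var, Expr.ok_ofNat, Expr.eval_ofNat, hr, g40,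
      Nat.reduceLeDiff, true_and, State.setReg_reg, reduceIte, Nat.reduceEqDiff]
    exact ⟨by omega, (((Fr.refl _ _ _).setReg (by decide)).setReg (by decide)).setReg (by decide),
      trivial⟩
  refine (s3.seq (T₂ := 2 * D + C + 130 * n + 800) (fun g3 ⟨f3, a41, a10, a11⟩ => ?_)).conseq
    (by omega) (fun _ h => h)
  have F3 : Fr [10, 11, 12, 13, 14, 15, 16, 17, 18, 19, 20, 21, 22, 30, 31, 41] [4, 5, 6, 7] h g3 :=
    (f1.trans f2 (by decide) (by decide) (by decide) (by decide) (S := [10, 11, 12, 13, 14, 15, 16,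
      17, 18, 19, 20, 21, 22, 30, 31, 41]) (C := [4, 5, 6, 7])).trans f3 (by decide) (by decide)
      (by decide) (by decide)
  refine ((run_test G L (b := 1) (t := t) hB le_rfl (by omega) g3
    (hi.frame F3 (by decide) (by decide) (by decide)) (hL.frame F3 (by decide) (by decide)) a10
    a11).seq (T₂ := D + C + 130 * n + 700) (fun g4 ⟨f4, hres⟩ => ?_)).conseq (by rw [← hD]; omega)
    (fun _ h => h)
  have F4 : Fr [10, 11, 12, 13, 14, 15, 16, 17, 18, 19, 20, 21, 22, 30, 31, 41] [4, 5, 6, 7] h g4 :=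
    F3.trans f4 (by decide) (by decide) (by decide) (by decide)
  have hR : Rows G 1 t g4 := by
    rcases hres with ⟨-, hR⟩ | ⟨-, s, -, T, -, u, v, -, -, hC⟩
    · exact hR
    · exact absurd hC (T.not_closing_of_good hgood)
  have hi4 := hi.frame F4 (by decide) (by decide) (by decide)
  have hL4 := hL.frame F4 (by decide) (by decide)
  refine ((run_allRounds G (r := r) (τ := τ) hB hi4 hBK hB₀ hX h3 h4 hP (hR.distLe ht.le)
    ((f4.1 41 (by decide)).trans a41) (fun a i ha => ?_)).seq (T₂ := D + 100 * n + 500)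
    (fun g5 ⟨k5, l5, K, hK, hb⟩ => ?_)).conseq (by rw [← hC]; omega) (fun _ h => h)
  · rw [F4.2 a (by simp; omega), hcells a i ha]
  have hi5 : Inp G g5 := ⟨by rw [k5 0 (by omega), hi4.reg0], by rw [k5 1 (by omega), hi4.reg1],
    fun i j => by rw [l5 0 (by omega), hi4.arr0]⟩
  have hL5 : Lists G L g5 := ⟨hL4.adj, by rw [l5 2 (by omega)]; exact hL4.row,
    by rw [l5 3 (by omega)]; exact hL4.deg⟩
  refine ((run_choose G L hB ht hi4 hi5 hL5 ?_ ?_ hR l5 hK hp hb).seq (T₂ := 100 * n + 200)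
    (fun g6 ⟨e0, s, u, v, e12, e20, e21, hbest⟩ => ?_)).conseq (by rw [← hD]; omega) (fun _ h => h)
  · rw [k5 10 (by omega), f4.1 10 (by decide), a10]
  · rw [k5 40 (by omega), F4.1 40 (by decide), e40]
  · exact run_writeCycle hB e0 e12 e20 e21 hbest

/-- Find a minimum weight cycle with the help of the program `P` for minimum weight triangles. -/
def cycleProg (P : Prog) : Prog :=
  .seq sortAll <| .seq (asg 10 1) <| .seq search <| .seq (asg 40 (.var 30)) <|
  ifE (.lt (.var 40) (.var 0 * .var 1)) (findCycle P) (asg 0 0)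

/-- If the first search ends at `n * M`, no cycle is light enough to exist and the empty list is
correct. Otherwise the next threshold is known to be bad, and a cycle exists. -/
theorem run_cycleProg {B B₀ τ : ℕ} {P : Prog} (G : WGraph n M)
    (hB : n * n + 4 * (n * M) + 10 * n + 10 * M + 50 < B)
    (hBK : (3 * n * (3 * n) + 3) * (n + 1) + 2 < B) (hB₀ : B₀ * (n + 1) ≤ B)
    (hX : P.regBound * (n + 1) ≤ B) (h3 : 3 * n < B₀) (h4 : 4 * M < B₀)
    (hP : ∀ G' : WGraph (3 * n) (4 * M), ∃ t s, Exec B₀ P G'.input t s ∧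
      MinTriangleOutput G' s.output ∧ t ≤ τ) :
    Run B (cycleProg P) G.input (n * ((Nat.log 2 M + 1) * (150 * n + 60) + 50 * n + 60) +
      2 * (Nat.clog 2 (n * M + 1) * (n * (1000 * n + 130) + 100)) +
      (2 * (n * (1000 * n + 130)) +
      ((Nat.log 2 n + 1) * (3 * n * (3 * n) * 160 + 30 * τ + 260) + 130 * n + 1200)))
      (fun g => MinCycleOutput G g.output) := by
  have hi : Inp G G.input := ⟨by simp [input], by simp [input], G.input_arr_zero⟩
  obtain ⟨C, hC⟩ : ∃ C, C = Nat.clog 2 (n * M + 1) * (n * (1000 * n + 130) + 100) +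
      (2 * (n * (1000 * n + 130)) +
      ((Nat.log 2 n + 1) * (3 * n * (3 * n) * 160 + 30 * τ + 260) + 130 * n + 1000)) := ⟨_, rfl⟩
  refine ((run_sortAll G hB G.input hi).seq
    (T₂ := Nat.clog 2 (n * M + 1) * (n * (1000 * n + 130) + 100) + C + 100)
    (fun g1 ⟨f1, L, hL⟩ => ?_)).conseq (by omega) (fun _ h => h)
  have s1 : Run B (asg 10 1) g1 5 (fun g => Fr [10] [] g1 g ∧ g.reg 10 = 1) :=
    Run.conseq (Run.asg (show 1 < B by omega) ⟨(Fr.refl _ _ _).setReg (by decide), by simp⟩)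
      (by decide) (fun _ h => h)
  refine (s1.seq (T₂ := Nat.clog 2 (n * M + 1) * (n * (1000 * n + 130) + 100) + C + 90)
    (fun g2 ⟨f2, e10⟩ => ?_)).conseq (by omega) (fun _ h => h)
  have F2 : Fr [2, 3, 4, 5, 6, 7, 10] [2, 3, 8] G.input g2 :=
    f1.trans f2 (by decide) (by decide) (by decide) (by decide)
  refine ((run_search G L (b := 1) hB le_rfl g2 (hi.frame F2 (by decide) (by decide) (by decide))
    (hL.frame f2 (by decide) (by decide)) e10).seq (T₂ := C + 40)
    (fun g3 ⟨f3, r1, r2, r3⟩ => ?_)).conseq (by omega) (fun _ h => h)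
  have s3 : Run B (asg 40 (.var 30)) g3 5 (fun g => Fr [40] [] g3 g ∧ g.reg 40 = g3.reg 30) :=
    Run.conseq (Run.asg (by simp) ⟨(Fr.refl _ _ _).setReg (by decide), by simp⟩)
      (by decide) (fun _ h => h)
  refine (s3.seq (T₂ := C + 30) (fun g4 ⟨f4, e40⟩ => ?_)).conseq (by omega) (fun _ h => h)
  have F3 : Fr [2, 3, 4, 5, 6, 7, 10, 11, 12, 13, 14, 15, 16, 17, 18, 19, 20, 21, 22, 30, 31, 40]
      [2, 3, 4, 5, 6, 7, 8] G.input g3 :=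
    F2.trans f3 (by decide) (by decide) (by decide) (by decide)
  have F4 : Fr [2, 3, 4, 5, 6, 7, 10, 11, 12, 13, 14, 15, 16, 17, 18, 19, 20, 21, 22, 30, 31, 40]
      [2, 3, 4, 5, 6, 7, 8] G.input g4 :=
    F3.trans f4 (by decide) (by decide) (by decide) (by decide)
  have hi4 : Inp G g4 := hi.frame F4 (by decide) (by decide) (by decide)
  have hL4 : Lists G L g4 :=
    ((hL.frame f2 (by decide) (by decide)).frame f3 (by decide) (by decide)).frame f4 (by decide)
      (by decide)
  have hcost : (Expr.lt (.var 40) (.var 0 * .var 1)).cost = 5 := rfl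
  refine (Run.ifE (T := C + 10) ?_ (fun hc => ?_) (fun hc => ?_)).conseq (by rw [hcost]; omega)
    (fun _ h => h)
  · simp only [Expr.ok_lt, Expr.ok_mul, Expr.ok_var, Expr.eval_var, hi4.reg0, hi4.reg1,
      Nat.reduceLeDiff, true_and]
    omega
  · have hlt : g3.reg 30 < n * M := by
      by_contra h'; simp [e40, hi4.reg0, hi4.reg1, h'] at hc
    refine (run_findCycle G L (t := g3.reg 30) hB hi4 hL4 hBK hB₀ hX h3 h4 hP (fun a i ha => ?_)
      e40 hlt r2 (r3.resolve_left (by omega))).conseq (by rw [← hC]; omega) (fun _ h => h)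
    rw [F4.2 a (by simp; omega)]
    have : a ≠ 0 := by omega
    simp [input, this]
  · have hle : n * M ≤ g3.reg 30 := by
      by_contra! h'; simp [e40, hi4.reg0, hi4.reg1, h'] at hc
    refine Run.conseq (Run.asg (show 0 < B by omega) ?_) ((show _ ≤ 10 by decide).trans (by omega))
      (fun _ h => h)
    refine Or.inl ⟨by simp [State.output], fun v c hcyc => ?_⟩
    have h1 := G.walkWeight_le_of_isCycle c hcyc
    have h2 := G.length_le_walkWeight c
    have h3 := hcyc.three_le_length
    rcases r2 with r2 | r2
    · omega
    · have := lt_of_good r2 c hcyc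
      omega

end WordRAM


/-! ### Time bounds and conclusion -/

namespace WordRAM

open WGraph

variable {n M : ℕ}

/-- For `n = 0` there is no promised time bound, but a common one for all graphs is needed; it is
the running time on the only graph. -/
instance {M : ℕ} : Subsingleton (WGraph 0 M) :=
  ⟨fun G H => by
    obtain ⟨g, w, h⟩ := G
    obtain ⟨g', w', h'⟩ := H
    obtain rfl : g = g' := Subsingleton.elim _ _
    obtain rfl : w = w' := funext fun e => isEmptyElim e
    rfl⟩

/-- For `x ≥ 2` the left side is at most twice the binary logarithm of `x`, and `2 / log 2 < 3`. -/
theorem natLog_succ_le_log {x : ℕ} (hx : 2 ≤ x) : ((Nat.log 2 x + 1 : ℕ) : ℝ) ≤ 3 * Real.log x := by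
  have h2 := Real.log_two_gt_d9
  have hx' : (2 : ℝ) ≤ x := by exact_mod_cast hx
  have h1 : ((2 ^ Nat.log 2 x : ℕ) : ℝ) ≤ x := by exact_mod_cast Nat.pow_log_le_self 2 (by omega)
  have h3 : (Nat.log 2 x : ℝ) * Real.log 2 ≤ Real.log x := by
    rw [← Real.log_pow]
    exact Real.log_le_log (by positivity) (by exact_mod_cast h1)
  have h4 : Real.log 2 ≤ Real.log x := Real.log_le_log (by norm_num) hx'
  have h5 : (0 : ℝ) ≤ Nat.log 2 x := by positivity
  push_cast
  nlinarith

/-- Lower order terms are absorbed by `x ≥ 2` and by the lower bounds `1 / 2` on both logarithms. -/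
theorem real_time_bound {x k l t L K : ℝ} (hx : 2 ≤ x) (hk0 : 0 ≤ k) (hl0 : 0 ≤ l) (ht0 : 0 ≤ t)
    (hL : l ≤ 3 * L) (hK : k ≤ 3 * K) (hL0 : 1 / 2 ≤ L) (hK0 : 1 / 2 ≤ K) :
    x * (k * (150 * x + 60) + 50 * x + 60) + 2 * (k * (x * (1000 * x + 130) + 100)) +
      (2 * (x * (1000 * x + 130)) +
        (l * (3 * x * (3 * x) * 160 + 30 * t + 260) + 130 * x + 1200)) ≤
      100000 * (t * L + x ^ 2 * L * K) := by
  have hn1 : x ≤ x ^ 2 / 2 := by nlinarith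
  have hn2 : 1 ≤ x ^ 2 / 4 := by nlinarith
  have e1 : k * x ≤ k * (x ^ 2 / 2) := mul_le_mul_of_nonneg_left hn1 hk0
  have e2 : k * 1 ≤ k * (x ^ 2 / 4) := mul_le_mul_of_nonneg_left hn2 hk0
  have e3 : l * 1 ≤ l * (x ^ 2 / 4) := mul_le_mul_of_nonneg_left hn2 hl0
  have e4 : l * t ≤ 3 * L * t := mul_le_mul_of_nonneg_right hL ht0
  have e5 : k * x ^ 2 ≤ 3 * K * x ^ 2 := mul_le_mul_of_nonneg_right hK (sq_nonneg x)
  have e6 : l * x ^ 2 ≤ 3 * L * x ^ 2 := mul_le_mul_of_nonneg_right hL (sq_nonneg x)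
  have e7 : K ≤ 2 * (L * K) := by nlinarith
  have e8 : L ≤ 2 * (L * K) := by nlinarith
  have e9 : 1 ≤ 4 * (L * K) := by nlinarith
  have f1 : K * x ^ 2 ≤ 2 * (L * K) * x ^ 2 := mul_le_mul_of_nonneg_right e7 (sq_nonneg x)
  have f2 : L * x ^ 2 ≤ 2 * (L * K) * x ^ 2 := mul_le_mul_of_nonneg_right e8 (sq_nonneg x)
  have f3 : 1 * x ^ 2 ≤ 4 * (L * K) * x ^ 2 := mul_le_mul_of_nonneg_right e9 (sq_nonneg x)
  have f4 : 0 ≤ t * L := mul_nonneg ht0 (by linarith)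
  linarith

theorem time_bound {τ : ℕ} (hn : 2 ≤ n) (hM : 1 ≤ M) :
    ((n * ((Nat.log 2 M + 1) * (150 * n + 60) + 50 * n + 60) +
      2 * (Nat.clog 2 (n * M + 1) * (n * (1000 * n + 130) + 100)) +
      (2 * (n * (1000 * n + 130)) + ((Nat.log 2 n + 1) *
        (3 * n * (3 * n) * 160 + 30 * τ + 260) + 130 * n + 1200)) : ℕ) : ℝ) ≤
      100000 * (τ * Real.log n + (n : ℝ) ^ 2 * Real.log n * Real.log (n * M)) := by
  set l := Nat.log 2 n + 1 with hl
  set k := Nat.log 2 (n * M) + 1 with hk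
  have hnM : n ≤ n * M := Nat.le_mul_of_pos_right n hM
  have hMn : M ≤ n * M := Nat.le_mul_of_pos_left M (by omega)
  have hc : Nat.clog 2 (n * M + 1) ≤ k :=
    Nat.clog_le_of_le_pow (Nat.lt_pow_succ_log_self (by norm_num) _)
  have hm : Nat.log 2 M + 1 ≤ k := Nat.succ_le_succ (Nat.log_mono_right hMn)
  have h1 : n * ((Nat.log 2 M + 1) * (150 * n + 60) + 50 * n + 60) +
      2 * (Nat.clog 2 (n * M + 1) * (n * (1000 * n + 130) + 100)) +
      (2 * (n * (1000 * n + 130)) + (l * (3 * n * (3 * n) * 160 + 30 * τ + 260) + 130 * n + 1200)) ≤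
      n * (k * (150 * n + 60) + 50 * n + 60) + 2 * (k * (n * (1000 * n + 130) + 100)) +
      (2 * (n * (1000 * n + 130)) +
        (l * (3 * n * (3 * n) * 160 + 30 * τ + 260) + 130 * n + 1200)) := by
    gcongr
  refine (Nat.cast_le.2 h1).trans ?_
  have hL := natLog_succ_le_log hn
  have hK := natLog_succ_le_log (hn.trans hnM)
  rw [← hl] at hL
  rw [← hk] at hK
  push_cast at hK ⊢
  have hlog := Real.log_two_gt_d9
  have hn' : (2 : ℝ) ≤ n := by exact_mod_cast hn
  have hL0 : 1 / 2 ≤ Real.log n :=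
    le_trans (by linarith) (Real.log_le_log (by norm_num) hn')
  have hK0 : 1 / 2 ≤ Real.log (n * M) := by
    refine le_trans (by linarith) (Real.log_le_log (by norm_num : (0 : ℝ) < 2) ?_)
    exact_mod_cast hn.trans hnM
  have hk0 : (0 : ℝ) ≤ k := Nat.cast_nonneg _
  have hl0 : (0 : ℝ) ≤ l := Nat.cast_nonneg _
  exact real_time_bound hn' hk0 hl0 (Nat.cast_nonneg _) hL hK hL0 hK0

theorem cycleProg_solves {P : Prog} {T : ℕ → ℕ → ℝ} (hP : SolvesInTime MinTriangleOutput P T) :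
    SolvesInTime MinCycleOutput (cycleProg P) (fun n M => (100000 : ℕ) *
      (T (3 * n) (4 * M) * Real.log n + (n : ℝ) ^ 2 * Real.log n * Real.log (n * M))) := by
  obtain ⟨c, hc⟩ := hP
  -- With `X = n + M + 1` one has `3n + 4M + 1 ≤ X ^ 3`, which explains `3 * c`. Simulated register
  -- names need `P.regBound ≤ X ^ P.regBound`. The rest covers polynomial factors and constants.
  refine ⟨3 * c + P.regBound + 20, fun n M hM G => ?_⟩
  set X := n + M + 1 with hXdef
  set B := X ^ (3 * c + P.regBound + 20) with hBdef
  -- The exponent `c + 1` instead of `c` ensures that `3 * n` and `4 * M` are words even for `c =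
  -- 0`.
  set B₀ := (3 * n + 4 * M + 1) ^ (c + 1) with hB₀def
  have hX : 2 ≤ X := by omega
  have hpow : ∀ e, e ≤ 3 * c + P.regBound + 20 → X ^ e ≤ B := fun e he =>
    Nat.pow_le_pow_right (by omega) he
  have hX3 : 3 * n + 4 * M + 1 ≤ X ^ 3 := by
    calc 3 * n + 4 * M + 1 ≤ 2 ^ 2 * X := by omega
      _ ≤ X ^ 2 * X := Nat.mul_le_mul_right _ (Nat.pow_le_pow_left hX 2)
      _ = X ^ 3 := by ring
  have hB64 : 64 * X ^ 3 ≤ B := by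
    calc 64 * X ^ 3 = 2 ^ 6 * X ^ 3 := by norm_num
      _ ≤ X ^ 6 * X ^ 3 := Nat.mul_le_mul_right _ (Nat.pow_le_pow_left hX 6)
      _ = X ^ 9 := by ring
      _ ≤ B := hpow 9 (by omega)
  have hself : 3 * n + 4 * M + 1 ≤ B₀ := Nat.le_self_pow (by omega) _
  have hB : n * n + 4 * (n * M) + 10 * n + 10 * M + 50 < B := by
    refine lt_of_lt_of_le ?_ hB64
    have : X ^ 2 * 2 ≤ X ^ 3 := by rw [pow_succ X 2]; exact Nat.mul_le_mul_left _ hX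
    have h2 : X ^ 2 = n * n + 2 * (n * M) + M * M + 2 * n + 2 * M + 1 := by rw [hXdef]; ring
    linarith [Nat.zero_le (n * n), Nat.zero_le (n * M), Nat.zero_le (M * M)]
  have hBK : (3 * n * (3 * n) + 3) * (n + 1) + 2 < B := by
    refine lt_of_lt_of_le ?_ hB64
    have h1 : 3 * n * (3 * n) + 3 ≤ 9 * X ^ 2 := by nlinarith
    have h2 : (3 * n * (3 * n) + 3) * (n + 1) ≤ 9 * X ^ 2 * X := Nat.mul_le_mul h1 (by omega)
    have h3 : 2 ^ 3 ≤ X ^ 3 := Nat.pow_le_pow_left hX 3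
    linarith [pow_succ X 2]
  have hB₀ : B₀ * (n + 1) ≤ B := by
    calc B₀ * (n + 1) ≤ (X ^ 3) ^ (c + 1) * X :=
          Nat.mul_le_mul (Nat.pow_le_pow_left hX3 _) (by omega)
      _ = X ^ (3 * c + 4) := by rw [← pow_mul]; ring
      _ ≤ B := hpow _ (by omega)
  have hXB : P.regBound * (n + 1) ≤ B := by
    calc P.regBound * (n + 1) ≤ X ^ P.regBound * X :=
          Nat.mul_le_mul ((Nat.lt_two_pow_self).le.trans (Nat.pow_le_pow_left hX _)) (by omega)
      _ = X ^ (P.regBound + 1) := by ring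
      _ ≤ B := hpow _ (by omega)
  obtain ⟨τ, hτ, hτT⟩ : ∃ τ : ℕ, (∀ G' : WGraph (3 * n) (4 * M), ∃ t s,
      Exec B₀ P G'.input t s ∧ MinTriangleOutput G' s.output ∧ t ≤ τ) ∧
      (2 ≤ n → (τ : ℝ) ≤ T (3 * n) (4 * M)) := by
    have hmono : (3 * n + 4 * M + 1) ^ c ≤ B₀ := Nat.pow_le_pow_right (by omega) (by omega)
    let G₀ : WGraph (3 * n) (4 * M) := ⟨⊥, fun _ => 0, by simp⟩
    obtain ⟨t₀, s₀, hex₀, hout₀, htime₀⟩ := hc (3 * n) (4 * M) (by omega) G₀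
    rcases Nat.eq_zero_or_pos n with rfl | hn
    · exact ⟨t₀, fun G' => ⟨t₀, s₀, (Subsingleton.elim (α := WGraph 0 _) G₀ G') ▸ ⟨hex₀.mono hmono, hout₀, le_rfl⟩⟩,
        by omega⟩
    -- The bound `T` is an arbitrary real function; its value here is nonnegative because it bounds
    -- the number of steps of an actual run, for which the edgeless graph serves. The promise
    -- applies as `3 * n ≥ 2`.
    · refine ⟨⌊T (3 * n) (4 * M)⌋₊, fun G' => ?_, fun _ => Nat.floor_le ?_⟩
      · obtain ⟨t, s, hex, hout, htime⟩ := hc (3 * n) (4 * M) (by omega) G'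
        exact ⟨t, s, hex.mono hmono, hout, Nat.le_floor (htime (by omega))⟩
      · exact (Nat.cast_nonneg t₀).trans (htime₀ (by omega))
  obtain ⟨t, s, h, hex, ht, hr, hq⟩ :=
    run_cycleProg G hB hBK hB₀ hXB (by omega) (by omega) hτ G.input
      ⟨rfl, fun _ _ => rfl, G.input_bounded (by omega) (by omega)⟩
  refine ⟨t, s, hex, ?_, fun hn => ?_⟩
  · have : s.output = h.output := by
      rw [State.output, State.output, hr.arr, hr.reg 0 (fun h => by have := h.1; omega)]
    rw [this]
    exact hq
  · have hlog : 0 ≤ Real.log n := Real.log_natCast_nonneg n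
    refine (Nat.cast_le.2 ht).trans ((time_bound hn hM).trans ?_)
    have := hτT hn
    push_cast
    gcongr

end WordRAM


theorem mainTheorem6 :
    (∃ a b C : ℕ, ∀ T : ℕ → ℕ → ℝ,
      (∃ P : WordRAM.Prog, SolvesInTime MinCycleOutput P T) →
        ∃ Q : WordRAM.Prog, SolvesInTime MinTriangleOutput Q
          (fun n M => T (a * n) (b * M) + C * (n : ℝ) ^ 2)) ∧
    (∃ a b C : ℕ, ∀ T : ℕ → ℕ → ℝ,
      (∃ P : WordRAM.Prog, SolvesInTime MinTriangleOutput P T) →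
        ∃ Q : WordRAM.Prog, SolvesInTime MinCycleOutput Q
          (fun n M => C * (T (a * n) (b * M) * Real.log n +
            (n : ℝ) ^ 2 * Real.log n * Real.log (n * M)))) :=
  ⟨⟨1, 4, 100, fun _ ⟨_, hP⟩ => ⟨_, triangleProg_solves hP⟩⟩,
    ⟨3, 4, 100000, fun _ ⟨_, hP⟩ => ⟨_, WordRAM.cycleProg_solves hP⟩⟩⟩
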